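/- Let $(X,\Sigma,\mu)$ be a $\sigma$-finite measure space and let $\omega:X\to\mathbb{R}$ be measurable with $\omega\ge m$ almost everywhere for some $m>0$. Let $\mathcal{F}=\bigoplus_{n\ge 0}S_nL^2(X)^{\otimes n}$ be the bosonic Fock space over $L^2(X)$, with creation and annihilation operators $a^*(f),a(f)$, $f\in L^2(X)$, and let $\mathrm{d}\Gamma(\omega)$ be the second quantization of $\omega$, i.e. the self-adjoint operator acting on the $n$-boson sector as multiplication by $\omega(k_1)+\dots+\omega(k_n)$. Let $D\in\mathbb{N}$ and $\mathfrak{H}=\mathbb{C}^D\otimes\mathcal{F}$. Let $K\in\mathbb{C}^{D\times D}$ be Hermitian and let $B\in\mathbb{C}^{D\times D}$ be unitary, and assume that there is an orthonormal basis $(v_k)_{k=1}^D$ of $\mathbb{C}^D$ consisting of eigenvectors of $K$ such that for every $1\le k\le D$ there is some $1\le k'\le D$ with $Bv_k=v_{k'}$. Let $(f_\Lambda)_{\Lambda\in\mathbb{N}}\subset L^2(X)$ satisfy $\Vert\omega^{-1}f_\Lambda\Vert_{L^2}\to\infty$ as $\Lambda\to\infty$, and put $$H_\Lambda:=K\otimes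 1+1\otimes\mathrm{d}\Gamma(\omega)+B\otimes a^*(f_\Lambda)+B^*\otimes a(f_\Lambda)\quad\text{on }\mathbb{C}^D\otimes\operatorname{Dom}(\mathrm{d}\Gamma(\omega)),\qquad E_\Lambda:=-B^*B\int_X\frac{|f_\Lambda(k)|^2}{\omega(k)}\,\mathrm{d}\mu(k).$$ Then there exist a real diagonal matrix $\eta_0\in\mathbb{C}^{D\times D}$ and unitary operators $W_\Lambda:\mathfrak{H}\to\mathfrak{H}$, $\Lambda\in\mathbb{N}$, such that $$W_\Lambda\,(H_\Lambda-E_\Lambda\otimes 1)\,W_\Lambda^*\;\longrightarrow\;\eta_0\otimes 1+1\otimes\mathrm{d}\Gamma(\omega)\qquad\text{as }\Lambda\to\infty$$ in the norm resolvent sense: all these operators are self-adjoint, and for every $z\in\mathbb{C}\setminus\mathbb{R}$ their resolvents at $z$ converge in operator norm. -/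

import Mathlib

open MeasureTheory Filter Topology
open scoped ENNReal

noncomputable section

namespace GSB

/-! ### The bosonic Fock space over `L²(X, μ)` -/

section Fock

variable {X : Type*} [MeasurableSpace X] (μ : Measure X) [SigmaFinite μ]

/-- The unsymmetrized `n`-boson space `L²(Xⁿ, μⁿ) = L²(X, μ)^{⊗ n}`. -/
abbrev NBody (n : ℕ) : Type _ := Lp ℂ 2 (Measure.pi (fun _ : Fin n => μ))

theorem measurePreserving_perm (n : ℕ) (σ : Equiv.Perm (Fin n)) :
    MeasurePreserving (fun k : Fin n → X => fun i => k (σ i))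
      (Measure.pi (fun _ : Fin n => μ)) (Measure.pi (fun _ : Fin n => μ)) := by
  have h := measurePreserving_piCongrLeft (fun _ : Fin n => μ) σ.symm
  convert! h using 1
  funext k i
  have := MeasurableEquiv.piCongrLeft_apply_apply (β := fun _ : Fin n => X) σ.symm k (σ i)
  simpa using this.symm

/-- The `n`-boson space `S_n L²(X, μ)^{⊗ n}`: the permutation-symmetric elements of
`L²(Xⁿ, μⁿ)`. -/
def symSpace (n : ℕ) : Submodule ℂ (NBody μ n) where
  carrier := {ψ | ∀ σ : Equiv.Perm (Fin n),
    (fun k : Fin n → X => ψ (fun i => k (σ i))) =ᵐ[Measure.pi (fun _ : Fin n => μ)] ψ}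
  zero_mem' := fun σ => by
    have h := Lp.coeFn_zero ℂ 2 (Measure.pi (fun _ : Fin n => μ))
    have h' := (measurePreserving_perm μ n σ).quasiMeasurePreserving.ae h
    filter_upwards [h, h'] with k hk hk'
    rw [hk, hk']
    rfl
  add_mem' := fun {a b} ha hb σ => by
    have h := Lp.coeFn_add a b
    have h' := (measurePreserving_perm μ n σ).quasiMeasurePreserving.ae h
    filter_upwards [h, h', ha σ, hb σ] with k hk hk' h1 h2
    rw [hk, hk', Pi.add_apply, Pi.add_apply, h1, h2]
  smul_mem' := fun c a ha σ => by
    have h := Lp.coeFn_smul c a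
    have h' := (measurePreserving_perm μ n σ).quasiMeasurePreserving.ae h
    filter_upwards [h, h', ha σ] with k hk hk' h1
    rw [hk, hk', Pi.smul_apply, Pi.smul_apply, h1]

theorem isClosed_symSpace (n : ℕ) : IsClosed (symSpace μ n : Set (NBody μ n)) := by
  have : (symSpace μ n : Set (NBody μ n)) = ⋂ σ : Equiv.Perm (Fin n),
      {ψ | Lp.compMeasurePreserving _ (measurePreserving_perm μ n σ) ψ = ψ} := by
    ext ψ
    simp only [Set.mem_iInter, Set.mem_ofPred_eq]
    refine forall_congr' fun σ => ?_
    have h := Lp.coeFn_compMeasurePreserving ψ (measurePreserving_perm μ n σ)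
    constructor
    · intro hψ
      exact Lp.ext (h.trans hψ)
    · intro hψ
      rw [hψ] at h
      exact h.symm
  rw [this]
  exact isClosed_iInter fun σ =>
    isClosed_eq (Lp.isometry_compMeasurePreserving _).continuous continuous_id

instance instCompleteSpaceSymSpace (n : ℕ) : CompleteSpace (symSpace μ n) :=
  (isClosed_symSpace μ n).completeSpace_coe

/-- The bosonic Fock space over `L²(X, μ)`: the Hilbert space direct sum of all `n`-boson
spaces. -/
abbrev Fock : Type _ := lp (fun n : ℕ => symSpace μ n) 2

theorem memℓp_two_iff {E : ℕ → Type*} [∀ n, NormedAddCommGroup (E n)] (ψ : ∀ n, E n) :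
    Memℓp ψ 2 ↔ Summable fun n => ‖ψ n‖ ^ 2 := by
  rw [memℓp_gen_iff (by norm_num)]
  simp

/-! ### Second quantization of the dispersion relation -/

/-- The graph of `dΓ(ω)`: all pairs `(ψ, φ)` of Fock vectors with
`φ⁽ⁿ⁾(k₁, …, kₙ) = (ω(k₁) + ⋯ + ω(kₙ)) ψ⁽ⁿ⁾(k₁, …, kₙ)` for all `n`. -/
def dGammaGraph (ω : X → ℝ) : Submodule ℂ (Fock μ × Fock μ) where
  carrier := {p | ∀ n : ℕ, ((p.2 n : NBody μ n) : (Fin n → X) → ℂ)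
    =ᵐ[Measure.pi (fun _ : Fin n => μ)]
      fun k => ((∑ j, ω (k j) : ℝ) : ℂ) * (p.1 n : NBody μ n) k}
  zero_mem' := fun n => by
    have h := Lp.coeFn_zero ℂ 2 (Measure.pi (fun _ : Fin n => μ))
    filter_upwards [h] with k hk
    have e : (((0 : Fock μ × Fock μ).1 n : symSpace μ n) : NBody μ n) = 0 := rfl
    have e' : (((0 : Fock μ × Fock μ).2 n : symSpace μ n) : NBody μ n) = 0 := rfl
    rw [e, e', hk]
    simp
  add_mem' := fun {p q} hp hq n => by
    have h1 := Lp.coeFn_add (p.1 n : NBody μ n) (q.1 n : NBody μ n)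
    have h2 := Lp.coeFn_add (p.2 n : NBody μ n) (q.2 n : NBody μ n)
    filter_upwards [h1, h2, hp n, hq n] with k h1 h2 h3 h4
    have e : (((p + q).1 n : symSpace μ n) : NBody μ n) = (p.1 n : NBody μ n) + (q.1 n) := rfl
    have e' : (((p + q).2 n : symSpace μ n) : NBody μ n) = (p.2 n : NBody μ n) + (q.2 n) := rfl
    rw [e, e', h1, h2, Pi.add_apply, Pi.add_apply, h3, h4]
    ring
  smul_mem' := fun c p hp n => by
    have h1 := Lp.coeFn_smul c (p.1 n : NBody μ n)
    have h2 := Lp.coeFn_smul c (p.2 n : NBody μ n)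
    filter_upwards [h1, h2, hp n] with k h1 h2 h3
    have e : (((c • p).1 n : symSpace μ n) : NBody μ n) = c • (p.1 n : NBody μ n) := rfl
    have e' : (((c • p).2 n : symSpace μ n) : NBody μ n) = c • (p.2 n : NBody μ n) := rfl
    rw [e, e', h1, h2, Pi.smul_apply, Pi.smul_apply, h3]
    simp only [smul_eq_mul]
    ring

/-- `dΓ(ω)` on its maximal domain, i.e. on all `ψ` for which the sectors
`(ω(k₁) + ⋯ + ω(kₙ)) ψ⁽ⁿ⁾` form a vector of the Fock space. -/
def dGamma (ω : X → ℝ) : Fock μ →ₗ.[ℂ] Fock μ := (dGammaGraph μ ω).toLinearPMap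

/-- The graph above is single-valued, so `dGamma` has exactly this graph. -/
theorem dGamma_graph (ω : X → ℝ) : (dGamma μ ω).graph = dGammaGraph μ ω := by
  refine Submodule.toLinearPMap_graph_eq _ fun p hp hp0 => ?_
  apply lp.ext
  funext n
  apply Subtype.ext
  apply Lp.ext
  have h := Lp.coeFn_zero ℂ 2 (Measure.pi (fun _ : Fin n => μ))
  filter_upwards [hp n, h] with k hk h0
  rw [hk, hp0]
  have e : (((0 : Fock μ) n : symSpace μ n) : NBody μ n) = 0 := rfl
  rw [e, h0]
  simp

/-! ### Creation and annihilation operators -/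

variable {μ}

theorem memLp_tensor (f : Lp ℂ 2 μ) (n : ℕ) (j : Fin (n + 1)) (ψ : NBody μ n) :
    MemLp (fun k : Fin (n + 1) → X => f (k j) * ψ (fun i => k (j.succAbove i))) 2
      (Measure.pi (fun _ : Fin (n + 1) => μ)) ∧
    eLpNorm (fun k : Fin (n + 1) → X => f (k j) * ψ (fun i => k (j.succAbove i))) 2
      (Measure.pi (fun _ : Fin (n + 1) => μ)) = ‖f‖ₑ * ‖ψ‖ₑ := by
  have hmp := measurePreserving_piFinSuccAbove (fun _ : Fin (n + 1) => μ) j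
  have hf := Lp.aestronglyMeasurable f
  have hψ := Lp.aestronglyMeasurable ψ
  set g : X × (Fin n → X) → ℂ := fun p => f p.1 * ψ p.2 with hg
  have hgm : AEStronglyMeasurable g (μ.prod (Measure.pi (fun _ : Fin n => μ))) :=
    (hf.comp_fst).mul (hψ.comp_snd)
  have hgn : eLpNorm g 2 (μ.prod (Measure.pi (fun _ : Fin n => μ))) = ‖f‖ₑ * ‖ψ‖ₑ := by
    rw [Lp.enorm_def, Lp.enorm_def]
    simp only [eLpNorm_eq_lintegral_rpow_enorm_toReal (two_ne_zero) (ENNReal.ofNat_ne_top)]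
    rw [← ENNReal.mul_rpow_of_nonneg _ _ (by positivity)]
    congr 1
    rw [← lintegral_prod_mul (hf.enorm.pow_const _) (hψ.enorm.pow_const _)]
    refine lintegral_congr fun p => ?_
    rw [hg]
    simp only [enorm_mul]
    rw [ENNReal.mul_rpow_of_nonneg _ _ (by positivity)]
  have hgL : MemLp g 2 (μ.prod (Measure.pi (fun _ : Fin n => μ))) :=
    ⟨hgm, by rw [hgn]; exact ENNReal.mul_lt_top enorm_lt_top enorm_lt_top⟩
  have e : (fun k : Fin (n + 1) → X => f (k j) * ψ (fun i => k (j.succAbove i)))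
      = g ∘ (MeasurableEquiv.piFinSuccAbove (fun _ : Fin (n + 1) => X) j) := rfl
  rw [e]
  exact ⟨hgL.comp_measurePreserving hmp, by rw [eLpNorm_comp_measurePreserving hgm hmp, hgn]⟩

theorem quasiMeasurePreserving_succAbove (n : ℕ) (j : Fin (n + 1)) :
    Measure.QuasiMeasurePreserving (fun k : Fin (n + 1) → X => fun i => k (j.succAbove i))
      (Measure.pi (fun _ : Fin (n + 1) => μ)) (Measure.pi (fun _ : Fin n => μ)) :=
  Measure.quasiMeasurePreserving_snd.comp
    (measurePreserving_piFinSuccAbove (fun _ : Fin (n + 1) => μ) j).quasiMeasurePreserving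

/-- The map `ψ ↦ f(k_j) ψ(k₁, …, k_{j-1}, k_{j+1}, …, k_{n+1})` from `L²(Xⁿ)` to `L²(Xⁿ⁺¹)`. -/
def insertAt (f : Lp ℂ 2 μ) (n : ℕ) (j : Fin (n + 1)) : NBody μ n →L[ℂ] NBody μ (n + 1) :=
  LinearMap.mkContinuous
    { toFun := fun ψ => (memLp_tensor f n j ψ).1.toLp _
      map_add' := fun ψ φ => by
        rw [← MemLp.toLp_add]
        apply MemLp.toLp_congr
        have h := (quasiMeasurePreserving_succAbove (μ := μ) n j).ae (Lp.coeFn_add ψ φ)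
        filter_upwards [h] with k hk
        rw [Pi.add_apply, hk, Pi.add_apply]
        ring
      map_smul' := fun c ψ => by
        rw [RingHom.id_apply, ← MemLp.toLp_const_smul]
        apply MemLp.toLp_congr
        have h := (quasiMeasurePreserving_succAbove (μ := μ) n j).ae (Lp.coeFn_smul c ψ)
        filter_upwards [h] with k hk
        rw [Pi.smul_apply, hk, Pi.smul_apply]
        simp only [smul_eq_mul]
        ring }
    ‖f‖ (fun ψ => by
      change ‖(memLp_tensor f n j ψ).1.toLp _‖ ≤ _
      rw [Lp.norm_toLp, (memLp_tensor f n j ψ).2, ENNReal.toReal_mul, toReal_enorm, toReal_enorm])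

theorem coeFn_insertAt (f : Lp ℂ 2 μ) (n : ℕ) (j : Fin (n + 1)) (ψ : NBody μ n) :
    insertAt f n j ψ =ᵐ[Measure.pi (fun _ : Fin (n + 1) => μ)]
      fun k => f (k j) * ψ (fun i => k (j.succAbove i)) :=
  MemLp.coeFn_toLp (memLp_tensor f n j ψ).1

theorem norm_insertAt_le (f : Lp ℂ 2 μ) (n : ℕ) (j : Fin (n + 1)) : ‖insertAt f n j‖ ≤ ‖f‖ :=
  LinearMap.mkContinuous_norm_le _ (norm_nonneg _) _

/-- `(n+1)^{-1/2} ∑_j f(k_j) ψ(k₁, …, k_{j-1}, k_{j+1}, …, k_{n+1})`; for symmetric `ψ` this is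
`√(n+1) S_{n+1} (f ⊗ ψ)`. -/
def createAux (f : Lp ℂ 2 μ) (n : ℕ) : NBody μ n →L[ℂ] NBody μ (n + 1) :=
  ((Real.sqrt (n + 1) : ℂ)⁻¹) • ∑ j : Fin (n + 1), insertAt f n j

theorem norm_createAux_le (f : Lp ℂ 2 μ) (n : ℕ) :
    ‖createAux f n‖ ≤ Real.sqrt (n + 1) * ‖f‖ := by
  have hpos : (0 : ℝ) < n + 1 := by positivity
  have h1 : ‖∑ j : Fin (n + 1), insertAt f n j‖ ≤ (n + 1) * ‖f‖ := by
    refine (norm_sum_le _ _).trans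
      ((Finset.sum_le_sum fun j _ => norm_insertAt_le f n j).trans (le_of_eq ?_))
    simp
  have h2 : ‖((Real.sqrt (n + 1) : ℂ)⁻¹)‖ = (Real.sqrt (n + 1))⁻¹ := by
    rw [norm_inv, Complex.norm_real, Real.norm_of_nonneg (Real.sqrt_nonneg _)]
  unfold createAux
  rw [norm_smul, h2]
  calc (Real.sqrt (n + 1))⁻¹ * ‖∑ j : Fin (n + 1), insertAt f n j‖
      ≤ (Real.sqrt (n + 1))⁻¹ * ((n + 1) * ‖f‖) := by gcongr
    _ = (Real.sqrt (n + 1))⁻¹ * ((Real.sqrt (n + 1) * Real.sqrt (n + 1)) * ‖f‖) := by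
        rw [Real.mul_self_sqrt hpos.le]
    _ = Real.sqrt (n + 1) * ‖f‖ := by
        have := (Real.sqrt_pos.2 hpos).ne'
        field_simp

theorem coeFn_createAux (f : Lp ℂ 2 μ) (n : ℕ) (ψ : NBody μ n) :
    createAux f n ψ =ᵐ[Measure.pi (fun _ : Fin (n + 1) => μ)]
      fun k => (Real.sqrt (n + 1) : ℂ)⁻¹ *
        ∑ j, f (k j) * ψ (fun i => k (j.succAbove i)) := by
  have e : createAux f n ψ
      = ((Real.sqrt (n + 1) : ℂ)⁻¹) • ∑ j : Fin (n + 1), insertAt f n j ψ := by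
    simp [createAux]
  rw [e]
  have h1 := Lp.coeFn_smul ((Real.sqrt (n + 1) : ℂ)⁻¹) (∑ j : Fin (n + 1), insertAt f n j ψ)
  have h2 := Lp.coeFn_finsetSum Finset.univ (fun j : Fin (n + 1) => insertAt f n j ψ)
  have h3 := ae_all_iff.2 fun j : Fin (n + 1) => coeFn_insertAt f n j ψ
  filter_upwards [h1, h2, h3] with k h1 h2 h3
  rw [h1, Pi.smul_apply, h2]
  simp [h3]

theorem exists_perm_succAbove (n : ℕ) (σ : Equiv.Perm (Fin (n + 1))) (j : Fin (n + 1)) :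
    ∃ τ : Equiv.Perm (Fin n), ∀ i, σ (j.succAbove i) = (σ j).succAbove (τ i) := by
  have h : ∀ i, ∃ t, (σ j).succAbove t = σ (j.succAbove i) := fun i =>
    Fin.exists_succAbove_eq (fun h => Fin.succAbove_ne j i (σ.injective h))
  choose t ht using h
  have hinj : Function.Injective t := fun a b hab => by
    have : σ (j.succAbove a) = σ (j.succAbove b) := by rw [← ht a, ← ht b, hab]
    exact Fin.succAbove_right_injective (σ.injective this)
  exact ⟨Equiv.ofBijective t (Finite.injective_iff_bijective.1 hinj), fun i => (ht i).symm⟩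

theorem createAux_mem (f : Lp ℂ 2 μ) (n : ℕ) (ψ : symSpace μ n) :
    createAux f n ψ ∈ symSpace μ (n + 1) := by
  intro σ
  have h := coeFn_createAux f n (ψ : NBody μ n)
  have h' := (measurePreserving_perm μ (n + 1) σ).quasiMeasurePreserving.ae h
  choose τ hτ using exists_perm_succAbove n σ
  have hs := ae_all_iff.2 fun j : Fin (n + 1) =>
    (quasiMeasurePreserving_succAbove (μ := μ) n (σ j)).ae (ψ.2 (τ j))
  filter_upwards [h, h', hs] with k hk hk' hs
  rw [hk, hk']
  congr 1
  rw [← Equiv.sum_comp σ (fun j => f (k j) * (ψ : NBody μ n) (fun i => k (j.succAbove i)))]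
  refine Finset.sum_congr rfl fun j _ => ?_
  rw [← hs j]
  simp only [hτ]

/-- The creation operator `a*(f)` between the `n`- and the `(n+1)`-boson space,
`(a*(f) ψ)(k₁, …, k_{n+1}) = (n+1)^{-1/2} ∑_j f(k_j) ψ(k₁, …, k_{j-1}, k_{j+1}, …, k_{n+1})`. -/
def createSector (f : Lp ℂ 2 μ) (n : ℕ) : symSpace μ n →L[ℂ] symSpace μ (n + 1) :=
  ((createAux f n).comp (symSpace μ n).subtypeL).codRestrict (symSpace μ (n + 1))
    (fun ψ => createAux_mem f n ψ)

/-- The annihilation operator `a(f)` between the `(n+1)`- and the `n`-boson space: the adjoint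
of the creation operator. -/
def annihilateSector (f : Lp ℂ 2 μ) (n : ℕ) : symSpace μ (n + 1) →L[ℂ] symSpace μ n :=
  ContinuousLinearMap.adjoint (createSector f n)

theorem norm_createSector_le (f : Lp ℂ 2 μ) (n : ℕ) :
    ‖createSector f n‖ ≤ Real.sqrt (n + 1) * ‖f‖ := by
  refine ContinuousLinearMap.opNorm_le_bound _ (by positivity) fun ψ => ?_
  change ‖createAux f n (ψ : NBody μ n)‖ ≤ _
  exact (createAux f n).le_of_opNorm_le (norm_createAux_le f n) _

theorem norm_annihilateSector_le (f : Lp ℂ 2 μ) (n : ℕ) :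
    ‖annihilateSector f n‖ ≤ Real.sqrt (n + 1) * ‖f‖ := by
  unfold annihilateSector
  rw [LinearIsometryEquiv.norm_map]
  exact norm_createSector_le f n

variable (μ) in
/-- The domain of `𝒩^{1/2}`, where `𝒩` is the number operator. -/
def domSqrtNumber : Submodule ℂ (Fock μ) where
  carrier := {ψ | Summable fun n : ℕ => (n : ℝ) * ‖ψ n‖ ^ 2}
  zero_mem' := by
    change Summable fun n : ℕ => (n : ℝ) * ‖(0 : Fock μ) n‖ ^ 2
    simp
  add_mem' := fun {a b} ha hb => by
    have ha' : Summable fun n : ℕ => (n : ℝ) * ‖a n‖ ^ 2 := ha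
    have hb' : Summable fun n : ℕ => (n : ℝ) * ‖b n‖ ^ 2 := hb
    change Summable fun n : ℕ => (n : ℝ) * ‖a n + b n‖ ^ 2
    refine Summable.of_nonneg_of_le (fun n => by positivity) (fun n => ?_)
      ((ha'.mul_left 2).add (hb'.mul_left 2))
    have h1 : ‖a n + b n‖ ^ 2 ≤ 2 * ‖a n‖ ^ 2 + 2 * ‖b n‖ ^ 2 := by
      have := norm_add_le (a n) (b n)
      nlinarith [sq_nonneg (‖a n‖ - ‖b n‖), norm_nonneg (a n + b n)]
    calc (n : ℝ) * ‖a n + b n‖ ^ 2 ≤ n * (2 * ‖a n‖ ^ 2 + 2 * ‖b n‖ ^ 2) := by gcongr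
      _ = _ := by ring
  smul_mem' := fun c a ha => by
    have ha' : Summable fun n : ℕ => (n : ℝ) * ‖a n‖ ^ 2 := ha
    change Summable fun n : ℕ => (n : ℝ) * ‖c • a n‖ ^ 2
    refine (ha'.mul_left (‖c‖ ^ 2)).congr fun n => ?_
    rw [norm_smul]
    ring

/-- The sectors of `a*(f) ψ`: nothing in the vacuum sector, `a*(f) ψ⁽ⁿ⁾` in the `(n+1)`-boson
sector. -/
def createSeq (f : Lp ℂ 2 μ) (ψ : Fock μ) : ∀ n : ℕ, symSpace μ n
  | 0 => 0
  | n + 1 => createSector f n (ψ n)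

theorem sq_le_of_le_sqrt {a b c x : ℝ} (ha : 0 ≤ a) (hx : 0 ≤ x)
    (h : x ≤ Real.sqrt a * b * c) : x ^ 2 ≤ b ^ 2 * (a * c ^ 2) := by
  calc x ^ 2 ≤ (Real.sqrt a * b * c) ^ 2 := by gcongr
    _ = (Real.sqrt a) ^ 2 * b ^ 2 * c ^ 2 := by ring
    _ = b ^ 2 * (a * c ^ 2) := by rw [Real.sq_sqrt ha]; ring

theorem memℓp_createSeq (f : Lp ℂ 2 μ) (ψ : domSqrtNumber μ) :
    Memℓp (createSeq f (ψ : Fock μ)) 2 := by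
  rw [memℓp_two_iff, ← summable_nat_add_iff 1]
  have h1 : Summable fun n : ℕ => (n : ℝ) * ‖(ψ : Fock μ) n‖ ^ 2 := ψ.2
  have h2 : Summable fun n : ℕ => ‖(ψ : Fock μ) n‖ ^ 2 := (memℓp_two_iff _).1 (lp.memℓp _)
  refine Summable.of_nonneg_of_le (fun n => by positivity) (fun n => ?_)
    ((h1.add h2).mul_left (‖f‖ ^ 2))
  have h3 : ‖createSeq f (ψ : Fock μ) (n + 1)‖
      ≤ Real.sqrt (n + 1) * ‖f‖ * ‖(ψ : Fock μ) n‖ :=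
    (createSector f n).le_of_opNorm_le (norm_createSector_le f n) _
  have h4 := sq_le_of_le_sqrt (by positivity) (norm_nonneg _) h3
  linarith

theorem memℓp_annihilateSeq (f : Lp ℂ 2 μ) (ψ : domSqrtNumber μ) :
    Memℓp (fun n : ℕ => annihilateSector f n ((ψ : Fock μ) (n + 1))) 2 := by
  rw [memℓp_two_iff]
  have h1 : Summable fun n : ℕ => (n : ℝ) * ‖(ψ : Fock μ) n‖ ^ 2 := ψ.2
  refine Summable.of_nonneg_of_le (fun n => by positivity) (fun n => ?_)
    (((summable_nat_add_iff 1).2 h1).mul_left (‖f‖ ^ 2))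
  have h3 : ‖annihilateSector f n ((ψ : Fock μ) (n + 1))‖
      ≤ Real.sqrt (n + 1) * ‖f‖ * ‖(ψ : Fock μ) (n + 1)‖ :=
    (annihilateSector f n).le_of_opNorm_le (norm_annihilateSector_le f n) _
  have h4 := sq_le_of_le_sqrt (by positivity) (norm_nonneg _) h3
  push_cast
  exact h4

/-- The creation operator `a*(f)` with domain `Dom(𝒩^{1/2})`. -/
def create (f : Lp ℂ 2 μ) : Fock μ →ₗ.[ℂ] Fock μ where
  domain := domSqrtNumber μ
  toFun :=
    { toFun := fun ψ => ⟨createSeq f (ψ : Fock μ), memℓp_createSeq f ψ⟩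
      map_add' := fun ψ φ => by
        apply lp.ext
        funext n
        cases n with
        | zero => exact (add_zero (0 : symSpace μ 0)).symm
        | succ n => exact map_add (createSector f n) ((ψ : Fock μ) n) ((φ : Fock μ) n)
      map_smul' := fun c ψ => by
        apply lp.ext
        funext n
        cases n with
        | zero => exact (smul_zero (A := symSpace μ 0) c).symm
        | succ n => exact map_smul (createSector f n) c ((ψ : Fock μ) n) }

/-- The annihilation operator `a(f)` with domain `Dom(𝒩^{1/2})`. -/
def annihilate (f : Lp ℂ 2 μ) : Fock μ →ₗ.[ℂ] Fock μ where
  domain := domSqrtNumber μ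
  toFun :=
    { toFun := fun ψ => ⟨fun n => annihilateSector f n ((ψ : Fock μ) (n + 1)),
        memℓp_annihilateSeq f ψ⟩
      map_add' := fun ψ φ => by
        apply lp.ext
        funext n
        exact map_add (annihilateSector f n) ((ψ : Fock μ) (n + 1)) ((φ : Fock μ) (n + 1))
      map_smul' := fun c ψ => by
        apply lp.ext
        funext n
        exact map_smul (annihilateSector f n) c ((ψ : Fock μ) (n + 1)) }

end Fock

/-! ### Unbounded operators -/

section Operators

variable {F : Type*} [NormedAddCommGroup F] [InnerProductSpace ℂ F]

/-- The Hilbert space `ℂ^D ⊗ F`, as the space of `D`-tuples `Ψ = ∑_i e_i ⊗ Ψ_i` of vectors of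
`F` with norm `‖Ψ‖² = ∑_i ‖Ψ_i‖²`. -/
abbrev Spin (D : ℕ) (F : Type*) : Type _ := PiLp 2 (fun _ : Fin D => F)

/-- `M ⊗ A` on `ℂ^D ⊗ Dom(A)`: its `i`-th component on `Ψ = ∑_j e_j ⊗ Ψ_j` is
`∑_j M_{ij} A Ψ_j`. -/
def spinTensor {D : ℕ} (M : Matrix (Fin D) (Fin D) ℂ) (A : F →ₗ.[ℂ] F) :
    Spin D F →ₗ.[ℂ] Spin D F where
  domain :=
    { carrier := {Ψ | ∀ j, Ψ j ∈ A.domain}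
      zero_mem' := fun _ => A.domain.zero_mem
      add_mem' := fun ha hb j => A.domain.add_mem (ha j) (hb j)
      smul_mem' := fun c _ ha j => A.domain.smul_mem c (ha j) }
  toFun :=
    { toFun := fun Ψ => WithLp.toLp 2 fun i => ∑ j, M i j • A ⟨(Ψ : Spin D F) j, Ψ.2 j⟩
      map_add' := fun Ψ Φ => by
        ext i
        simp only [PiLp.add_apply]
        rw [← Finset.sum_add_distrib]
        refine Finset.sum_congr rfl fun j _ => ?_
        rw [← smul_add, ← LinearPMap.map_add]
        rfl
      map_smul' := fun c Ψ => by
        ext i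
        simp only [PiLp.smul_apply, RingHom.id_apply]
        rw [Finset.smul_sum]
        refine Finset.sum_congr rfl fun j _ => ?_
        rw [smul_comm c, ← LinearPMap.map_smul A c]
        rfl }

/-- The identity, as an everywhere defined operator. -/
def idOp (F : Type*) [NormedAddCommGroup F] [InnerProductSpace ℂ F] : F →ₗ.[ℂ] F :=
  (LinearMap.id : F →ₗ[ℂ] F).toPMap ⊤

/-- The conjugated operator `W A W*` with domain `W Dom(A)`, for `W` unitary. -/
def conj (W : F ≃ₗᵢ[ℂ] F) (A : F →ₗ.[ℂ] F) : F →ₗ.[ℂ] F where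
  domain := A.domain.comap (W.symm.toLinearEquiv : F →ₗ[ℂ] F)
  toFun :=
    { toFun := fun Ψ => W (A ⟨W.symm Ψ, Ψ.2⟩)
      map_add' := fun Ψ Φ => by
        rw [← map_add, ← LinearPMap.map_add]
        congr 2
        exact Subtype.ext (map_add W.symm (Ψ : F) Φ)
      map_smul' := fun c Ψ => by
        rw [RingHom.id_apply, ← map_smul, ← LinearPMap.map_smul]
        congr 2
        exact Subtype.ext (map_smul W.symm c (Ψ : F)) }

/-- `R = (A - z)⁻¹`: the bounded everywhere defined operator `R` is a two-sided inverse of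
`A - z : Dom(A) → F`. -/
def IsResolvent (A : F →ₗ.[ℂ] F) (z : ℂ) (R : F →L[ℂ] F) : Prop :=
  (∀ φ : F, ∃ h : R φ ∈ A.domain, A ⟨R φ, h⟩ - z • R φ = φ) ∧
    ∀ ψ : A.domain, R (A ψ - z • (ψ : F)) = ψ

/-- Norm resolvent convergence `A_Λ → A` of self-adjoint operators:
`(A_Λ - z)⁻¹ → (A - z)⁻¹` in operator norm for every non-real `z`. -/
def NormResolventTendsto [CompleteSpace F] (A : ℕ → F →ₗ.[ℂ] F) (A' : F →ₗ.[ℂ] F) : Prop :=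
  (∀ Λ, IsSelfAdjoint (A Λ)) ∧ IsSelfAdjoint A' ∧
    ∀ z : ℂ, z.im ≠ 0 → ∃ (R : ℕ → F →L[ℂ] F) (R' : F →L[ℂ] F),
      (∀ Λ, IsResolvent (A Λ) z (R Λ)) ∧ IsResolvent A' z R' ∧ Tendsto R atTop (𝓝 R')

end Operators

/-! ### The generalized spin–boson model with one form factor -/

section Model

variable {X : Type*} [MeasurableSpace X] {μ : Measure X} [SigmaFinite μ] {D : ℕ}

/-- The Hamiltonian `H = K ⊗ 1 + 1 ⊗ dΓ(ω) + B ⊗ a*(f) + B* ⊗ a(f)` on `ℂ^D ⊗ ℱ`, on the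
intersection of the domains of its summands (for `ω ≥ m > 0` this is `ℂ^D ⊗ Dom(dΓ(ω))`). -/
def hamiltonian (ω : X → ℝ) (K B : Matrix (Fin D) (Fin D) ℂ) (f : Lp ℂ 2 μ) :
    Spin D (Fock μ) →ₗ.[ℂ] Spin D (Fock μ) :=
  spinTensor K (idOp (Fock μ)) + spinTensor 1 (dGamma μ ω)
    + (spinTensor B (create f) + spinTensor B.conjTranspose (annihilate f))

/-- The self-energy `E = -B* B ∫ conj(f(k)) f(k) / ω(k) dμ(k)`, a `D × D` matrix. -/
def selfEnergy (ω : X → ℝ) (B : Matrix (Fin D) (Fin D) ℂ) (f : Lp ℂ 2 μ) :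
    Matrix (Fin D) (Fin D) ℂ :=
  -((∫ k, (starRingEnd ℂ) (f k) * f k / (ω k : ℂ) ∂μ) • (B.conjTranspose * B))

/-- `B` is unitary and permutes some orthonormal eigenbasis of `K`. -/
def PermutesEigenbasis (K B : Matrix (Fin D) (Fin D) ℂ) : Prop :=
  B ∈ Matrix.unitaryGroup (Fin D) ℂ ∧
    ∃ v : OrthonormalBasis (Fin D) ℂ (EuclideanSpace ℂ (Fin D)),
      (∀ i, ∃ c : ℂ, Matrix.toEuclideanLin K (v i) = c • v i) ∧
        ∀ i, ∃ i', Matrix.toEuclideanLin B (v i) = v i'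

end Model

end GSB

end

noncomputable section

namespace GSB

/-! ### Self-adjointness, resolvents and norm resolvent convergence -/

section AbstractOperators

variable {F : Type*} [NormedAddCommGroup F] [InnerProductSpace ℂ F]

/-! Put `g = f / ω` and let `W(h) = exp (a*(h) - a(h))` be the Weyl operator. Commuting `dΓ(ω)`
through `W(βg)` with `|β| = 1` produces the linear terms `a*(βf) + a(βf)` and the constant `∫ |f|² /
ω`, that is, it completes the square (`weyl_mem_graph`). Write `B U = U diag(β)`. In the basis of
columns of `U`, the operator `H - E` without `K` is a direct sum of such shifted fields, so `W_Λ =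
(⊕_j W(β_j g)) (Uᴴ ⊗ 1)` turns it into `1 ⊗ dΓ(ω)` (`mem_graph_conj_spinWeyl`). The matrix `K`
becomes the bounded operator with entries `(Uᴴ K U)_{jk} W(β_j g) W(β_k g)*`.

The diagonal entries are constant and form `η₀`. Off-diagonal entries with `β_j = β_k` vanish if the
compression of `K` to each eigenspace of `B` is diagonalized as well (`exists_adapted_eigenbasis`).
The remaining entries do not vanish in norm, but they do as forms on the domain of `dΓ(ω)`: since
`a(g) W(βg) W(γg)* = W(βg) W(γg)* (a(g) + (β - γ) ‖g‖²)`, pairing with vectors of that domain, on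
which `a(g)` and `a*(g)` are `O(‖g‖)` because `ω ≥ m`, gives decay of order `1 / ‖g‖`
(`norm_inner_weyl_weyl_symm_le`).

Smallness as a form in the graph norm, together with a uniform operator bound, suffices for norm
resolvent convergence, because the resolvent difference sandwiches the perturbation between two
resolvents (`normResolventTendsto_of_form`).

The Weyl operators are exponential series on finite particle vectors, which are entire vectors of
`a*(g) - a(g)`. Commutation relations are summed weakly there (`inner_exp_commutator`) and carried
to the full domain by closedness of `dΓ(ω)` and convergence of truncations in graph norm. -/

theorem IsResolvent.mem_graph {A : F →ₗ.[ℂ] F} {z : ℂ} {R : F →L[ℂ] F} (h : IsResolvent A z R)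
    (φ : F) : (R φ, φ + z • R φ) ∈ A.graph := by
  obtain ⟨h1, h2⟩ := h.1 φ
  have := LinearPMap.mem_graph A ⟨R φ, h1⟩
  rw [sub_eq_iff_eq_add] at h2
  rwa [h2] at this

/-- A symmetric relation `G` for which `G + c` is surjective for some real `c` contains all pairs
that are symmetric with respect to `G`. -/
theorem rel_of_forall_inner {G : F → F → Prop}
    (hsym : ∀ a b x y, G a b → G x y → inner ℂ b x = inner ℂ a y)
    (c : ℝ) (hs : ∀ φ : F, ∃ ψ, G ψ (φ - (c : ℂ) • ψ)) {x y : F}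
    (h : ∀ a b, G a b → inner ℂ b x = inner ℂ a y) : G x y := by
  -- Solve `(G + c) ψ = y + c x`. Then `x - ψ` is orthogonal to the range of `G + c`, which is
  -- everything, so `x = ψ`.
  obtain ⟨ψ, hψ⟩ := hs (y + (c : ℂ) • x)
  have : x = ψ := by
    refine ext_inner_left ℂ fun φ => ?_
    obtain ⟨χ, hχ⟩ := hs φ
    have h1 := h _ _ hχ
    have h2 := hsym _ _ _ _ hχ hψ
    simp only [inner_sub_left, inner_sub_right, inner_add_right, inner_smul_left,
      inner_smul_right, Complex.conj_ofReal] at h1 h2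
    linear_combination h1 - h2
  rw [← this] at hψ
  simpa using hψ

variable [CompleteSpace F]

theorem isSelfAdjoint_of_graph {A : F →ₗ.[ℂ] F} (hd : Dense (A.domain : Set F))
    (h : ∀ x y, (x, y) ∈ A.graph ↔ ∀ a b, (a, b) ∈ A.graph → inner ℂ b x = inner ℂ a y) :
    IsSelfAdjoint A := by
  rw [LinearPMap.isSelfAdjoint_def]
  apply LinearPMap.eq_of_eq_graph
  rw [LinearPMap.adjoint_graph_eq_graph_adjoint hd]
  ext ⟨x, y⟩
  rw [Submodule.mem_adjoint_iff, h]
  simp only [sub_eq_zero]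

theorem mem_graph_iff_of_isSelfAdjoint {A : F →ₗ.[ℂ] F} (hA : IsSelfAdjoint A) (x y : F) :
    (x, y) ∈ A.graph ↔ ∀ a b, (a, b) ∈ A.graph → inner ℂ b x = inner ℂ a y := by
  have h := LinearPMap.adjoint_graph_eq_graph_adjoint hA.dense_domain
  rw [LinearPMap.isSelfAdjoint_def.1 hA] at h
  nth_rw 1 [h]
  rw [Submodule.mem_adjoint_iff]
  simp only [sub_eq_zero]

/-- A symmetric operator `A` for which `A + c` is surjective for some real `c` is self-adjoint. -/
theorem isSelfAdjoint_of_surjective {A : F →ₗ.[ℂ] F}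
    (hsym : ∀ a b x y, (a, b) ∈ A.graph → (x, y) ∈ A.graph → inner ℂ b x = inner ℂ a y)
    (c : ℝ) (hs : ∀ φ : F, ∃ ψ, (ψ, φ - (c : ℂ) • ψ) ∈ A.graph) : IsSelfAdjoint A := by
  have key : ∀ x y, (∀ a b, (a, b) ∈ A.graph → inner ℂ b x = inner ℂ a y) →
      (x, y) ∈ A.graph := fun x y h =>
    rel_of_forall_inner (G := fun x y => (x, y) ∈ A.graph) hsym c hs h
  refine isSelfAdjoint_of_graph ?_ fun x y => ⟨fun h a b hab => hsym _ _ _ _ hab h, key x y⟩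
  rw [Submodule.dense_iff_topologicalClosure_eq_top, Submodule.topologicalClosure_eq_top_iff,
    Submodule.eq_bot_iff]
  intro y hy
  -- Density comes for free: for `y` orthogonal to the domain, the pair `(0, y)` is symmetric to the
  -- graph, hence belongs to it, and an operator maps `0` to `0`.
  have h0 : ((0 : F), y) ∈ A.graph := key 0 y fun a b hab => by
    rw [inner_zero_right]
    exact (hy a (LinearPMap.mem_domain_of_mem_graph hab)).symm
  exact LinearPMap.graph_fst_eq_zero_snd A h0 rfl

/-- Symmetry makes `⟨x, y⟩` real, so the imaginary part of `⟨x, y - z x⟩` is `-Im z ‖x‖²`; then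
Cauchy–Schwarz. -/
theorem norm_le_of_mem_graph {A : F →ₗ.[ℂ] F} (hA : IsSelfAdjoint A) (z : ℂ) {x y : F}
    (h : (x, y) ∈ A.graph) : |z.im| * ‖x‖ ≤ ‖y - z • x‖ := by
  have h1 : inner ℂ y x = inner ℂ x y := (mem_graph_iff_of_isSelfAdjoint hA x y).1 h _ _ h
  have h2 : (inner ℂ x y).im = 0 := by
    rw [← inner_conj_symm] at h1
    have := congrArg Complex.im h1
    simp only [Complex.conj_im] at this
    linarith
  have h3 : (inner ℂ x (y - z • x)).im = -(z.im * ‖x‖ ^ 2) := by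
    rw [inner_sub_right, inner_smul_right, inner_self_eq_norm_sq_to_K, Complex.sub_im, h2]
    simp [← Complex.ofReal_pow]
  have h4 : |z.im| * ‖x‖ ^ 2 ≤ ‖x‖ * ‖y - z • x‖ := by
    calc |z.im| * ‖x‖ ^ 2 = |(inner ℂ x (y - z • x)).im| := by
          rw [h3, abs_neg, abs_mul, abs_of_nonneg (sq_nonneg ‖x‖)]
      _ ≤ ‖inner ℂ x (y - z • x)‖ := Complex.abs_im_le_norm _
      _ ≤ _ := norm_inner_le_norm _ _
  rcases (norm_nonneg x).eq_or_lt with h0 | h0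
  · rw [← h0, mul_zero]; exact norm_nonneg _
  · nlinarith

/-- A self-adjoint operator has a bounded resolvent at every non-real point. -/
theorem exists_isResolvent {A : F →ₗ.[ℂ] F} (hA : IsSelfAdjoint A) {z : ℂ} (hz : z.im ≠ 0) :
    ∃ R : F →L[ℂ] F, IsResolvent A z R := by
  have hcl : IsClosed (A.graph : Set (F × F)) := hA.isClosed
  have : CompleteSpace A.graph := hcl.completeSpace_coe
  let ℓ : A.graph →L[ℂ] F :=
    (ContinuousLinearMap.snd ℂ F F - z • ContinuousLinearMap.fst ℂ F F).comp A.graph.subtypeL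
  have hℓ : ∀ p : A.graph, ℓ p = (p : F × F).2 - z • (p : F × F).1 := fun p => rfl
  have hpos : 0 < |z.im| := abs_pos.2 hz
  have hb : ∀ p : A.graph, ‖p‖ ≤ (1 + (1 + ‖z‖) / |z.im|) * ‖ℓ p‖ := by
    intro p
    have h1 := norm_le_of_mem_graph hA z p.2
    rw [← hℓ] at h1
    have h1' : ‖(p : F × F).1‖ ≤ ‖ℓ p‖ / |z.im| := by
      rw [le_div_iff₀ hpos]; linarith
    have h2 : ‖(p : F × F).2‖ ≤ ‖ℓ p‖ + ‖z‖ * ‖(p : F × F).1‖ := by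
      have : (p : F × F).2 = ℓ p + z • (p : F × F).1 := by rw [hℓ]; abel
      rw [this]
      exact (norm_add_le _ _).trans (by rw [norm_smul])
    have e : (1 + (1 + ‖z‖) / |z.im|) * ‖ℓ p‖
        = ‖ℓ p‖ + ‖ℓ p‖ / |z.im| + ‖z‖ * (‖ℓ p‖ / |z.im|) := by ring
    rw [e]
    change max ‖(p : F × F).1‖ ‖(p : F × F).2‖ ≤ _
    have h3 : 0 ≤ ‖ℓ p‖ / |z.im| := by positivity
    have h4 : ‖z‖ * ‖(p : F × F).1‖ ≤ ‖z‖ * (‖ℓ p‖ / |z.im|) := by gcongr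
    have h5 : 0 ≤ ‖z‖ * (‖ℓ p‖ / |z.im|) := by positivity
    refine max_le ?_ ?_
    · linarith [norm_nonneg (ℓ p)]
    · linarith
  -- On the complete graph, `A - z` is continuous and bounded below, hence injective with closed
  -- range.
  have hanti : AntilipschitzWith (Real.toNNReal (1 + (1 + ‖z‖) / |z.im|)) ℓ := by
    refine ContinuousLinearMap.antilipschitz_of_bound ℓ fun p => ?_
    rw [Real.coe_toNNReal _ (by positivity)]
    exact hb p
  have hclr : IsClosed (LinearMap.range (ℓ : A.graph →ₗ[ℂ] F) : Set F) := by
    rw [LinearMap.coe_range]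
    exact hanti.isClosed_range ℓ.uniformContinuous
  have hker : LinearMap.ker (ℓ : A.graph →ₗ[ℂ] F) = ⊥ := LinearMap.ker_eq_bot.2 hanti.injective
  have hrange : LinearMap.range (ℓ : A.graph →ₗ[ℂ] F) = ⊤ := by
    have : CompleteSpace (LinearMap.range (ℓ : A.graph →ₗ[ℂ] F)) := hclr.completeSpace_coe
    rw [← Submodule.orthogonal_eq_bot_iff, Submodule.eq_bot_iff]
    intro y hy
    -- A vector orthogonal to the range is an eigenvector of `A` for the non-real number `conj z`,
    -- so it vanishes by the same lower bound.
    have hy' : ∀ a b, (a, b) ∈ A.graph → inner ℂ b y = inner ℂ a ((starRingEnd ℂ z) • y) := by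
      intro a b hab
      have := hy (b - z • a) ⟨⟨(a, b), hab⟩, rfl⟩
      rw [inner_sub_left, inner_smul_left, sub_eq_zero] at this
      rw [this, inner_smul_right]
    have hg := (mem_graph_iff_of_isSelfAdjoint hA y _).2 hy'
    have h1 := norm_le_of_mem_graph hA (starRingEnd ℂ z) hg
    rw [sub_self, norm_zero, Complex.conj_im, abs_neg] at h1
    have : ‖y‖ ≤ 0 := by
      by_contra hc
      push Not at hc
      nlinarith
    exact norm_le_zero_iff.1 this
  let e := ContinuousLinearEquiv.ofBijective ℓ hker hrange
  have he : ∀ p, e p = ℓ p := fun p => rfl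
  refine ⟨((ContinuousLinearMap.fst ℂ F F).comp A.graph.subtypeL).comp (e.symm : F →L[ℂ] A.graph),
    fun φ => ?_, fun ψ => ?_⟩
  · have h1 := (LinearPMap.mem_graph_iff A).1 (e.symm φ).2
    obtain ⟨w, hw1, hw2⟩ := h1
    have h2 : ((e.symm φ : A.graph) : F × F).1 ∈ A.domain := hw1 ▸ w.2
    refine ⟨h2, ?_⟩
    have h3 : A ⟨((e.symm φ : A.graph) : F × F).1, h2⟩ = ((e.symm φ : A.graph) : F × F).2 := by
      rw [← hw2]; congr 1; exact Subtype.ext hw1.symm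
    change A ⟨((e.symm φ : A.graph) : F × F).1, h2⟩ - z • ((e.symm φ : A.graph) : F × F).1 = φ
    rw [h3, ← hℓ, ← he, e.apply_symm_apply]
  · have : A ψ - z • (ψ : F) = e ⟨((ψ : F), A ψ), LinearPMap.mem_graph A ψ⟩ := rfl
    rw [this]
    change ((e.symm (e _) : A.graph) : F × F).1 = _
    rw [e.symm_apply_apply]

theorem IsResolvent.norm_apply_le {A : F →ₗ.[ℂ] F} (hA : IsSelfAdjoint A) {z : ℂ}
    (hz : z.im ≠ 0) {R : F →L[ℂ] F} (h : IsResolvent A z R) (φ : F) :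
    ‖R φ‖ ≤ |z.im|⁻¹ * ‖φ‖ := by
  have := norm_le_of_mem_graph hA z (h.mem_graph φ)
  rw [add_sub_cancel_right] at this
  rw [inv_mul_eq_div, le_div_iff₀ (abs_pos.2 hz)]
  linarith

/-- A self-adjoint operator plus a bounded self-adjoint operator is self-adjoint. -/
theorem isSelfAdjoint_of_bounded_perturbation {A A' : F →ₗ.[ℂ] F} (hA' : IsSelfAdjoint A')
    {V : F →L[ℂ] F} (hV : ∀ x y, inner ℂ (V x) y = inner ℂ x (V y))
    (hg : ∀ x y, (x, y) ∈ A.graph ↔ (x, y - V x) ∈ A'.graph) : IsSelfAdjoint A := by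
  have hg' : ∀ a b, (a, b) ∈ A'.graph → (a, b + V a) ∈ A.graph := fun a b h => by
    rw [hg]; simpa using h
  have hd : A.domain = A'.domain := by
    ext x
    rw [LinearPMap.mem_domain_iff, LinearPMap.mem_domain_iff]
    exact ⟨fun ⟨y, h⟩ => ⟨_, (hg _ _).1 h⟩, fun ⟨y, h⟩ => ⟨_, hg' _ _ h⟩⟩
  refine isSelfAdjoint_of_graph (by rw [hd]; exact hA'.dense_domain) fun x y => ?_
  rw [hg, mem_graph_iff_of_isSelfAdjoint hA']
  constructor
  · intro h a b hab
    have := h _ _ ((hg _ _).1 hab)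
    rw [inner_sub_left, inner_sub_right, hV] at this
    simpa using this
  · intro h a b hab
    have := h _ _ (hg' _ _ hab)
    rw [inner_add_left, hV] at this
    rw [inner_sub_right, ← this]
    ring

/-- Self-adjoint operators `A Λ = A' + V Λ` with uniformly bounded `V Λ` that vanish in the limit
as forms with respect to the graph norm of `A'` converge to `A'` in the norm resolvent sense. -/
theorem normResolventTendsto_of_form {A : ℕ → F →ₗ.[ℂ] F} {A' : F →ₗ.[ℂ] F}
    (hA' : IsSelfAdjoint A') {V : ℕ → F →L[ℂ] F}
    (hV : ∀ Λ x y, inner ℂ (V Λ x) y = inner ℂ x (V Λ y)) {C : ℝ} (hC : ∀ Λ x, ‖V Λ x‖ ≤ C * ‖x‖)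
    (hg : ∀ Λ x y, (x, y) ∈ (A Λ).graph ↔ (x, y - V Λ x) ∈ A'.graph)
    {ε : ℕ → ℝ} (hε : Tendsto ε atTop (𝓝 0))
    (hform : ∀ Λ a b x y, (a, b) ∈ A'.graph → (x, y) ∈ A'.graph →
      ‖inner ℂ a (V Λ x)‖ ≤ ε Λ * ((‖a‖ + ‖b‖) * (‖x‖ + ‖y‖))) :
    NormResolventTendsto A A' := by
  have hA : ∀ Λ, IsSelfAdjoint (A Λ) := fun Λ =>
    isSelfAdjoint_of_bounded_perturbation hA' (hV Λ) (hg Λ)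
  refine ⟨hA, hA', fun z hz => ?_⟩
  choose R hR using fun Λ => exists_isResolvent (hA Λ) hz
  obtain ⟨R', hR'⟩ := exists_isResolvent hA' hz
  have hz' : (starRingEnd ℂ z).im ≠ 0 := by simpa using hz
  -- `S = (A' - conj z)⁻¹` plays the role of the adjoint of `R'`.
  obtain ⟨S, hS⟩ := exists_isResolvent hA' hz'
  refine ⟨R, R', hR, hR', ?_⟩
  set r : ℝ := |z.im|⁻¹ with hr
  have hr0 : 0 ≤ r := by positivity
  -- The factors bound the graph norms, with respect to `A'`, of `S φ` and of `R Λ ψ`. Since `A' R ψ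
  -- = ψ + z R ψ - V R ψ`, the second one involves the uniform bound `C` on `V`.
  set M : ℝ := (r + (1 + ‖z‖ * r)) * (r + (1 + ‖z‖ * r + |C| * r)) with hM
  have hM0 : 0 ≤ M := by positivity
  have key : ∀ Λ φ ψ, ‖inner ℂ φ ((R Λ - R') ψ)‖ ≤ |ε Λ| * M * (‖φ‖ * ‖ψ‖) := by
    intro Λ φ ψ
    have hX := hS.mem_graph φ
    have hX' := (hg Λ _ _).1 ((hR Λ).mem_graph ψ)
    have hX'' := hR'.mem_graph ψ
    -- The second resolvent identity `R - R' = -R' V R`, in weak form.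
    have e1 : inner ℂ φ ((R Λ - R') ψ) = -inner ℂ (S φ) (V Λ (R Λ ψ)) := by
      have h1 := (mem_graph_iff_of_isSelfAdjoint hA' _ _).1 hX' _ _ hX
      have h2 := (mem_graph_iff_of_isSelfAdjoint hA' _ _).1 hX'' _ _ hX
      simp only [inner_sub_right, inner_add_right, inner_add_left, inner_smul_left,
        inner_smul_right, Complex.conj_conj] at h1 h2
      rw [sub_apply, inner_sub_right]
      linear_combination h1 - h2
    have nR : ‖R Λ ψ‖ ≤ r * ‖ψ‖ := (hR Λ).norm_apply_le (hA Λ) hz ψ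
    have nS : ‖S φ‖ ≤ r * ‖φ‖ := by
      have := hS.norm_apply_le hA' hz' φ
      rwa [Complex.conj_im, abs_neg] at this
    have n1 : ‖φ + (starRingEnd ℂ z) • S φ‖ ≤ (1 + ‖z‖ * r) * ‖φ‖ := by
      refine (norm_add_le _ _).trans ?_
      rw [norm_smul, RCLike.norm_conj]
      have : ‖z‖ * ‖S φ‖ ≤ ‖z‖ * (r * ‖φ‖) := by gcongr
      linarith
    have n2 : ‖ψ + z • R Λ ψ - V Λ (R Λ ψ)‖ ≤ (1 + ‖z‖ * r + |C| * r) * ‖ψ‖ := by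
      refine (norm_sub_le _ _).trans ((add_le_add (norm_add_le _ _) (hC Λ _)).trans ?_)
      rw [norm_smul]
      have h1 : ‖z‖ * ‖R Λ ψ‖ ≤ ‖z‖ * (r * ‖ψ‖) := by gcongr
      have h2 : C * ‖R Λ ψ‖ ≤ |C| * (r * ‖ψ‖) := by
        refine mul_le_mul (le_abs_self C) nR (norm_nonneg _) (abs_nonneg _)
      linarith
    rw [e1, norm_neg]
    refine (hform Λ _ _ _ _ hX hX').trans ?_
    have h3 : (‖S φ‖ + ‖φ + (starRingEnd ℂ z) • S φ‖) *
        (‖R Λ ψ‖ + ‖ψ + z • R Λ ψ - V Λ (R Λ ψ)‖) ≤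
        ((r + (1 + ‖z‖ * r)) * ‖φ‖) * ((r + (1 + ‖z‖ * r + |C| * r)) * ‖ψ‖) := by
      refine mul_le_mul (by linarith) (by linarith) (by positivity) (by positivity)
    calc _ ≤ |ε Λ| * _ := mul_le_mul (le_abs_self _) h3 (by positivity) (abs_nonneg _)
      _ = _ := by rw [hM]; ring
  have hn : ∀ Λ, ‖R Λ - R'‖ ≤ |ε Λ| * M := by
    intro Λ
    refine ContinuousLinearMap.opNorm_le_bound _ (by positivity) fun ψ => ?_
    -- Choosing `φ = (R Λ - R') ψ` turns the form bound into an operator norm bound.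
    have h1 := key Λ ((R Λ - R') ψ) ψ
    rw [inner_self_eq_norm_sq_to_K, norm_pow, RCLike.norm_ofReal, abs_norm] at h1
    rcases (norm_nonneg ((R Λ - R') ψ)).eq_or_lt with h0 | h0
    · rw [← h0]; positivity
    · refine le_of_mul_le_mul_left ?_ h0
      calc _ = ‖(R Λ - R') ψ‖ ^ 2 := by ring
        _ ≤ _ := h1
        _ = _ := by ring
  rw [tendsto_iff_norm_sub_tendsto_zero]
  refine squeeze_zero (fun _ => norm_nonneg _) hn ?_
  have : Tendsto (fun Λ => |ε Λ| * M) atTop (𝓝 (|0| * M)) := (hε.abs).mul_const M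
  simpa using this

end AbstractOperators

/-! ### Exponentials of skew-symmetric operators with entire vectors -/

section Exponential

open scoped Nat

variable {F : Type*} [NormedAddCommGroup F] [InnerProductSpace ℂ F] {D₀ : Submodule ℂ F}

/-- The terms `Aⁿ x / n!` of the exponential series. -/
def expTerm (A : Module.End ℂ D₀) (x : D₀) (n : ℕ) : F := ((n ! : ℂ)⁻¹) • (((A ^ n) x : D₀) : F)

theorem norm_expTerm (A : Module.End ℂ D₀) (x : D₀) (n : ℕ) :
    ‖expTerm A x n‖ = ‖(((A ^ n) x : D₀) : F)‖ / n ! := by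
  rw [expTerm, norm_smul, norm_inv, Complex.norm_natCast, inv_mul_eq_div]

theorem neg_pow_apply (A : Module.End ℂ D₀) (n : ℕ) (x : D₀) :
    ((-A) ^ n) x = (-1 : ℂ) ^ n • (A ^ n) x := by
  induction n with
  | zero => simp
  | succ n ih =>
    rw [pow_succ', Module.End.mul_apply, ih, pow_succ' A, Module.End.mul_apply, pow_succ',
      LinearMap.neg_apply, map_smul, mul_smul, neg_one_smul]

theorem inner_pow_of_skew {A : Module.End ℂ D₀}
    (hA : ∀ x y : D₀, inner ℂ (A x : F) (y : F) = -inner ℂ (x : F) (A y : F)) (n : ℕ) :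
    ∀ x y : D₀, inner ℂ ((A ^ n) x : F) (y : F) = (-1) ^ n * inner ℂ (x : F) ((A ^ n) y : F) := by
  induction n with
  | zero => intro x y; simp
  | succ n ih =>
    intro x y
    rw [pow_succ', Module.End.mul_apply, hA, ih, ← Module.End.mul_apply (A ^ n) A, ← pow_succ,
      ← pow_succ']
    ring

/-- Skewness moves all powers to the right factor, leaving the binomial sum `(-1 + 1)^N` in front of
`⟨x, A^N y⟩ / N!`. -/
theorem sum_antidiagonal_inner_expTerm {A : Module.End ℂ D₀}
    (hA : ∀ x y : D₀, inner ℂ (A x : F) (y : F) = -inner ℂ (x : F) (A y : F)) (x y : D₀) (N : ℕ) :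
    ∑ p ∈ Finset.HasAntidiagonal.antidiagonal N, inner ℂ (expTerm A x p.1) (expTerm A y p.2) =
      if N = 0 then inner ℂ (x : F) (y : F) else 0 := by
  have h1 : ∀ p ∈ Finset.HasAntidiagonal.antidiagonal N, inner ℂ (expTerm A x p.1) (expTerm A y p.2) =
      (N ! : ℂ)⁻¹ * inner ℂ (x : F) ((A ^ N) y : F) * (N.choose p.1 • ((-1 : ℂ) ^ p.1 * 1 ^ p.2)) := by
    intro p hp
    have hN : p.1 + p.2 = N := Finset.HasAntidiagonal.mem_antidiagonal.1 hp
    have hf : ((N.choose p.1 : ℕ) : ℂ) * (p.1 ! : ℂ) * (p.2 ! : ℂ) = (N ! : ℂ) := by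
      have h := Nat.choose_mul_factorial_mul_factorial (n := N) (k := p.1) (by omega)
      rw [show N - p.1 = p.2 by omega] at h
      exact_mod_cast h
    have e : inner ℂ (expTerm A x p.1) (expTerm A y p.2) =
        (p.1 ! : ℂ)⁻¹ * (p.2 ! : ℂ)⁻¹ * ((-1) ^ p.1 * inner ℂ (x : F) ((A ^ N) y : F)) := by
      rw [expTerm, expTerm, inner_smul_left, inner_smul_right, inner_pow_of_skew hA,
        ← Module.End.mul_apply, ← pow_add, hN, map_inv₀, Complex.conj_natCast]
      ring
    have f1 : (p.1 ! : ℂ) ≠ 0 := Nat.cast_ne_zero.2 (Nat.factorial_ne_zero _)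
    have f2 : (p.2 ! : ℂ) ≠ 0 := Nat.cast_ne_zero.2 (Nat.factorial_ne_zero _)
    have f3 : (N.choose p.1 : ℂ) ≠ 0 := Nat.cast_ne_zero.2 (Nat.choose_pos (by omega)).ne'
    rw [e, ← hf, nsmul_eq_mul]
    field_simp
    simp
  rw [Finset.sum_congr rfl h1, ← Finset.mul_sum, ← (Commute.all (-1 : ℂ) 1).add_pow']
  rcases N with _ | N
  · simp
  · simp

/-- The exponential series preserves inner products: absolute convergence permits summing the double
series along antidiagonals, where only `N = 0` contributes. -/
theorem inner_tsum_expTerm {A : Module.End ℂ D₀}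
    (hA : ∀ x y : D₀, inner ℂ (A x : F) (y : F) = -inner ℂ (x : F) (A y : F)) {x y : D₀} {a b : F}
    (hx : Summable fun n => ‖expTerm A x n‖) (hy : Summable fun n => ‖expTerm A y n‖)
    (ha : HasSum (expTerm A x) a) (hb : HasSum (expTerm A y) b) :
    inner ℂ a b = inner ℂ (x : F) (y : F) := by
  have hs : Summable fun p : ℕ × ℕ => inner ℂ (expTerm A x p.1) (expTerm A y p.2) :=
    Summable.of_norm_bounded (hx.mul_of_nonneg hy (fun _ => norm_nonneg _) (fun _ => norm_nonneg _))
      fun p => norm_inner_le_norm _ _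
  have h1 : ∀ n, HasSum (fun m => inner ℂ (expTerm A x n) (expTerm A y m))
      (inner ℂ (expTerm A x n) b) := fun n => (innerSL ℂ (expTerm A x n)).hasSum hb
  have h2 : HasSum (fun n => inner ℂ (expTerm A x n) b) (inner ℂ a b) :=
    (innerSLFlip ℂ b).hasSum ha
  have h3 : ∑' p : ℕ × ℕ, inner ℂ (expTerm A x p.1) (expTerm A y p.2) = inner ℂ a b :=
    (hs.hasSum.prod_fiberwise h1).unique h2
  rw [← h3, ← Finset.HasAntidiagonal.sigmaAntidiagonalEquivProd.tsum_eq]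
  refine (Summable.tsum_sigma' (fun n => (hasSum_fintype _).summable)
      (Finset.HasAntidiagonal.sigmaAntidiagonalEquivProd.summable_iff.2 hs)).trans ?_
  have h4 : ∀ N, ∑' c : (Finset.HasAntidiagonal.antidiagonal N),
      inner ℂ (expTerm A x (Finset.HasAntidiagonal.sigmaAntidiagonalEquivProd ⟨N, c⟩).1)
        (expTerm A y (Finset.HasAntidiagonal.sigmaAntidiagonalEquivProd ⟨N, c⟩).2) =
      if N = 0 then inner ℂ (x : F) (y : F) else 0 := by
    intro N
    rw [← sum_antidiagonal_inner_expTerm hA, tsum_fintype]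
    exact Finset.sum_coe_sort (Finset.HasAntidiagonal.antidiagonal N)
      fun p => inner ℂ (expTerm A x p.1) (expTerm A y p.2)
  exact (tsum_congr h4).trans (tsum_ite_eq _ _)

/-- Termwise, the formal adjoint of `A^n` is `(-A)^n`; hence `e^{-A}` is the adjoint of `e^A` on the
core. -/
theorem inner_hasSum_expTerm_neg {A : Module.End ℂ D₀}
    (hA : ∀ x y : D₀, inner ℂ (A x : F) (y : F) = -inner ℂ (x : F) (A y : F)) {x y : D₀} {a b : F}
    (ha : HasSum (expTerm A x) a) (hb : HasSum (expTerm (-A) y) b) :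
    inner ℂ a (y : F) = inner ℂ (x : F) b := by
  have h1 : HasSum (fun n => inner ℂ (expTerm A x n) (y : F)) (inner ℂ a (y : F)) :=
    (innerSLFlip ℂ (y : F)).hasSum ha
  have h2 : HasSum (fun n => inner ℂ (x : F) (expTerm (-A) y n)) (inner ℂ (x : F) b) :=
    (innerSL ℂ (x : F)).hasSum hb
  refine h1.unique (h2.congr_fun fun n => ?_)
  rw [expTerm, expTerm, inner_smul_left, inner_smul_right, inner_pow_of_skew hA, map_inv₀,
    Complex.conj_natCast, neg_pow_apply, Submodule.coe_smul, inner_smul_right]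

theorem pow_commutator {A Φ : Module.End ℂ D₀} {c : ℂ} (hΦ : ∀ x, Φ (A x) = A (Φ x) + c • x)
    (n : ℕ) (x : D₀) :
    Φ ((A ^ n) x) = (A ^ n) (Φ x) + ((n : ℂ) * c) • (A ^ (n - 1)) x := by
  induction n with
  | zero => simp
  | succ n ih =>
    have h1 : ((n : ℂ) * c) • A ((A ^ (n - 1)) x) = ((n : ℂ) * c) • (A ^ n) x := by
      rcases n with _ | n
      · simp
      · rw [Nat.add_sub_cancel, ← Module.End.mul_apply, ← pow_succ']
    rw [pow_succ', Module.End.mul_apply, hΦ, ih, map_add, map_smul, h1, Module.End.mul_apply,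
      add_assoc, ← add_smul, Nat.add_sub_cancel]
    push_cast
    ring_nf

/-- This is `[L, A^n] = n A^{n-1} Φ + (n(n-1)/2) c A^{n-2}` for the operator `L` with graph `G`.
Stating it with a relation avoids assuming that `L` is defined on all of `D₀`. The truncated
exponents are harmless, as the coefficients vanish for small `n`. -/
theorem pow_double_commutator {A Φ : Module.End ℂ D₀} {c : ℂ}
    (hΦ : ∀ x, Φ (A x) = A (Φ x) + c • x) {G : D₀ → D₀ → Prop}
    (hG : ∀ x u, G x u → G (A x) (A u + Φ x)) {x u : D₀} (hxu : G x u) (n : ℕ) :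
    G ((A ^ n) x) ((A ^ n) u + (n : ℂ) • (A ^ (n - 1)) (Φ x)
      + ((n : ℂ) * (n - 1) * (c / 2)) • (A ^ (n - 2)) x) := by
  induction n with
  | zero => simpa using hxu
  | succ n ih =>
    have h := hG _ _ ih
    rw [pow_commutator hΦ] at h
    have e0 : ∀ y, A ((A ^ n) y) = (A ^ (n + 1)) y := fun y => by
      rw [pow_succ', Module.End.mul_apply]
    have e1 : (n : ℂ) • A ((A ^ (n - 1)) (Φ x)) = (n : ℂ) • (A ^ n) (Φ x) := by
      rcases n with _ | n
      · simp
      · rw [Nat.add_sub_cancel, ← Module.End.mul_apply, ← pow_succ']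
    have e2 : ((n : ℂ) * (n - 1) * (c / 2)) • A ((A ^ (n - 2)) x) =
        ((n : ℂ) * (n - 1) * (c / 2)) • (A ^ (n - 1)) x := by
      rcases n with _ | _ | n
      · simp
      · simp
      · rw [show n + 1 + 1 - 2 = n by omega, show n + 1 + 1 - 1 = n + 1 by omega,
          ← Module.End.mul_apply, ← pow_succ']
    rw [map_add, map_add, map_smul, map_smul, e0, e0, e1, e2] at h
    convert h using 1
    rw [Nat.add_sub_cancel, show n + 1 - 2 = n - 1 by omega]
    push_cast
    module

/-- Since `n / n! = 1 / (n-1)!`, the correction terms from the commutators are again exponential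
series, shifted by one here and by two in the next lemma. -/
theorem hasSum_expTerm_succ_shift {A : Module.End ℂ D₀} {x : D₀} {a : F}
    (ha : HasSum (expTerm A x) a) :
    HasSum (fun n : ℕ => ((n ! : ℂ)⁻¹ * n) • (((A ^ (n - 1)) x : D₀) : F)) a := by
  rw [← hasSum_nat_add_iff' 1]
  simp only [Finset.range_one, Finset.sum_singleton, Nat.cast_zero, mul_zero, zero_smul, sub_zero,
    Nat.add_sub_cancel]
  refine ha.congr_fun fun n => ?_
  rw [expTerm, Nat.factorial_succ]
  congr 1
  have h1 : ((n : ℂ) + 1) ≠ 0 := Nat.cast_add_one_ne_zero n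
  push_cast
  field_simp

theorem hasSum_expTerm_two_shift {A : Module.End ℂ D₀} {x : D₀} {a : F}
    (ha : HasSum (expTerm A x) a) :
    HasSum (fun n : ℕ => ((n ! : ℂ)⁻¹ * (n * (n - 1))) • (((A ^ (n - 2)) x : D₀) : F)) a := by
  rw [← hasSum_nat_add_iff' 2]
  have h0 : ∑ i ∈ Finset.range 2,
      ((i ! : ℂ)⁻¹ * (i * (i - 1))) • (((A ^ (i - 2)) x : D₀) : F) = 0 := by
    simp [Finset.sum_range_succ]
  rw [h0, sub_zero]
  refine ha.congr_fun fun n => ?_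
  rw [expTerm, Nat.factorial_succ, Nat.factorial_succ, Nat.add_sub_cancel]
  congr 1
  have h1 : ((n : ℂ) + 1) ≠ 0 := Nat.cast_add_one_ne_zero n
  have h2 : ((n : ℂ) + 1 + 1) ≠ 0 := by exact_mod_cast Nat.succ_ne_zero (n + 1)
  push_cast
  field_simp
  ring

/-- If `[L, A] = Φ` and `[Φ, A] = c`, where `G` is the graph of `L`, then
`L e^A = e^A (L + Φ + c / 2)`, tested against pairs `(ξ, ξ')` in the graph of the adjoint of `L`. -/
theorem inner_exp_commutator {A Φ : Module.End ℂ D₀} {c : ℂ}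
    (hΦ : ∀ x, Φ (A x) = A (Φ x) + c • x) {G : D₀ → D₀ → Prop}
    (hG : ∀ x u, G x u → G (A x) (A u + Φ x)) {W : F ≃ₗᵢ[ℂ] F}
    (hW : ∀ x : D₀, HasSum (expTerm A x) (W x)) {x u : D₀} (hxu : G x u) {ξ ξ' : F}
    (hξ : ∀ x u : D₀, G x u → inner ℂ ξ' (x : F) = inner ℂ ξ (u : F)) :
    inner ℂ ξ' (W x) = inner ℂ ξ (W ((u : F) + Φ x + (c / 2) • (x : F))) := by
  have h1 : HasSum (fun n => inner ℂ ξ' (expTerm A x n)) (inner ℂ ξ' (W x)) :=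
    (innerSL ℂ ξ').hasSum (hW x)
  have h2 := ((hW u).add (hasSum_expTerm_succ_shift (hW (Φ x)))).add
    ((hasSum_expTerm_two_shift (hW x)).const_smul (c / 2))
  have h3 := (innerSL ℂ ξ).hasSum h2
  rw [map_add, map_add, map_smul]
  refine h1.unique (h3.congr_fun fun n => ?_)
  have h4 := hξ _ _ (pow_double_commutator hΦ hG hxu n)
  rw [expTerm, inner_smul_right, h4, ← inner_smul_right, innerSL_apply_apply]
  congr 1
  simp only [expTerm, Submodule.coe_add, Submodule.coe_smul]
  module

variable [CompleteSpace F]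

/-- The series is isometric on `D₀` by `inner_tsum_expTerm` and extends by density. -/
theorem exists_isometry_exp (hD : Dense (D₀ : Set F)) {A : Module.End ℂ D₀}
    (hA : ∀ x y : D₀, inner ℂ (A x : F) (y : F) = -inner ℂ (x : F) (A y : F))
    (hs : ∀ x, Summable fun n => ‖expTerm A x n‖) :
    ∃ W : F →ₗᵢ[ℂ] F, ∀ x : D₀, HasSum (expTerm A x) (W x) := by
  have hsum : ∀ x, HasSum (expTerm A x) (∑' n, expTerm A x n) := fun x => (hs x).of_norm.hasSum
  let W₀ : D₀ →ₗ[ℂ] F :=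
    { toFun := fun x => ∑' n, expTerm A x n
      map_add' := fun x y => by
        rw [← ((hsum x).add (hsum y)).tsum_eq]
        refine tsum_congr fun n => ?_
        simp [expTerm]
      map_smul' := fun c x => by
        rw [RingHom.id_apply, ← ((hsum x).const_smul c).tsum_eq]
        refine tsum_congr fun n => ?_
        simp [expTerm, smul_smul, mul_comm] }
  have hiso : ∀ x : D₀, ‖W₀ x‖ = ‖(x : F)‖ := by
    intro x
    have := inner_tsum_expTerm hA (hs x) (hs x) (hsum x) (hsum x)
    rw [inner_self_eq_norm_sq_to_K, inner_self_eq_norm_sq_to_K] at this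
    have h2 : ‖∑' n, expTerm A x n‖ ^ 2 = ‖(x : F)‖ ^ 2 := by exact_mod_cast this
    exact (sq_eq_sq₀ (norm_nonneg _) (norm_nonneg _)).1 h2
  let W₁ : D₀ →L[ℂ] F := W₀.mkContinuous 1 fun x => by rw [hiso, one_mul]; rfl
  let W₂ : F →L[ℂ] F := W₁.extend D₀.subtypeL
  have hW₂ : ∀ x : D₀, W₂ x = W₀ x := fun x =>
    ContinuousLinearMap.extend_eq _ hD.denseRange_val
      isUniformEmbedding_subtype_val.isUniformInducing _
  have hnorm : ∀ x : F, ‖W₂ x‖ = ‖x‖ := by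
    intro x
    refine hD.induction (P := fun x => ‖W₂ x‖ = ‖x‖) (fun y hy => ?_)
      (isClosed_eq (by fun_prop) (by fun_prop)) x
    have := hW₂ ⟨y, hy⟩
    simp only at this
    rw [this, hiso]
  exact ⟨⟨W₂.toLinearMap, hnorm⟩, fun x => by
    have : (W₂ : F → F) x = ∑' n, expTerm A x n := hW₂ x
    change HasSum _ (W₂ x)
    rw [this]
    exact hsum x⟩

/-- The exponential of a skew-symmetric operator with a dense invariant domain of entire vectors
extends to a unitary operator. -/
theorem exists_unitary_exp (hD : Dense (D₀ : Set F)) {A : Module.End ℂ D₀}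
    (hA : ∀ x y : D₀, inner ℂ (A x : F) (y : F) = -inner ℂ (x : F) (A y : F))
    (hs : ∀ x, Summable fun n => ‖expTerm A x n‖) :
    ∃ W : F ≃ₗᵢ[ℂ] F, (∀ x : D₀, HasSum (expTerm A x) (W x)) ∧
      ∀ x : D₀, HasSum (expTerm (-A) x) (W.symm x) := by
  obtain ⟨W, hW⟩ := exists_isometry_exp hD hA hs
  have hA' : ∀ x y : D₀, inner ℂ ((-A) x : F) (y : F) = -inner ℂ (x : F) ((-A) y : F) := by
    intro x y
    simp [hA]
  have hs' : ∀ x, Summable fun n => ‖expTerm (-A) x n‖ := fun x => (hs x).congr fun n => by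
    rw [norm_expTerm, norm_expTerm, neg_pow_apply, Submodule.coe_smul, norm_smul]
    simp
  obtain ⟨W', hW'⟩ := exists_isometry_exp hD hA' hs'
  -- The isometries built from `A` and `-A` are mutually adjoint, hence mutually inverse; this
  -- supplies surjectivity.
  have hadj : ∀ x y : F, inner ℂ (W x) y = inner ℂ x (W' y) := by
    have h1 : ∀ x ∈ D₀, ∀ y ∈ D₀, inner ℂ (W x) y = inner ℂ x (W' y) := fun x hx y hy =>
      inner_hasSum_expTerm_neg hA (hW ⟨x, hx⟩) (hW' ⟨y, hy⟩)
    have h2 : ∀ x ∈ D₀, ∀ y, inner ℂ (W x) y = inner ℂ x (W' y) := fun x hx y =>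
      hD.induction (P := fun y => inner ℂ (W x) y = inner ℂ x (W' y)) (h1 x hx)
        (isClosed_eq (by fun_prop) (by have := W'.continuous; fun_prop)) y
    exact fun x y => hD.induction (P := fun x => inner ℂ (W x) y = inner ℂ x (W' y))
      (fun x hx => h2 x hx y)
        (isClosed_eq (by have := W.continuous; fun_prop) (by fun_prop)) x
  have h1 : ∀ x, W' (W x) = x := fun x => ext_inner_left ℂ fun y => by
    rw [← hadj, W.inner_map_map]
  have h2 : ∀ x, W (W' x) = x := fun x => ext_inner_right ℂ fun y => by
    rw [hadj, W'.inner_map_map]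
  exact ⟨⟨LinearEquiv.ofLinearMap W.toLinearMap W'.toLinearMap (LinearMap.ext h2) (LinearMap.ext h1),
    W.norm_map⟩, hW, hW'⟩

end Exponential

/-! ### The `n`-boson spaces: ladder operators and the multiplication operator -/

section Sectors

variable {X : Type*} [MeasurableSpace X] {μ : Measure X} [SigmaFinite μ]

/-! ### Partial integration -/

variable (X) in
/-- `(k, x) ↦ (x, k₁, …, kₙ)` as a measurable equivalence. -/
def consEquiv (n : ℕ) : (Fin n → X) × X ≃ᵐ (Fin (n + 1) → X) :=
  MeasurableEquiv.prodComm.trans (MeasurableEquiv.piFinSuccAbove (fun _ : Fin (n + 1) => X) 0).symm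

theorem consEquiv_zero (n : ℕ) (p : (Fin n → X) × X) : consEquiv X n p 0 = p.2 := rfl

theorem consEquiv_succ (n : ℕ) (p : (Fin n → X) × X) (i : Fin n) :
    consEquiv X n p i.succ = p.1 i := rfl

theorem measurePreserving_consEquiv (n : ℕ) :
    MeasurePreserving (consEquiv X n) ((Measure.pi (fun _ : Fin n => μ)).prod μ)
      (Measure.pi (fun _ : Fin (n + 1) => μ)) :=
  ((measurePreserving_piFinSuccAbove (fun _ : Fin (n + 1) => μ) 0).symm _).comp
    Measure.measurePreserving_swap

theorem ae_ae_consEquiv {n : ℕ} {p : (Fin (n + 1) → X) → Prop}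
    (h : ∀ᵐ K ∂Measure.pi (fun _ : Fin (n + 1) => μ), p K) :
    ∀ᵐ k ∂Measure.pi (fun _ : Fin n => μ), ∀ᵐ x ∂μ, p (consEquiv X n (k, x)) :=
  Measure.ae_ae_of_ae_prod ((measurePreserving_consEquiv n).quasiMeasurePreserving.ae h)

theorem consEquiv_succAbove_succ (n : ℕ) (k : Fin (n + 1) → X) (x : X) (j : Fin (n + 1)) :
    (fun i => consEquiv X (n + 1) (k, x) (j.succ.succAbove i)) =
      consEquiv X n (fun i => k (j.succAbove i), x) := by
  funext i
  refine Fin.cases ?_ (fun i => ?_) i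
  · rw [Fin.succ_succAbove_zero]; rfl
  · rw [Fin.succ_succAbove_succ]; rfl

/-- The adjoint of `insertAt g n 0`. -/
def contract (g : Lp ℂ 2 μ) (n : ℕ) : NBody μ (n + 1) →L[ℂ] NBody μ n :=
  ContinuousLinearMap.adjoint (insertAt g n 0)

/-- The adjoint is identified through its integrals over sets of finite measure: pair with an
indicator function and use Fubini. σ-finiteness lets such integrals determine the function. -/
theorem coeFn_contract (g : Lp ℂ 2 μ) (n : ℕ) (Φ : NBody μ (n + 1)) :
    contract g n Φ =ᵐ[Measure.pi (fun _ : Fin n => μ)]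
      fun k => ∫ x, (starRingEnd ℂ) (g x) * Φ (consEquiv X n (k, x)) ∂μ := by
  have main : ∀ s : Set (Fin n → X), MeasurableSet s →
      Measure.pi (fun _ : Fin n => μ) s < ∞ →
      IntegrableOn (fun k => ∫ x, (starRingEnd ℂ) (g x) * Φ (consEquiv X n (k, x)) ∂μ) s
        (Measure.pi (fun _ : Fin n => μ)) ∧
      ∫ k in s, contract g n Φ k ∂Measure.pi (fun _ : Fin n => μ) =
        ∫ k in s, (∫ x, (starRingEnd ℂ) (g x) * Φ (consEquiv X n (k, x)) ∂μ)
          ∂Measure.pi (fun _ : Fin n => μ) := by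
    intro s hs hμs
    set χ : NBody μ n := indicatorConstLp 2 hs hμs.ne (1 : ℂ) with hχ
    set T : (Fin n → X) × X → ℂ := fun p =>
      s.indicator (fun _ => (1 : ℂ)) p.1 * ((starRingEnd ℂ) (g p.2) * Φ (consEquiv X n p)) with hT
    have hmp := measurePreserving_consEquiv (μ := μ) n
    have e1 : (fun p => inner ℂ (insertAt g n 0 χ (consEquiv X n p)) (Φ (consEquiv X n p)))
        =ᵐ[(Measure.pi (fun _ : Fin n => μ)).prod μ] T := by
      have h1 := hmp.quasiMeasurePreserving.ae (coeFn_insertAt g n 0 χ)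
      have h2 := Measure.quasiMeasurePreserving_fst (ν := μ) |>.ae
        (indicatorConstLp_coeFn (p := 2) (hs := hs) (hμs := hμs.ne) (c := (1 : ℂ)))
      filter_upwards [h1, h2] with p h1 h2
      have e3 : (fun i => consEquiv X n p ((0 : Fin (n + 1)).succAbove i)) = p.1 := rfl
      rw [h1, e3, consEquiv_zero, hχ, h2, RCLike.inner_apply, hT]
      by_cases hp : p.1 ∈ s <;> simp [hp, mul_comm]
    have hint : Integrable T ((Measure.pi (fun _ : Fin n => μ)).prod μ) :=
      ((hmp.integrable_comp_emb (consEquiv X n).measurableEmbedding).2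
        (L2.integrable_inner (𝕜 := ℂ) (insertAt g n 0 χ) Φ)).congr e1
    have e2 : (fun k => ∫ x, T (k, x) ∂μ) =
        s.indicator (fun k => ∫ x, (starRingEnd ℂ) (g x) * Φ (consEquiv X n (k, x)) ∂μ) := by
      funext k
      by_cases hk : k ∈ s <;> simp [hT, hk]
    have h3 := hint.integral_prod_left
    rw [e2, integrable_indicator_iff hs] at h3
    refine ⟨h3, ?_⟩
    rw [← L2.inner_indicatorConstLp_one (𝕜 := ℂ) hs hμs.ne (contract g n Φ), ← hχ, contract,
      ContinuousLinearMap.adjoint_inner_right, L2.inner_def, ← hmp.integral_comp',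
      integral_congr_ae e1, integral_prod _ hint, e2, integral_indicator hs]
  refine ae_eq_of_forall_setIntegral_eq_of_sigmaFinite (fun s hs hμs => ?_)
    (fun s hs hμs => (main s hs hμs).1) (fun s hs hμs => (main s hs hμs).2)
  exact integrableOn_Lp_of_measure_ne_top _ one_le_two hμs.ne

theorem contract_insertAt_zero (g f : Lp ℂ 2 μ) (n : ℕ) (ψ : NBody μ n) :
    contract g n (insertAt f n 0 ψ) = (inner ℂ g f : ℂ) • ψ := by
  apply Lp.ext
  filter_upwards [coeFn_contract g n (insertAt f n 0 ψ), Lp.coeFn_smul (inner ℂ g f : ℂ) ψ,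
    ae_ae_consEquiv (coeFn_insertAt f n 0 ψ)] with k h1 h2 h3
  rw [h1, h2, Pi.smul_apply, L2.inner_def, smul_eq_mul, ← integral_mul_const]
  refine integral_congr_ae ?_
  filter_upwards [h3] with x h3
  rw [h3, consEquiv_zero, RCLike.inner_apply]
  have e3 : (fun i => consEquiv X n (k, x) ((0 : Fin (n + 1)).succAbove i)) = k := rfl
  rw [e3]
  ring

theorem contract_insertAt_succ (g f : Lp ℂ 2 μ) (n : ℕ) (j : Fin (n + 1)) (ψ : NBody μ (n + 1)) :
    contract g (n + 1) (insertAt f (n + 1) j.succ ψ) = insertAt f n j (contract g n ψ) := by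
  apply Lp.ext
  filter_upwards [coeFn_contract g (n + 1) (insertAt f (n + 1) j.succ ψ),
    coeFn_insertAt f n j (contract g n ψ),
    (quasiMeasurePreserving_succAbove (μ := μ) n j).ae (coeFn_contract g n ψ),
    ae_ae_consEquiv (coeFn_insertAt f (n + 1) j.succ ψ)] with k h1 h2 h3 h4
  rw [h1, h2, h3, ← integral_const_mul]
  refine integral_congr_ae ?_
  filter_upwards [h4] with x h4
  rw [h4, consEquiv_succ, consEquiv_succAbove_succ]
  ring

theorem contract_mem (g : Lp ℂ 2 μ) (n : ℕ) (Φ : symSpace μ (n + 1)) :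
    contract g n Φ ∈ symSpace μ n := by
  intro σ
  have h := coeFn_contract g n (Φ : NBody μ (n + 1))
  -- The permutation `decomposeFin.symm (0, σ)` of `n + 1` indices fixes the integrated slot `0` and
  -- acts as `σ` on the others.
  filter_upwards [h, (measurePreserving_perm μ n σ).quasiMeasurePreserving.ae h,
    ae_ae_consEquiv (Φ.2 (Equiv.Perm.decomposeFin.symm (0, σ)))] with k h1 h2 h3
  rw [h1, h2]
  refine integral_congr_ae ?_
  filter_upwards [h3] with x h3
  rw [← h3]
  congr 2
  funext i
  refine Fin.cases ?_ (fun i => ?_) i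
  · rw [Equiv.Perm.decomposeFin_symm_apply_zero]; rfl
  · rw [Equiv.Perm.decomposeFin_symm_apply_succ, Equiv.swap_self]; rfl

/-! ### Canonical commutation relations between sectors -/

/-- The inverse of `j.cycleRange` sends `0` to `j` and enumerates the other slots in order, so all
insertions are relabelings of the one in slot `0`. -/
theorem insertAt_eq_perm (f : Lp ℂ 2 μ) (n : ℕ) (j : Fin (n + 1)) (χ : NBody μ n) :
    insertAt f n j χ = Lp.compMeasurePreservingₗᵢ ℂ _
      (measurePreserving_perm μ (n + 1) j.cycleRange.symm) (insertAt f n 0 χ) := by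
  apply Lp.ext
  have h := coeFn_insertAt f n 0 χ
  have hp := measurePreserving_perm μ (n + 1) j.cycleRange.symm
  filter_upwards [coeFn_insertAt f n j χ, hp.quasiMeasurePreserving.ae h,
    Lp.coeFn_compMeasurePreserving (insertAt f n 0 χ) hp] with k h1 h2 h3
  refine h1.trans (Eq.trans ?_ h3.symm)
  rw [Function.comp_apply, h2, Fin.cycleRange_symm_zero]
  congr 2
  funext i
  rw [Fin.succAbove_zero, Fin.cycleRange_symm_succ]

theorem compMeasurePreserving_symSpace {n : ℕ} (Φ : symSpace μ n) (σ : Equiv.Perm (Fin n)) :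
    Lp.compMeasurePreservingₗᵢ ℂ _ (measurePreserving_perm μ n σ) (Φ : NBody μ n) = Φ :=
  Lp.ext ((Lp.coeFn_compMeasurePreserving (Φ : NBody μ n) (measurePreserving_perm μ n σ)).trans
    (Φ.2 σ))

theorem inner_insertAt_symSpace (f : Lp ℂ 2 μ) (n : ℕ) (j : Fin (n + 1)) (χ : NBody μ n)
    (Φ : symSpace μ (n + 1)) :
    inner ℂ (insertAt f n j χ) (Φ : NBody μ (n + 1)) =
      inner ℂ (insertAt f n 0 χ) (Φ : NBody μ (n + 1)) := by
  rw [insertAt_eq_perm, ← compMeasurePreserving_symSpace Φ j.cycleRange.symm,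
    LinearIsometry.inner_map_map, compMeasurePreserving_symSpace]

theorem sqrt_succ_mul_self (n : ℕ) :
    (Real.sqrt (n + 1) : ℂ) * (Real.sqrt (n + 1) : ℂ) = n + 1 := by
  rw [← Complex.ofReal_mul, Real.mul_self_sqrt (by positivity)]
  push_cast
  rfl

theorem sqrt_succ_ne_zero (n : ℕ) : (Real.sqrt (n + 1) : ℂ) ≠ 0 :=
  Complex.ofReal_ne_zero.2 (Real.sqrt_pos.2 (by positivity)).ne'

theorem createAux_apply (f : Lp ℂ 2 μ) (n : ℕ) (χ : NBody μ n) :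
    createAux f n χ = (Real.sqrt (n + 1) : ℂ)⁻¹ • ∑ j : Fin (n + 1), insertAt f n j χ := by
  simp [createAux]

/-- Against a symmetric vector all `n + 1` insertions have the same pairing, and `(n+1) / √(n+1) =
√(n+1)`. -/
theorem inner_createAux_symSpace (f : Lp ℂ 2 μ) (n : ℕ) (χ : NBody μ n)
    (Φ : symSpace μ (n + 1)) :
    inner ℂ (createAux f n χ) (Φ : NBody μ (n + 1)) =
      Real.sqrt (n + 1) * inner ℂ (insertAt f n 0 χ) (Φ : NBody μ (n + 1)) := by
  rw [createAux_apply, inner_smul_left, sum_inner,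
    Finset.sum_congr rfl fun j _ => inner_insertAt_symSpace f n j χ Φ, Finset.sum_const,
    Finset.card_univ, Fintype.card_fin, map_inv₀, Complex.conj_ofReal, nsmul_eq_mul]
  push_cast
  rw [← sqrt_succ_mul_self]
  have := sqrt_succ_ne_zero n
  field_simp

theorem coe_createSector (f : Lp ℂ 2 μ) (n : ℕ) (ψ : symSpace μ n) :
    (createSector f n ψ : NBody μ (n + 1)) = createAux f n ψ := rfl

/-- The abstract adjoint becomes a partial integration, so that the commutation relations reduce to
how `contract` meets a single insertion. -/
theorem coe_annihilateSector (f : Lp ℂ 2 μ) (n : ℕ) (Φ : symSpace μ (n + 1)) :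
    (annihilateSector f n Φ : NBody μ n) = (Real.sqrt (n + 1) : ℂ) • contract f n Φ := by
  have h : annihilateSector f n Φ = 
      (Real.sqrt (n + 1) : ℂ) • (⟨contract f n Φ, contract_mem f n Φ⟩ : symSpace μ n) := by
    refine ext_inner_left ℂ fun χ => ?_
    rw [annihilateSector, ContinuousLinearMap.adjoint_inner_right, Submodule.coe_inner,
      Submodule.coe_inner, coe_createSector, inner_createAux_symSpace, Submodule.coe_smul,
      inner_smul_right]
    exact congrArg _ (ContinuousLinearMap.adjoint_inner_right _ _ _).symm
  rw [h]
  rfl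

theorem contract_createAux (g f : Lp ℂ 2 μ) (n : ℕ) (ψ : NBody μ n) :
    (Real.sqrt (n + 1) : ℂ) • contract g n (createAux f n ψ) =
      ∑ j : Fin (n + 1), contract g n (insertAt f n j ψ) := by
  rw [createAux_apply, map_smul, smul_smul, mul_inv_cancel₀ (sqrt_succ_ne_zero n), one_smul,
    map_sum]

theorem annihilateSector_createSector_zero (g f : Lp ℂ 2 μ) (ψ : symSpace μ 0) :
    annihilateSector g 0 (createSector f 0 ψ) = (inner ℂ g f : ℂ) • ψ := by
  apply Subtype.ext
  rw [coe_annihilateSector, coe_createSector, contract_createAux, Fin.sum_univ_one,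
    contract_insertAt_zero]
  rfl

/-- Contracting slot `0` against the insertion in slot `0` gives `⟨g, f⟩`; insertions in later slots
commute with the contraction and reassemble to `a*(f) a(g)`. -/
theorem annihilateSector_createSector_succ (g f : Lp ℂ 2 μ) (n : ℕ) (ψ : symSpace μ (n + 1)) :
    annihilateSector g (n + 1) (createSector f (n + 1) ψ) =
      createSector f n (annihilateSector g n ψ) + (inner ℂ g f : ℂ) • ψ := by
  apply Subtype.ext
  rw [coe_annihilateSector, coe_createSector, contract_createAux, Fin.sum_univ_succ,
    contract_insertAt_zero, Submodule.coe_add, coe_createSector, coe_annihilateSector, map_smul,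
    createAux_apply, smul_smul, mul_inv_cancel₀ (sqrt_succ_ne_zero n), one_smul]
  simp only [contract_insertAt_succ]
  exact add_comm _ _

theorem insertAt_smul (c : ℂ) (f : Lp ℂ 2 μ) (n : ℕ) (j : Fin (n + 1)) (ψ : NBody μ n) :
    insertAt (c • f) n j ψ = c • insertAt f n j ψ := by
  apply Lp.ext
  have h := (Measure.quasiMeasurePreserving_eval (fun _ : Fin (n + 1) => μ) j).ae
    (Lp.coeFn_smul c f)
  filter_upwards [h, coeFn_insertAt (c • f) n j ψ, coeFn_insertAt f n j ψ,
    Lp.coeFn_smul c (insertAt f n j ψ)] with k h1 h2 h3 h4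
  rw [h2, h4, Pi.smul_apply, h3]
  have h1' : (c • f : Lp ℂ 2 μ) (k j) = c • f (k j) := h1
  rw [h1', smul_eq_mul, smul_eq_mul, mul_assoc]

theorem createSector_smul (c : ℂ) (f : Lp ℂ 2 μ) (n : ℕ) :
    createSector (c • f) n = c • createSector f n := by
  ext1 ψ
  apply Subtype.ext
  change createAux (c • f) n ψ = c • createAux f n ψ
  rw [createAux_apply, createAux_apply]
  simp only [insertAt_smul]
  rw [← Finset.smul_sum, smul_comm]

theorem annihilateSector_smul (c : ℂ) (f : Lp ℂ 2 μ) (n : ℕ) :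
    annihilateSector (c • f) n = (starRingEnd ℂ c) • annihilateSector f n := by
  rw [annihilateSector, createSector_smul, map_smulₛₗ]
  rfl

/-! ### The multiplication operator `ω(k₁) + ⋯ + ω(kₙ)` in a sector -/

/-- The graph of multiplication by `ω(k₁) + ⋯ + ω(kₙ)` on the `n`-boson space. -/
def SectorGraph (ω : X → ℝ) (n : ℕ) (ψ φ : symSpace μ n) : Prop :=
  ((φ : NBody μ n) : (Fin n → X) → ℂ) =ᵐ[Measure.pi (fun _ : Fin n => μ)]
    fun k => ((∑ j, ω (k j) : ℝ) : ℂ) * (ψ : NBody μ n) k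

theorem mem_dGammaGraph {ω : X → ℝ} {ψ φ : Fock μ} :
    (ψ, φ) ∈ dGammaGraph μ ω ↔ ∀ n, SectorGraph ω n (ψ n) (φ n) := Iff.rfl

theorem SectorGraph.inner_eq {ω : X → ℝ} {n : ℕ} {a b x y : symSpace μ n}
    (h : SectorGraph ω n a b) (h' : SectorGraph ω n x y) : inner ℂ b x = inner ℂ a y := by
  rw [Submodule.coe_inner, Submodule.coe_inner, L2.inner_def, L2.inner_def]
  refine integral_congr_ae ?_
  filter_upwards [h, h'] with k h h'
  rw [h, h', RCLike.inner_apply, RCLike.inner_apply, map_mul, Complex.conj_ofReal]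
  ring

theorem ae_le_sum {ω : X → ℝ} {m : ℝ} (hωm : ∀ᵐ k ∂μ, m ≤ ω k) (n : ℕ) :
    ∀ᵐ k ∂Measure.pi (fun _ : Fin n => μ), m * n ≤ ∑ j, ω (k j) := by
  have h := ae_all_iff.2 fun j : Fin n =>
    (Measure.quasiMeasurePreserving_eval (fun _ : Fin n => μ) j).ae hωm
  filter_upwards [h] with k hk
  calc m * n = ∑ _j : Fin n, m := by simp [mul_comm]
    _ ≤ _ := Finset.sum_le_sum fun j _ => hk j

/-- Here the mass gap enters: the energy of `n` bosons is at least `m n`, so `dΓ(ω)` controls the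
number operator. -/
theorem SectorGraph.norm_le {ω : X → ℝ} {m : ℝ} (hm : 0 < m) (hωm : ∀ᵐ k ∂μ, m ≤ ω k) {n : ℕ}
    {ψ φ : symSpace μ n} (h : SectorGraph ω n ψ φ) : n * ‖ψ‖ ≤ m⁻¹ * ‖φ‖ := by
  have h1 : ‖((m * n : ℝ) : ℂ) • (ψ : NBody μ n)‖ ≤ ‖(φ : NBody μ n)‖ := by
    refine Lp.norm_le_norm_of_ae_le ?_
    filter_upwards [h, ae_le_sum hωm n, Lp.coeFn_smul ((m * n : ℝ) : ℂ) (ψ : NBody μ n)]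
      with k h1 h2 h3
    rw [h1, h3, Pi.smul_apply, norm_smul, norm_mul, Complex.norm_real, Complex.norm_real,
      Real.norm_of_nonneg (by positivity)]
    gcongr
    exact h2.trans (le_abs_self _)
  rw [norm_smul, Complex.norm_real, Real.norm_of_nonneg (by positivity)] at h1
  rw [inv_mul_eq_div, le_div_iff₀ hm]
  calc n * ‖ψ‖ * m = m * n * ‖(ψ : NBody μ n)‖ := by rw [Submodule.coe_norm]; ring
    _ ≤ _ := h1

/-- The witness is multiplication by `(1 + ω(k₁) + ⋯ + ω(kₙ))⁻¹`, which is at most `1` and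
permutation invariant. -/
theorem exists_sectorGraph_resolvent {ω : X → ℝ} (hω : Measurable ω) (hω0 : ∀ᵐ k ∂μ, 0 ≤ ω k)
    (n : ℕ) (η : symSpace μ n) : ∃ χ : symSpace μ n, SectorGraph ω n χ (η - χ) ∧ ‖χ‖ ≤ ‖η‖ := by
  have h0 := ae_le_sum hω0 n
  simp only [zero_mul] at h0
  set u : (Fin n → X) → ℂ := fun k => ((1 + ∑ j, ω (k j) : ℝ) : ℂ)⁻¹ * (η : NBody μ n) k with hu
  have hle : ∀ᵐ k ∂Measure.pi (fun _ : Fin n => μ), ‖u k‖ ≤ 1 * ‖(η : NBody μ n) k‖ := by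
    filter_upwards [h0] with k hk
    rw [hu, norm_mul, norm_inv, Complex.norm_real, Real.norm_of_nonneg (by linarith)]
    gcongr
    exact inv_le_one_of_one_le₀ (by linarith)
  have hmeas : Measurable fun k : Fin n → X => ((1 + ∑ j, ω (k j) : ℝ) : ℂ)⁻¹ := by fun_prop
  have hL : MemLp u 2 (Measure.pi (fun _ : Fin n => μ)) :=
    (Lp.memLp (η : NBody μ n)).of_le_mul
      (hmeas.aestronglyMeasurable.mul (Lp.aestronglyMeasurable (η : NBody μ n))) hle
  have hmem : hL.toLp u ∈ symSpace μ n := by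
    intro σ
    have h := hL.coeFn_toLp
    filter_upwards [h, (measurePreserving_perm μ n σ).quasiMeasurePreserving.ae h, η.2 σ]
      with k h1 h2 h3
    rw [h1, h2, hu]
    simp only
    rw [h3, Equiv.sum_comp σ fun j => ω (k j)]
  refine ⟨⟨hL.toLp u, hmem⟩, ?_, ?_⟩
  · have e : ((η - ⟨hL.toLp u, hmem⟩ : symSpace μ n) : NBody μ n) = (η : NBody μ n) - hL.toLp u := rfl
    unfold SectorGraph
    rw [e]
    filter_upwards [h0, hL.coeFn_toLp, Lp.coeFn_sub (η : NBody μ n) (hL.toLp u)] with k h1 h2 h3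
    rw [h3, Pi.sub_apply, h2, hu]
    have h4 : ((1 + ∑ j, ω (k j) : ℝ) : ℂ) ≠ 0 := Complex.ofReal_ne_zero.2 (by linarith)
    have h5 : ((∑ j, ω (k j) : ℝ) : ℂ) = ((1 + ∑ j, ω (k j) : ℝ) : ℂ) - 1 := by
      push_cast; ring
    rw [h5]
    field_simp
  · have := Lp.norm_le_mul_norm_of_ae_le_mul (c := 1) (f := hL.toLp u) (g := (η : NBody μ n)) (by
      filter_upwards [hle, hL.coeFn_toLp] with k h1 h2
      rwa [h2])
    rwa [one_mul] at this

theorem sectorGraph_of_forall_inner {ω : X → ℝ} (hω : Measurable ω) (hω0 : ∀ᵐ k ∂μ, 0 ≤ ω k)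
    {n : ℕ} {x y : symSpace μ n}
    (h : ∀ a b, SectorGraph ω n a b → inner ℂ b x = inner ℂ a y) : SectorGraph ω n x y := by
  refine rel_of_forall_inner (fun a b x y h h' => h.inner_eq h') 1 (fun η => ?_) h
  obtain ⟨χ, hχ, -⟩ := exists_sectorGraph_resolvent hω hω0 n η
  exact ⟨χ, by simpa using hχ⟩

/-- `[dΓ(ω), a*(g)] = a*(ω g)` on sectors. -/
theorem SectorGraph.createSector {ω : X → ℝ} {f g : Lp ℂ 2 μ}
    (hfg : f =ᵐ[μ] fun k => (ω k : ℂ) * g k) {n : ℕ} {ψ φ : symSpace μ n}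
    (h : SectorGraph ω n ψ φ) :
    SectorGraph ω (n + 1) (createSector g n ψ) (createSector g n φ + createSector f n ψ) := by
  have e : ((GSB.createSector g n φ + GSB.createSector f n ψ : symSpace μ (n + 1)) :
      NBody μ (n + 1)) = createAux g n φ + createAux f n ψ := rfl
  unfold SectorGraph
  rw [e, coe_createSector]
  have h1 := ae_all_iff.2 fun j : Fin (n + 1) =>
    (quasiMeasurePreserving_succAbove (μ := μ) n j).ae h
  have h2 := ae_all_iff.2 fun j : Fin (n + 1) =>
    (Measure.quasiMeasurePreserving_eval (fun _ : Fin (n + 1) => μ) j).ae hfg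
  filter_upwards [Lp.coeFn_add (createAux g n (φ : NBody μ n)) (createAux f n (ψ : NBody μ n)),
    coeFn_createAux g n (φ : NBody μ n), coeFn_createAux f n (ψ : NBody μ n),
    coeFn_createAux g n (ψ : NBody μ n), h1, h2] with k e1 e2 e3 e4 e5 e6
  rw [e1, Pi.add_apply, e2, e3, e4, ← mul_add, ← Finset.sum_add_distrib, mul_left_comm]
  congr 1
  rw [Finset.mul_sum]
  refine Finset.sum_congr rfl fun j _ => ?_
  have e6' : f (k j) = (ω (k j) : ℂ) * g (k j) := e6 j
  -- The energy splits into `ω(k_j)`, which turns `g` into `f`, and the energy of the other bosons.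
  rw [e5 j, e6', Fin.sum_univ_succAbove (fun i => ω (k i)) j]
  push_cast
  ring

/-- `[dΓ(ω), a(g)] = -a(ω g)` on sectors. -/
theorem SectorGraph.annihilateSector {ω : X → ℝ} (hω : Measurable ω) (hω0 : ∀ᵐ k ∂μ, 0 ≤ ω k)
    {f g : Lp ℂ 2 μ} (hfg : f =ᵐ[μ] fun k => (ω k : ℂ) * g k) {n : ℕ} {ψ φ : symSpace μ (n + 1)}
    (h : SectorGraph ω (n + 1) ψ φ) :
    SectorGraph ω n (annihilateSector g n ψ) (annihilateSector g n φ - annihilateSector f n ψ) := by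
  -- By self-adjointness it suffices to test against the graph, where the claim is dual to the
  -- relation for creation.
  refine sectorGraph_of_forall_inner hω hω0 fun a b hab => ?_
  have h1 := (hab.createSector hfg).inner_eq h
  rw [inner_add_left] at h1
  simp only [GSB.annihilateSector, inner_sub_right, ContinuousLinearMap.adjoint_inner_right]
  rw [← h1]
  ring

theorem sectorGraph_zero (ω : X → ℝ) (ψ : symSpace μ 0) : SectorGraph ω 0 ψ 0 := by
  have e : ((0 : symSpace μ 0) : NBody μ 0) = 0 := rfl
  unfold SectorGraph
  rw [e]
  filter_upwards [Lp.coeFn_zero ℂ 2 (Measure.pi (fun _ : Fin 0 => μ))] with k hk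
  rw [hk]
  simp

end Sectors

/-! ### Ladder operators and second quantization on the whole Fock space -/

section FockOperators

variable {X : Type*} [MeasurableSpace X] {μ : Measure X} [SigmaFinite μ]

/-! ### Norm estimates on the Fock space -/

theorem hasSum_norm_sq (ψ : Fock μ) : HasSum (fun n => ‖ψ n‖ ^ 2) (‖ψ‖ ^ 2) := by
  have := lp.hasSum_norm (p := 2) (by norm_num) ψ
  simpa using this

/-- With `le_of_sq_le_two_mul`, this lets sectorwise bounds by sums of two norms be squared, summed
over sectors and unsquared, at the cost of a factor `2`. -/
theorem sq_le_two_mul_sq_add {C a b c : ℝ} (hc : 0 ≤ c) (h : c ≤ C * (a + b)) :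
    c ^ 2 ≤ 2 * C ^ 2 * (a ^ 2 + b ^ 2) := by
  calc c ^ 2 ≤ (C * (a + b)) ^ 2 := by gcongr
    _ ≤ _ := by nlinarith [mul_nonneg (sq_nonneg C) (sq_nonneg (a - b))]

theorem le_of_sq_le_two_mul {C a b c : ℝ} (hC : 0 ≤ C) (ha : 0 ≤ a) (hb : 0 ≤ b)
    (h : c ^ 2 ≤ 2 * C ^ 2 * (a ^ 2 + b ^ 2)) : c ≤ 2 * C * (a + b) := by
  refine le_of_sq_le_sq ?_ (by positivity)
  nlinarith [mul_nonneg (sq_nonneg C) (mul_nonneg ha hb),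
    mul_nonneg (sq_nonneg C) (sq_nonneg a), mul_nonneg (sq_nonneg C) (sq_nonneg b)]

theorem norm_le_of_forall_succ_le {y x x' : Fock μ} {C : ℝ} (hC : 0 ≤ C) (h0 : y 0 = 0)
    (h : ∀ n, ‖y (n + 1)‖ ≤ C * (‖x n‖ + ‖x' n‖)) : ‖y‖ ≤ 2 * C * (‖x‖ + ‖x'‖) := by
  refine le_of_sq_le_two_mul hC (norm_nonneg _) (norm_nonneg _) ?_
  have h1 : HasSum (fun n => ‖y (n + 1)‖ ^ 2) (‖y‖ ^ 2) := by
    rw [hasSum_nat_add_iff (f := fun n => ‖y n‖ ^ 2) 1]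
    simpa [h0] using hasSum_norm_sq y
  exact hasSum_le (fun n => sq_le_two_mul_sq_add (norm_nonneg _) (h n)) h1
    (((hasSum_norm_sq x).add (hasSum_norm_sq x')).mul_left (2 * C ^ 2))

theorem norm_le_of_forall_le_succ {y x x' : Fock μ} {C : ℝ} (hC : 0 ≤ C)
    (h : ∀ n, ‖y n‖ ≤ C * (‖x (n + 1)‖ + ‖x' (n + 1)‖)) : ‖y‖ ≤ 2 * C * (‖x‖ + ‖x'‖) := by
  refine le_of_sq_le_two_mul hC (norm_nonneg _) (norm_nonneg _) ?_
  have h1 : ∀ z : Fock μ, HasSum (fun n => ‖z (n + 1)‖ ^ 2) (‖z‖ ^ 2 - ‖z 0‖ ^ 2) := by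
    intro z
    rw [hasSum_nat_add_iff (f := fun n => ‖z n‖ ^ 2) 1]
    simpa using hasSum_norm_sq z
  refine (hasSum_le (fun n => sq_le_two_mul_sq_add (norm_nonneg _) (h n)) (hasSum_norm_sq y)
    (((h1 x).add (h1 x')).mul_left (2 * C ^ 2))).trans ?_
  gcongr <;> simp

theorem create_apply_zero (f : Lp ℂ 2 μ) (x : domSqrtNumber μ) :
    (create f x : Fock μ) 0 = 0 := rfl

theorem create_apply_succ (f : Lp ℂ 2 μ) (x : domSqrtNumber μ) (n : ℕ) :
    (create f x : Fock μ) (n + 1) = createSector f n ((x : Fock μ) n) := rfl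

theorem annihilate_apply (f : Lp ℂ 2 μ) (x : domSqrtNumber μ) (n : ℕ) :
    (annihilate f x : Fock μ) n = annihilateSector f n ((x : Fock μ) (n + 1)) := rfl

theorem inner_create (f : Lp ℂ 2 μ) (x y : domSqrtNumber μ) :
    inner ℂ (create f x : Fock μ) (y : Fock μ) = inner ℂ (x : Fock μ) (annihilate f y : Fock μ) := by
  have h1 := lp.hasSum_inner (𝕜 := ℂ) (create f x : Fock μ) (y : Fock μ)
  rw [← hasSum_nat_add_iff' 1] at h1
  simp only [Finset.range_one, Finset.sum_singleton, create_apply_zero, inner_zero_left,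
    sub_zero, create_apply_succ] at h1
  refine h1.unique ((lp.hasSum_inner (𝕜 := ℂ) (x : Fock μ) (annihilate f y : Fock μ)).congr_fun
    fun n => ?_)
  rw [annihilate_apply, annihilateSector, ContinuousLinearMap.adjoint_inner_right]

theorem create_smul (c : ℂ) (f : Lp ℂ 2 μ) (x : domSqrtNumber μ) :
    (create (c • f) x : Fock μ) = c • (create f x : Fock μ) := by
  apply lp.ext
  funext n
  cases n with
  | zero => exact (smul_zero (A := symSpace μ 0) c).symm
  | succ n =>
    rw [create_apply_succ, createSector_smul]
    rfl

theorem annihilate_smul (c : ℂ) (f : Lp ℂ 2 μ) (x : domSqrtNumber μ) :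
    (annihilate (c • f) x : Fock μ) = (starRingEnd ℂ c) • (annihilate f x : Fock μ) := by
  apply lp.ext
  funext n
  rw [annihilate_apply, annihilateSector_smul]
  rfl

/-! ### Second quantization -/

theorem mem_graph_dGamma {ω : X → ℝ} {ψ φ : Fock μ} :
    (ψ, φ) ∈ (dGamma μ ω).graph ↔ ∀ n, SectorGraph ω n (ψ n) (φ n) := by
  rw [dGamma_graph]
  exact mem_dGammaGraph

theorem inner_eq_of_mem_graph_dGamma {ω : X → ℝ} {a b x y : Fock μ}
    (hab : (a, b) ∈ (dGamma μ ω).graph) (hxy : (x, y) ∈ (dGamma μ ω).graph) :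
    inner ℂ b x = inner ℂ a y := by
  rw [mem_graph_dGamma] at hab hxy
  rw [lp.inner_eq_tsum, lp.inner_eq_tsum]
  exact tsum_congr fun n => (hab n).inner_eq (hxy n)

theorem exists_resolvent_dGamma {ω : X → ℝ} (hω : Measurable ω) (hω0 : ∀ᵐ k ∂μ, 0 ≤ ω k)
    (η : Fock μ) : ∃ χ : Fock μ, (χ, η - χ) ∈ (dGamma μ ω).graph := by
  choose χ hχ hn using fun n => exists_sectorGraph_resolvent hω hω0 n (η n)
  have hmem : Memℓp χ 2 := by
    rw [memℓp_two_iff]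
    refine Summable.of_nonneg_of_le (fun n => by positivity) (fun n => ?_)
      (hasSum_norm_sq η).summable
    have := hn n
    gcongr
  exact ⟨⟨χ, hmem⟩, mem_graph_dGamma.2 hχ⟩

theorem isSelfAdjoint_dGamma {ω : X → ℝ} (hω : Measurable ω) (hω0 : ∀ᵐ k ∂μ, 0 ≤ ω k) :
    IsSelfAdjoint (dGamma μ ω) :=
  isSelfAdjoint_of_surjective (fun _ _ _ _ => inner_eq_of_mem_graph_dGamma) 1 fun η => by
    simpa using exists_resolvent_dGamma hω hω0 η

theorem mem_domSqrtNumber_of_graph {ω : X → ℝ} {m : ℝ} (hm : 0 < m) (hωm : ∀ᵐ k ∂μ, m ≤ ω k)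
    {x y : Fock μ} (h : (x, y) ∈ (dGamma μ ω).graph) : x ∈ domSqrtNumber μ := by
  rw [mem_graph_dGamma] at h
  change Summable fun n : ℕ => (n : ℝ) * ‖x n‖ ^ 2
  refine Summable.of_nonneg_of_le (fun n => by positivity) (fun n => ?_)
    ((hasSum_norm_sq y).summable.mul_left (m⁻¹ ^ 2))
  have h1 := (h n).norm_le hm hωm
  have h2 : (n : ℝ) ≤ (n : ℝ) ^ 2 := by exact_mod_cast Nat.le_self_pow two_ne_zero n
  calc (n : ℝ) * ‖x n‖ ^ 2 ≤ (n : ℝ) ^ 2 * ‖x n‖ ^ 2 := by gcongr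
    _ = (n * ‖x n‖) ^ 2 := by ring
    _ ≤ (m⁻¹ * ‖y n‖) ^ 2 := by gcongr
    _ = _ := by ring

/-- The growth `√(n+1)` of the ladder operators is absorbed by the graph norm of `dΓ(ω)`; the crude
bound `√(n+1) ≤ n + 1` is enough. -/
theorem sqrt_succ_mul_norm_le {ω : X → ℝ} {m : ℝ} (hm : 0 < m) (hωm : ∀ᵐ k ∂μ, m ≤ ω k) {n : ℕ}
    {x y : symSpace μ n} (h : SectorGraph ω n x y) :
    Real.sqrt (n + 1) * ‖x‖ ≤ (1 + m⁻¹) * (‖x‖ + ‖y‖) := by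
  have h1 := h.norm_le hm hωm
  have h2 : Real.sqrt (n + 1) ≤ n + 1 := by
    rw [Real.sqrt_le_left (by positivity)]
    nlinarith [(Nat.cast_nonneg n : (0 : ℝ) ≤ n)]
  have h3 : 0 < m⁻¹ := inv_pos.2 hm
  calc Real.sqrt (n + 1) * ‖x‖ ≤ (n + 1) * ‖x‖ := by gcongr
    _ ≤ m⁻¹ * ‖y‖ + ‖x‖ := by linarith
    _ ≤ _ := by nlinarith [norm_nonneg x, norm_nonneg y, mul_nonneg h3.le (norm_nonneg x)]

theorem norm_create_le {ω : X → ℝ} {m : ℝ} (hm : 0 < m) (hωm : ∀ᵐ k ∂μ, m ≤ ω k)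
    (f : Lp ℂ 2 μ) {y : Fock μ} (x : domSqrtNumber μ)
    (h : ((x : Fock μ), y) ∈ (dGamma μ ω).graph) :
    ‖(create f x : Fock μ)‖ ≤ 2 * (‖f‖ * (1 + m⁻¹)) * (‖(x : Fock μ)‖ + ‖y‖) := by
  have hm' : 0 < m⁻¹ := inv_pos.2 hm
  rw [mem_graph_dGamma] at h
  refine norm_le_of_forall_succ_le (by positivity) (create_apply_zero f x) fun n => ?_
  rw [create_apply_succ]
  calc _ ≤ Real.sqrt (n + 1) * ‖f‖ * ‖(x : Fock μ) n‖ :=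
        (createSector f n).le_of_opNorm_le (norm_createSector_le f n) _
    _ = ‖f‖ * (Real.sqrt (n + 1) * ‖(x : Fock μ) n‖) := by ring
    _ ≤ ‖f‖ * ((1 + m⁻¹) * (‖(x : Fock μ) n‖ + ‖y n‖)) :=
        mul_le_mul_of_nonneg_left (sqrt_succ_mul_norm_le hm hωm (h n)) (norm_nonneg _)
    _ = _ := by ring

theorem norm_annihilate_le {ω : X → ℝ} {m : ℝ} (hm : 0 < m) (hωm : ∀ᵐ k ∂μ, m ≤ ω k)
    (f : Lp ℂ 2 μ) {y : Fock μ} (x : domSqrtNumber μ)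
    (h : ((x : Fock μ), y) ∈ (dGamma μ ω).graph) :
    ‖(annihilate f x : Fock μ)‖ ≤ 2 * (‖f‖ * (1 + m⁻¹)) * (‖(x : Fock μ)‖ + ‖y‖) := by
  have hm' : 0 < m⁻¹ := inv_pos.2 hm
  rw [mem_graph_dGamma] at h
  refine norm_le_of_forall_le_succ (by positivity) fun n => ?_
  rw [annihilate_apply]
  have h1 : Real.sqrt ((n : ℝ) + 1) ≤ Real.sqrt (((n + 1 : ℕ) : ℝ) + 1) :=
    Real.sqrt_le_sqrt (by push_cast; linarith)
  calc _ ≤ Real.sqrt (n + 1) * ‖f‖ * ‖(x : Fock μ) (n + 1)‖ :=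
        (annihilateSector f n).le_of_opNorm_le (norm_annihilateSector_le f n) _
    _ ≤ Real.sqrt (((n + 1 : ℕ) : ℝ) + 1) * ‖f‖ * ‖(x : Fock μ) (n + 1)‖ := by gcongr
    _ = ‖f‖ * (Real.sqrt (((n + 1 : ℕ) : ℝ) + 1) * ‖(x : Fock μ) (n + 1)‖) := by ring
    _ ≤ ‖f‖ * ((1 + m⁻¹) * (‖(x : Fock μ) (n + 1)‖ + ‖y (n + 1)‖)) :=
        mul_le_mul_of_nonneg_left (sqrt_succ_mul_norm_le hm hωm (h (n + 1))) (norm_nonneg _)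
    _ = _ := by ring

/-! ### Vectors with finitely many particles -/

/-- `x` has no components with more than `p` particles. -/
def AtMost (p : ℕ) (x : Fock μ) : Prop := ∀ n, p < n → x n = 0

variable (μ) in
/-- The finite particle vectors. -/
def finiteVec : Submodule ℂ (Fock μ) where
  carrier := {x | ∃ p, AtMost p x}
  zero_mem' := ⟨0, fun _ _ => rfl⟩
  add_mem' := fun {a b} ⟨p, hp⟩ ⟨q, hq⟩ => ⟨max p q, fun n hn => by
    change a n + b n = 0
    rw [hp n ((le_max_left p q).trans_lt hn), hq n ((le_max_right p q).trans_lt hn), add_zero]⟩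
  smul_mem' := fun c a ⟨p, hp⟩ => ⟨p, fun n hn => by
    change c • a n = 0
    rw [hp n hn, smul_zero]⟩

theorem finiteVec_le_domSqrtNumber : finiteVec μ ≤ domSqrtNumber μ := by
  rintro x ⟨p, hp⟩
  change Summable fun n : ℕ => (n : ℝ) * ‖x n‖ ^ 2
  refine summable_of_ne_finset_zero (s := Finset.range (p + 1)) fun n hn => ?_
  rw [hp n (by simpa using hn)]
  simp

/-- The projection to fewer than `p` particles. -/
def trunc (p : ℕ) (x : Fock μ) : Fock μ := ∑ n ∈ Finset.range p, lp.single 2 n (x n)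

theorem trunc_apply (p : ℕ) (x : Fock μ) (n : ℕ) : trunc p x n = if n < p then x n else 0 := by
  rw [trunc, lp.coeFn_sum, Finset.sum_apply]
  simp only [lp.coeFn_single]
  rw [Finset.sum_pi_single]
  simp

theorem tendsto_trunc (x : Fock μ) : Tendsto (fun p => trunc p x) atTop (𝓝 x) :=
  (lp.hasSum_single (by norm_num) x).tendsto_sum_nat

theorem trunc_mem_finiteVec (p : ℕ) (x : Fock μ) : trunc p x ∈ finiteVec μ :=
  ⟨p, fun n hn => by rw [trunc_apply, if_neg (by omega)]⟩

theorem dense_finiteVec : Dense (finiteVec μ : Set (Fock μ)) := fun x =>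
  mem_closure_of_tendsto (tendsto_trunc x) (Eventually.of_forall fun p => trunc_mem_finiteVec p x)

theorem sectorGraph_zero_zero (ω : X → ℝ) (n : ℕ) : SectorGraph (μ := μ) ω n 0 0 :=
  mem_graph_dGamma.1 ((dGamma μ ω).graph.zero_mem) n

theorem trunc_mem_graph {ω : X → ℝ} {x y : Fock μ} (h : (x, y) ∈ (dGamma μ ω).graph) (p : ℕ) :
    (trunc p x, trunc p y) ∈ (dGamma μ ω).graph := by
  rw [mem_graph_dGamma] at h ⊢
  intro n
  rw [trunc_apply, trunc_apply]
  split_ifs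
  · exact h n
  · exact sectorGraph_zero_zero ω n

/-- The creation operator on finite particle vectors. -/
def createFin (f : Lp ℂ 2 μ) : Module.End ℂ (finiteVec μ) where
  toFun x := ⟨create f ⟨x, finiteVec_le_domSqrtNumber x.2⟩, by
    obtain ⟨p, hp⟩ := x.2
    refine ⟨p + 1, fun n hn => ?_⟩
    cases n with
    | zero => rfl
    | succ n => exact (congrArg (createSector f n) (hp n (by omega))).trans (map_zero _)⟩
  map_add' x y := Subtype.ext ((create f).map_add ⟨x, finiteVec_le_domSqrtNumber x.2⟩
    ⟨y, finiteVec_le_domSqrtNumber y.2⟩)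
  map_smul' c x := Subtype.ext ((create f).map_smul c ⟨x, finiteVec_le_domSqrtNumber x.2⟩)

/-- The annihilation operator on finite particle vectors. -/
def annihilateFin (f : Lp ℂ 2 μ) : Module.End ℂ (finiteVec μ) where
  toFun x := ⟨annihilate f ⟨x, finiteVec_le_domSqrtNumber x.2⟩, by
    obtain ⟨p, hp⟩ := x.2
    refine ⟨p, fun n hn => ?_⟩
    exact (congrArg (annihilateSector f n) (hp (n + 1) (by omega))).trans (map_zero _)⟩
  map_add' x y := Subtype.ext ((annihilate f).map_add ⟨x, finiteVec_le_domSqrtNumber x.2⟩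
    ⟨y, finiteVec_le_domSqrtNumber y.2⟩)
  map_smul' c x := Subtype.ext ((annihilate f).map_smul c ⟨x, finiteVec_le_domSqrtNumber x.2⟩)

theorem createFin_zero (f : Lp ℂ 2 μ) (x : finiteVec μ) : (createFin f x : Fock μ) 0 = 0 := rfl

theorem createFin_succ (f : Lp ℂ 2 μ) (x : finiteVec μ) (n : ℕ) :
    (createFin f x : Fock μ) (n + 1) = createSector f n ((x : Fock μ) n) := rfl

theorem annihilateFin_apply (f : Lp ℂ 2 μ) (x : finiteVec μ) (n : ℕ) :
    (annihilateFin f x : Fock μ) n = annihilateSector f n ((x : Fock μ) (n + 1)) := rfl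

theorem inner_createFin (f : Lp ℂ 2 μ) (x y : finiteVec μ) :
    inner ℂ (createFin f x : Fock μ) (y : Fock μ) =
      inner ℂ (x : Fock μ) (annihilateFin f y : Fock μ) :=
  inner_create f ⟨x, finiteVec_le_domSqrtNumber x.2⟩ ⟨y, finiteVec_le_domSqrtNumber y.2⟩

theorem inner_annihilateFin (f : Lp ℂ 2 μ) (x y : finiteVec μ) :
    inner ℂ (annihilateFin f x : Fock μ) (y : Fock μ) =
      inner ℂ (x : Fock μ) (createFin f y : Fock μ) := by
  rw [← inner_conj_symm, ← inner_createFin, inner_conj_symm]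

theorem annihilateFin_createFin (g f : Lp ℂ 2 μ) (x : finiteVec μ) :
    annihilateFin g (createFin f x) = createFin f (annihilateFin g x) + (inner ℂ g f : ℂ) • x := by
  apply Subtype.ext
  apply lp.ext
  funext n
  cases n with
  | zero =>
    refine (annihilateSector_createSector_zero g f ((x : Fock μ) 0)).trans ?_
    exact (zero_add _).symm
  | succ n => exact annihilateSector_createSector_succ g f n ((x : Fock μ) (n + 1))

/-- Induction on the particle number. Let `C` be the commutator applied to `x`. The scalars in the
canonical commutation relations cancel, so `a(h) C` is the commutator applied to `a(h) x`, which has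
fewer particles and gives zero. As `C` is a difference of vectors in the ranges of `a*(f)` and
`a*(g)`, it follows that `⟨C, C⟩ = 0`. -/
theorem createFin_comm_of_atMost (f g : Lp ℂ 2 μ) (p : ℕ) :
    ∀ x : finiteVec μ, AtMost p (x : Fock μ) →
      createFin f (createFin g x) = createFin g (createFin f x) := by
  have main : ∀ x : finiteVec μ,
      (∀ h, createFin f (createFin g (annihilateFin h x)) =
        createFin g (createFin f (annihilateFin h x))) →
      createFin f (createFin g x) = createFin g (createFin f x) := by
    intro x hx
    obtain ⟨C, hC⟩ : ∃ C, C = createFin f (createFin g x) - createFin g (createFin f x) := ⟨_, rfl⟩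
    have h1 : ∀ h, annihilateFin h C = 0 := by
      intro h
      rw [hC, map_sub, annihilateFin_createFin, annihilateFin_createFin, annihilateFin_createFin,
        annihilateFin_createFin]
      simp only [map_add, map_smul]
      rw [hx h]
      abel
    have h2 : inner ℂ (C : Fock μ) (C : Fock μ) = (0 : ℂ) := by
      nth_rw 1 [hC]
      rw [Submodule.coe_sub, inner_sub_left, inner_createFin f, h1, inner_createFin g _ C, h1]
      simp
    have h3 : (C : Fock μ) = 0 := inner_self_eq_zero.1 h2
    exact sub_eq_zero.1 (hC.symm.trans (Subtype.ext h3))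
  induction p with
  | zero =>
    intro x hx
    refine main x fun h => ?_
    have : annihilateFin h x = 0 := by
      apply Subtype.ext
      apply lp.ext
      funext n
      rw [annihilateFin_apply, hx (n + 1) (by omega), map_zero]
      rfl
    rw [this]
    simp
  | succ p ih =>
    intro x hx
    refine main x fun h => ih _ fun n hn => ?_
    rw [annihilateFin_apply, hx (n + 1) (by omega), map_zero]

theorem createFin_comm (f g : Lp ℂ 2 μ) (x : finiteVec μ) :
    createFin f (createFin g x) = createFin g (createFin f x) := by
  obtain ⟨p, hp⟩ := x.2
  exact createFin_comm_of_atMost f g p x hp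

theorem annihilateFin_comm (f g : Lp ℂ 2 μ) (x : finiteVec μ) :
    annihilateFin f (annihilateFin g x) = annihilateFin g (annihilateFin f x) := by
  apply Subtype.ext
  refine dense_finiteVec.eq_of_inner_left ℂ fun y hy => ?_
  rw [inner_annihilateFin f _ ⟨y, hy⟩, inner_annihilateFin, inner_annihilateFin g _ ⟨y, hy⟩,
    inner_annihilateFin, createFin_comm]

end FockOperators

/-! ### Weyl operators and their commutation relations -/

section Weyl

variable {X : Type*} [MeasurableSpace X] {μ : Measure X} [SigmaFinite μ]

/-- The generator `a*(g) - a(g)` of the Weyl operators on finite particle vectors. -/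
def weylGen (g : Lp ℂ 2 μ) : Module.End ℂ (finiteVec μ) := createFin g - annihilateFin g

/-- The field operator `a*(f) + a(f)` on finite particle vectors. -/
def fieldFin (f : Lp ℂ 2 μ) : Module.End ℂ (finiteVec μ) := createFin f + annihilateFin f

theorem weylGen_skew (g : Lp ℂ 2 μ) (x y : finiteVec μ) :
    inner ℂ (weylGen g x : Fock μ) (y : Fock μ) = -inner ℂ (x : Fock μ) (weylGen g y : Fock μ) := by
  have e : ∀ z, (weylGen g z : Fock μ) = (createFin g z : Fock μ) - (annihilateFin g z : Fock μ) :=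
    fun z => rfl
  rw [e, e, inner_sub_left, inner_sub_right, inner_createFin, inner_annihilateFin]
  ring

/-- The commutator is a scalar, so the commutator expansion of `dΓ(ω)` with the Weyl generator stops
at second order. -/
theorem fieldFin_weylGen (f g : Lp ℂ 2 μ) (x : finiteVec μ) :
    fieldFin f (weylGen g x) = weylGen g (fieldFin f x) + (inner ℂ f g + inner ℂ g f : ℂ) • x := by
  simp only [fieldFin, weylGen, LinearMap.add_apply, LinearMap.sub_apply, map_add, map_sub]
  rw [annihilateFin_createFin f g, annihilateFin_createFin g f, createFin_comm f g,
    annihilateFin_comm f g]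
  module

theorem annihilateFin_weylGen (h g : Lp ℂ 2 μ) (x : finiteVec μ) :
    annihilateFin h (weylGen g x) = weylGen g (annihilateFin h x) + (inner ℂ h g : ℂ) • x := by
  simp only [weylGen, LinearMap.sub_apply, map_sub]
  rw [annihilateFin_createFin h g, annihilateFin_comm h g]
  module

theorem AtMost.weylGen {p : ℕ} {x : finiteVec μ} (h : AtMost p (x : Fock μ)) (g : Lp ℂ 2 μ) :
    AtMost (p + 1) (weylGen g x : Fock μ) := by
  intro n hn
  change (createFin g x : Fock μ) n - (annihilateFin g x : Fock μ) n = 0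
  cases n with
  | zero => omega
  | succ n =>
    rw [createFin_succ, annihilateFin_apply, h n (by omega), h (n + 1 + 1) (by omega), map_zero,
      map_zero, sub_zero]

/-- The constant `4` collects a factor `2` from each of the two sector estimates, used with zero as
their second vector. -/
theorem norm_weylGen_le {p : ℕ} {x : finiteVec μ} (h : AtMost p (x : Fock μ)) (g : Lp ℂ 2 μ) :
    ‖(weylGen g x : Fock μ)‖ ≤ 4 * ‖g‖ * Real.sqrt (p + 1) * ‖(x : Fock μ)‖ := by
  have hsq : ∀ n : ℕ, Real.sqrt (n + 1) * ‖g‖ * ‖(x : Fock μ) n‖ ≤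
      Real.sqrt (p + 1) * ‖g‖ * (‖(x : Fock μ) n‖ + ‖(0 : Fock μ) n‖) := by
    intro n
    rcases le_or_gt n p with hn | hn
    · have h1 : Real.sqrt ((n : ℝ) + 1) ≤ Real.sqrt ((p : ℝ) + 1) := by
        apply Real.sqrt_le_sqrt
        gcongr
      have h2 : ‖(0 : Fock μ) n‖ = 0 := norm_zero
      rw [h2, add_zero]
      gcongr
    · rw [h n hn, norm_zero, mul_zero]
      positivity
  have h1 : ‖(createFin g x : Fock μ)‖ ≤
      2 * (Real.sqrt (p + 1) * ‖g‖) * (‖(x : Fock μ)‖ + ‖(0 : Fock μ)‖) := by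
    refine norm_le_of_forall_succ_le (by positivity) (createFin_zero g x) fun n => ?_
    rw [createFin_succ]
    exact ((createSector g n).le_of_opNorm_le (norm_createSector_le g n) _).trans (hsq n)
  have h2 : ‖(annihilateFin g x : Fock μ)‖ ≤
      2 * (Real.sqrt (p + 1) * ‖g‖) * (‖(x : Fock μ)‖ + ‖(0 : Fock μ)‖) := by
    refine norm_le_of_forall_le_succ (by positivity) fun n => ?_
    rw [annihilateFin_apply]
    refine ((annihilateSector g n).le_of_opNorm_le (norm_annihilateSector_le g n) _).trans
      (le_trans ?_ (hsq (n + 1)))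
    gcongr
    simp
  rw [norm_zero, add_zero] at h1 h2
  calc ‖(weylGen g x : Fock μ)‖ = ‖(createFin g x : Fock μ) - (annihilateFin g x : Fock μ)‖ := rfl
    _ ≤ _ := norm_sub_le _ _
    _ ≤ _ := add_le_add h1 h2
    _ = _ := by ring

/-- Each application adds at most one particle, so `n` of them cost a constant to the power `n`
times `√(n!)`, which the `n!` of the exponential series dominates. -/
theorem norm_weylGen_pow_le {p : ℕ} {x : finiteVec μ} (h : AtMost p (x : Fock μ)) (g : Lp ℂ 2 μ)
    (n : ℕ) : AtMost (p + n) ((weylGen g ^ n) x : Fock μ) ∧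
      ‖((weylGen g ^ n) x : Fock μ)‖ ≤
        (4 * ‖g‖ * Real.sqrt (p + 1)) ^ n * Real.sqrt n.factorial * ‖(x : Fock μ)‖ := by
  induction n with
  | zero => exact ⟨h, by simp⟩
  | succ n ih =>
    obtain ⟨ih1, ih2⟩ := ih
    rw [pow_succ', Module.End.mul_apply]
    refine ⟨ih1.weylGen g, (norm_weylGen_le ih1 g).trans ?_⟩
    -- This is `p + n + 1 ≤ (p + 1)(n + 1)`.
    have h1 : Real.sqrt (((p + n : ℕ) : ℝ) + 1) ≤ Real.sqrt (p + 1) * Real.sqrt (n + 1) := by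
      rw [← Real.sqrt_mul (by positivity)]
      apply Real.sqrt_le_sqrt
      push_cast
      nlinarith [mul_nonneg (Nat.cast_nonneg p : (0 : ℝ) ≤ p) (Nat.cast_nonneg n : (0 : ℝ) ≤ n)]
    have h2 : Real.sqrt (n + 1).factorial = Real.sqrt (n + 1) * Real.sqrt n.factorial := by
      rw [← Real.sqrt_mul (by positivity), Nat.factorial_succ]
      push_cast
      rfl
    calc _ ≤ 4 * ‖g‖ * (Real.sqrt (p + 1) * Real.sqrt (n + 1)) *
          ((4 * ‖g‖ * Real.sqrt (p + 1)) ^ n * Real.sqrt n.factorial * ‖(x : Fock μ)‖) := by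
          gcongr
      _ = _ := by rw [h2]; ring

theorem summable_pow_mul_sqrt_factorial (C : ℝ) :
    Summable fun n : ℕ => C ^ n * Real.sqrt n.factorial / n.factorial := by
  refine Summable.of_norm_bounded
    ((Real.summable_pow_div_factorial (2 * C ^ 2)).add
      (summable_geometric_of_lt_one (r := 1 / 2) (by norm_num) (by norm_num))) fun n => ?_
  have hf : (0 : ℝ) < n.factorial := by exact_mod_cast n.factorial_pos
  set a : ℝ := (2 * C ^ 2) ^ n / n.factorial with ha
  set b : ℝ := (1 / 2) ^ n with hb
  have ha0 : 0 ≤ a := by positivity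
  have hb0 : 0 ≤ b := by positivity
  -- The term is the geometric mean of an exponential term and a geometric one, hence at most their
  -- sum.
  have h : (C ^ n * Real.sqrt n.factorial / n.factorial) ^ 2 = a * b := by
    have e : (2 * C ^ 2) ^ n * (1 / 2) ^ n = (C ^ n) ^ 2 := by
      rw [← mul_pow, ← pow_mul, mul_comm n 2, pow_mul]
      congr 1
      ring
    rw [div_pow, mul_pow, Real.sq_sqrt hf.le, ha, hb, div_mul_eq_mul_div, e]
    field_simp
  rw [Real.norm_eq_abs]
  refine abs_le_of_sq_le_sq ?_ (by positivity)
  rw [h]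
  nlinarith [mul_nonneg ha0 hb0]

theorem summable_expTerm_weylGen (g : Lp ℂ 2 μ) (x : finiteVec μ) :
    Summable fun n => ‖expTerm (weylGen g) x n‖ := by
  obtain ⟨p, hp⟩ := x.2
  refine Summable.of_nonneg_of_le (fun n => norm_nonneg _) (fun n => ?_)
    ((summable_pow_mul_sqrt_factorial (4 * ‖g‖ * Real.sqrt (p + 1))).mul_right ‖(x : Fock μ)‖)
  rw [norm_expTerm, div_mul_eq_mul_div]
  gcongr
  exact (norm_weylGen_pow_le hp g n).2

theorem exists_weyl (g : Lp ℂ 2 μ) : ∃ W : Fock μ ≃ₗᵢ[ℂ] Fock μ,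
    (∀ x : finiteVec μ, HasSum (expTerm (weylGen g) x) (W x)) ∧
      ∀ x : finiteVec μ, HasSum (expTerm (-weylGen g) x) (W.symm x) :=
  exists_unitary_exp dense_finiteVec (weylGen_skew g) (summable_expTerm_weylGen g)

/-- The Weyl operator `e^{a*(g) - a(g)}`. -/
def weyl (g : Lp ℂ 2 μ) : Fock μ ≃ₗᵢ[ℂ] Fock μ := (exists_weyl g).choose

theorem hasSum_weyl (g : Lp ℂ 2 μ) (x : finiteVec μ) :
    HasSum (expTerm (weylGen g) x) (weyl g x) := (exists_weyl g).choose_spec.1 x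

theorem hasSum_weyl_symm (g : Lp ℂ 2 μ) (x : finiteVec μ) :
    HasSum (expTerm (-weylGen g) x) ((weyl g).symm x) := (exists_weyl g).choose_spec.2 x

/-! ### Conjugation of `dΓ(ω)` with Weyl operators -/

theorem createFin_mem_graph {ω : X → ℝ} {f g : Lp ℂ 2 μ}
    (hfg : f =ᵐ[μ] fun k => (ω k : ℂ) * g k) {x u : finiteVec μ}
    (h : ((x : Fock μ), (u : Fock μ)) ∈ (dGamma μ ω).graph) :
    ((createFin g x : Fock μ), (createFin g u + createFin f x : Fock μ)) ∈
      (dGamma μ ω).graph := by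
  rw [mem_graph_dGamma] at h ⊢
  intro n
  cases n with
  | zero =>
    have e : (createFin g u + createFin f x : Fock μ) 0 = 0 := add_zero (0 : symSpace μ 0)
    rw [e]
    exact sectorGraph_zero ω _
  | succ n => exact (h n).createSector hfg

theorem annihilateFin_mem_graph {ω : X → ℝ} (hω : Measurable ω) (hω0 : ∀ᵐ k ∂μ, 0 ≤ ω k)
    {f g : Lp ℂ 2 μ} (hfg : f =ᵐ[μ] fun k => (ω k : ℂ) * g k) {x u : finiteVec μ}
    (h : ((x : Fock μ), (u : Fock μ)) ∈ (dGamma μ ω).graph) :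
    ((annihilateFin g x : Fock μ), (annihilateFin g u - annihilateFin f x : Fock μ)) ∈
      (dGamma μ ω).graph := by
  rw [mem_graph_dGamma] at h ⊢
  exact fun n => (h (n + 1)).annihilateSector hω hω0 hfg

theorem weylGen_mem_graph {ω : X → ℝ} (hω : Measurable ω) (hω0 : ∀ᵐ k ∂μ, 0 ≤ ω k)
    {f g : Lp ℂ 2 μ} (hfg : f =ᵐ[μ] fun k => (ω k : ℂ) * g k) {x u : finiteVec μ}
    (h : ((x : Fock μ), (u : Fock μ)) ∈ (dGamma μ ω).graph) :
    ((weylGen g x : Fock μ), ((weylGen g u + fieldFin f x : finiteVec μ) : Fock μ)) ∈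
      (dGamma μ ω).graph := by
  have h1 := (dGamma μ ω).graph.sub_mem (createFin_mem_graph hfg h)
    (annihilateFin_mem_graph hω hω0 hfg h)
  convert h1 using 1
  refine Prod.ext rfl ?_
  change ((createFin g u : Fock μ) - annihilateFin g u) + (createFin f x + annihilateFin f x) =
    (createFin g u + createFin f x) - (annihilateFin g u - annihilateFin f x)
  abel

/-- The field operator `a*(f) + a(f)`. -/
def field (f : Lp ℂ 2 μ) (x : domSqrtNumber μ) : Fock μ := create f x + annihilate f x

theorem norm_field_le {ω : X → ℝ} {m : ℝ} (hm : 0 < m) (hωm : ∀ᵐ k ∂μ, m ≤ ω k)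
    (f : Lp ℂ 2 μ) {y : Fock μ} (x : domSqrtNumber μ)
    (h : ((x : Fock μ), y) ∈ (dGamma μ ω).graph) :
    ‖field f x‖ ≤ 4 * (‖f‖ * (1 + m⁻¹)) * (‖(x : Fock μ)‖ + ‖y‖) := by
  refine (norm_add_le _ _).trans
    ((add_le_add (norm_create_le hm hωm f x h) (norm_annihilate_le hm hωm f x h)).trans ?_)
  exact le_of_eq (by ring)

/-- Truncation commutes with `dΓ(ω)`, so truncations converge in graph norm, and every additive map
bounded in that norm follows. -/
theorem tendsto_of_bound {ω : X → ℝ} {Q : domSqrtNumber μ → Fock μ} {C : ℝ}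
    (hQ : ∀ a b, Q a - Q b = Q (a - b))
    (hC : ∀ (x : domSqrtNumber μ) (y : Fock μ), ((x : Fock μ), y) ∈ (dGamma μ ω).graph →
      ‖Q x‖ ≤ C * (‖(x : Fock μ)‖ + ‖y‖))
    {x y : Fock μ} (hx : x ∈ domSqrtNumber μ) (h : (x, y) ∈ (dGamma μ ω).graph) :
    Tendsto (fun p => Q ⟨trunc p x, finiteVec_le_domSqrtNumber (trunc_mem_finiteVec p x)⟩) atTop
      (𝓝 (Q ⟨x, hx⟩)) := by
  rw [tendsto_iff_norm_sub_tendsto_zero]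
  have h0 : Tendsto (fun p => C * (‖trunc p x - x‖ + ‖trunc p y - y‖)) atTop (𝓝 0) := by
    have h1 := (tendsto_iff_norm_sub_tendsto_zero.1 (tendsto_trunc x)).add
      (tendsto_iff_norm_sub_tendsto_zero.1 (tendsto_trunc y))
    simpa using h1.const_mul C
  refine squeeze_zero (fun _ => norm_nonneg _) (fun p => ?_) h0
  rw [hQ]
  exact hC _ _ ((dGamma μ ω).graph.sub_mem (trunc_mem_graph h p) h)

theorem field_sub (f : Lp ℂ 2 μ) (a b : domSqrtNumber μ) :
    field f a - field f b = field f (a - b) := by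
  have h1 : create f (a - b) = create f a - create f b := (create f).map_sub a b
  have h2 : annihilate f (a - b) = annihilate f a - annihilate f b := (annihilate f).map_sub a b
  rw [field, field, field, h1, h2]
  abel

variable {ω : X → ℝ} {m : ℝ}

/-- Intertwining relations between `dΓ(ω)` and a unitary operator extend from finite particle
vectors to the domain of `dΓ(ω)`. -/
theorem graph_extend (hω : Measurable ω) (hm : 0 < m) (hωm : ∀ᵐ k ∂μ, m ≤ ω k) (f : Lp ℂ 2 μ)
    (W : Fock μ ≃ₗᵢ[ℂ] Fock μ) (s d : ℂ)
    (hW : ∀ x u : finiteVec μ, ((x : Fock μ), (u : Fock μ)) ∈ (dGamma μ ω).graph →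
      (W x, W ((u : Fock μ) + s • (fieldFin f x : Fock μ) + d • (x : Fock μ))) ∈
        (dGamma μ ω).graph)
    {x y : Fock μ} (hx : x ∈ domSqrtNumber μ) (h : (x, y) ∈ (dGamma μ ω).graph) :
    (W x, W (y + s • field f ⟨x, hx⟩ + d • x)) ∈ (dGamma μ ω).graph := by
  have hω0 : ∀ᵐ k ∂μ, 0 ≤ ω k := hωm.mono fun k hk => hm.le.trans hk
  have hcl : IsClosed ((dGamma μ ω).graph : Set (Fock μ × Fock μ)) :=
    (isSelfAdjoint_dGamma hω hω0).isClosed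
  have hfield := tendsto_of_bound (field_sub f)
    (fun x y h => norm_field_le hm hωm f x h) hx h
  have hlim := (W.continuous.tendsto _).comp (tendsto_trunc x) |>.prodMk_nhds
    ((W.continuous.tendsto _).comp
      (((tendsto_trunc y).add (hfield.const_smul s)).add ((tendsto_trunc x).const_smul d)))
  refine hcl.mem_of_tendsto hlim (Eventually.of_forall fun p => ?_)
  exact hW ⟨_, trunc_mem_finiteVec p x⟩ ⟨_, trunc_mem_finiteVec p y⟩ (trunc_mem_graph h p)

/-- The commutator expansion with `L = dΓ(ω)`, `A = a*(g) - a(g)` and `Φ = a*(f) + a(f)`. It is only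
known weakly against the graph of `dΓ(ω)`, and self-adjointness upgrades this to membership in the
graph. -/
theorem weyl_mem_graph_fin (hω : Measurable ω) (hω0 : ∀ᵐ k ∂μ, 0 ≤ ω k) {f g : Lp ℂ 2 μ}
    (hfg : f =ᵐ[μ] fun k => (ω k : ℂ) * g k) {x u : finiteVec μ}
    (h : ((x : Fock μ), (u : Fock μ)) ∈ (dGamma μ ω).graph) :
    (weyl g x, weyl g ((u : Fock μ) + (fieldFin f x : Fock μ) +
      ((inner ℂ f g + inner ℂ g f) / 2 : ℂ) • (x : Fock μ))) ∈ (dGamma μ ω).graph := by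
  rw [mem_graph_iff_of_isSelfAdjoint (isSelfAdjoint_dGamma hω hω0)]
  intro a b hab
  exact inner_exp_commutator (fieldFin_weylGen f g)
    (G := fun x u => ((x : Fock μ), (u : Fock μ)) ∈ (dGamma μ ω).graph)
    (fun x u h => weylGen_mem_graph hω hω0 hfg h) (hasSum_weyl g) h
    (fun x u h => inner_eq_of_mem_graph_dGamma hab h)

theorem weyl_symm_mem_graph_fin (hω : Measurable ω) (hω0 : ∀ᵐ k ∂μ, 0 ≤ ω k) {f g : Lp ℂ 2 μ}
    (hfg : f =ᵐ[μ] fun k => (ω k : ℂ) * g k) {x u : finiteVec μ}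
    (h : ((x : Fock μ), (u : Fock μ)) ∈ (dGamma μ ω).graph) :
    ((weyl g).symm x, (weyl g).symm ((u : Fock μ) + ((-fieldFin f) x : finiteVec μ) +
      ((inner ℂ f g + inner ℂ g f) / 2 : ℂ) • (x : Fock μ))) ∈ (dGamma μ ω).graph := by
  rw [mem_graph_iff_of_isSelfAdjoint (isSelfAdjoint_dGamma hω hω0)]
  intro a b hab
  refine inner_exp_commutator (A := -weylGen g) (Φ := -fieldFin f) (fun x => ?_)
    (G := fun x u => ((x : Fock μ), (u : Fock μ)) ∈ (dGamma μ ω).graph)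
    (fun x u h => ?_) (hasSum_weyl_symm g) h
    (fun x u h => inner_eq_of_mem_graph_dGamma hab h)
  · simp only [LinearMap.neg_apply, map_neg, neg_neg]
    exact fieldFin_weylGen f g x
  · have := (dGamma μ ω).graph.neg_mem (weylGen_mem_graph hω hω0 hfg h)
    convert this using 1
    refine Prod.ext rfl ?_
    change ((-(weylGen g u) + -(fieldFin f x) : finiteVec μ) : Fock μ) =
      ((-(weylGen g u + fieldFin f x) : finiteVec μ) : Fock μ)
    rw [neg_add]

/-- `dΓ(ω) W = W (dΓ(ω) + a*(f) + a(f) + ⟨f, g⟩)` for the Weyl operator `W` of `g = f / ω`. -/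
theorem weyl_mem_graph (hω : Measurable ω) (hm : 0 < m) (hωm : ∀ᵐ k ∂μ, m ≤ ω k) {f g : Lp ℂ 2 μ}
    (hfg : f =ᵐ[μ] fun k => (ω k : ℂ) * g k) {x y : Fock μ} (hx : x ∈ domSqrtNumber μ)
    (h : (x, y) ∈ (dGamma μ ω).graph) :
    (weyl g x, weyl g (y + field f ⟨x, hx⟩ + ((inner ℂ f g + inner ℂ g f) / 2 : ℂ) • x)) ∈
      (dGamma μ ω).graph := by
  have hω0 : ∀ᵐ k ∂μ, 0 ≤ ω k := hωm.mono fun k hk => hm.le.trans hk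
  have := graph_extend hω hm hωm f (weyl g) 1 ((inner ℂ f g + inner ℂ g f) / 2 : ℂ)
    (fun x u h => by simpa only [one_smul] using weyl_mem_graph_fin hω hω0 hfg h) hx h
  simpa only [one_smul] using this

/-- Only invariance of the domain is recorded; the value can later be recovered from
`weyl_mem_graph` and single-valuedness. -/
theorem weyl_symm_mem_graph (hω : Measurable ω) (hm : 0 < m) (hωm : ∀ᵐ k ∂μ, m ≤ ω k)
    {f g : Lp ℂ 2 μ} (hfg : f =ᵐ[μ] fun k => (ω k : ℂ) * g k) {x y : Fock μ}
    (h : (x, y) ∈ (dGamma μ ω).graph) :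
    ∃ y', ((weyl g).symm x, y') ∈ (dGamma μ ω).graph := by
  have hω0 : ∀ᵐ k ∂μ, 0 ≤ ω k := hωm.mono fun k hk => hm.le.trans hk
  refine ⟨_, graph_extend hω hm hωm f (weyl g).symm (-1) ((inner ℂ f g + inner ℂ g f) / 2 : ℂ)
    (fun x u h => ?_) (mem_domSqrtNumber_of_graph hm hωm h) h⟩
  convert weyl_symm_mem_graph_fin hω hω0 hfg h using 5
  exact neg_one_smul ℂ (fieldFin f x : Fock μ)

/-- `a(h) W = W (a(h) + ⟨h, g⟩)` for the Weyl operator `W` of `g`. -/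
theorem annihilate_weyl (hm : 0 < m) (hωm : ∀ᵐ k ∂μ, m ≤ ω k) (h g : Lp ℂ 2 μ) {x y : Fock μ}
    (hx : x ∈ domSqrtNumber μ) (hxy : (x, y) ∈ (dGamma μ ω).graph)
    (hWx : weyl g x ∈ domSqrtNumber μ) :
    (annihilate h ⟨weyl g x, hWx⟩ : Fock μ) =
      weyl g (annihilate h ⟨x, hx⟩ + (inner ℂ h g : ℂ) • x) := by
  have hfin : ∀ φ x : finiteVec μ, inner ℂ (createFin h φ : Fock μ) (weyl g x) =
      inner ℂ (φ : Fock μ) (weyl g ((annihilateFin h x : Fock μ) + (inner ℂ h g : ℂ) • (x : Fock μ))) := by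
    intro φ x
    -- Now `L = a(h)`, whose commutator with the generator is the scalar `⟨h, g⟩`, so the second
    -- commutator `c` is zero.
    have := inner_exp_commutator (A := weylGen g) (Φ := (inner ℂ h g : ℂ) • 1) (c := 0)
      (fun x => by simp) (G := fun x u => u = annihilateFin h x)
      (fun x u hu => by subst hu; rw [annihilateFin_weylGen]; rfl) (hasSum_weyl g)
      (x := x) rfl (ξ := φ) (ξ' := createFin h φ)
      (fun x u hu => by subst hu; exact inner_createFin h φ x)
    rw [this, zero_div, zero_smul, add_zero]
    rfl
  have hlim1 : Tendsto (fun p => weyl g (trunc p x)) atTop (𝓝 (weyl g x)) :=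
    ((weyl g).continuous.tendsto _).comp (tendsto_trunc x)
  have hann := tendsto_of_bound (Q := fun x => annihilate h x)
    (fun a b => ((annihilate h).map_sub a b).symm)
    (fun x y hxy => norm_annihilate_le hm hωm h x hxy) hx hxy
  have hlim2 := ((weyl g).continuous.tendsto _).comp
    (hann.add ((tendsto_trunc x).const_smul (inner ℂ h g : ℂ)))
  refine dense_finiteVec.eq_of_inner_right ℂ fun φ hφ => ?_
  refine (inner_create h ⟨φ, finiteVec_le_domSqrtNumber hφ⟩ ⟨weyl g x, hWx⟩).symm.trans ?_
  have l1 := (tendsto_const_nhds (x := (createFin h ⟨φ, hφ⟩ : Fock μ))).inner (𝕜 := ℂ) hlim1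
  have l2 := (tendsto_const_nhds (x := φ)).inner (𝕜 := ℂ) hlim2
  refine tendsto_nhds_unique l1 (l2.congr fun p => ?_)
  exact (hfin ⟨φ, hφ⟩ ⟨_, trunc_mem_finiteVec p x⟩).symm

end Weyl

/-! ### Asymptotic orthogonality of Weyl operators -/

section WeylDecay

variable {X : Type*} [MeasurableSpace X] {μ : Measure X} {ω : X → ℝ} {m : ℝ}

theorem smul_ae_eq_mul_smul {f g : Lp ℂ 2 μ} (hfg : f =ᵐ[μ] fun k => (ω k : ℂ) * g k) (c : ℂ) :
    (c • f : Lp ℂ 2 μ) =ᵐ[μ] fun k => (ω k : ℂ) * (c • g : Lp ℂ 2 μ) k := by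
  filter_upwards [hfg, Lp.coeFn_smul c f, Lp.coeFn_smul c g] with k h1 h2 h3
  rw [h2, h3, Pi.smul_apply, Pi.smul_apply, h1, smul_eq_mul, smul_eq_mul]
  ring

variable [SigmaFinite μ]

/-- With `x = W(γg)* ψ`, the displacement relation is used for `W(γg) x = ψ` and for `W(βg) x`;
eliminating `a(g) x` leaves the difference of the two shifts. -/
theorem annihilate_weyl_weyl_symm (hω : Measurable ω) (hm : 0 < m) (hωm : ∀ᵐ k ∂μ, m ≤ ω k)
    {f g : Lp ℂ 2 μ} (hfg : f =ᵐ[μ] fun k => (ω k : ℂ) * g k) (β γ : ℂ) {ψ ψ' : Fock μ}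
    (hψ : (ψ, ψ') ∈ (dGamma μ ω).graph) (hψd : ψ ∈ domSqrtNumber μ) :
    ∃ h : weyl (β • g) ((weyl (γ • g)).symm ψ) ∈ domSqrtNumber μ,
      (annihilate g ⟨_, h⟩ : Fock μ) =
        weyl (β • g) ((weyl (γ • g)).symm (annihilate g ⟨ψ, hψd⟩)) +
          ((β - γ) * ((‖g‖ ^ 2 : ℝ) : ℂ)) • weyl (β • g) ((weyl (γ • g)).symm ψ) := by
  have dom : ∀ {x y : Fock μ}, (x, y) ∈ (dGamma μ ω).graph → x ∈ domSqrtNumber μ :=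
    fun h => mem_domSqrtNumber_of_graph hm hωm h
  obtain ⟨x, hx⟩ : ∃ x, x = (weyl (γ • g)).symm ψ := ⟨_, rfl⟩
  have hγx : weyl (γ • g) x = ψ := by rw [hx, LinearIsometryEquiv.apply_symm_apply]
  obtain ⟨x', hxx⟩ := weyl_symm_mem_graph hω hm hωm (smul_ae_eq_mul_smul hfg γ) hψ
  rw [← hx] at hxx ⊢
  have hβx := weyl_mem_graph hω hm hωm (smul_ae_eq_mul_smul hfg β) (dom hxx) hxx
  refine ⟨dom hβx, ?_⟩
  have e1 := annihilate_weyl hm hωm g (γ • g) (dom hxx) hxx (by rw [hγx]; exact hψd)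
  have e2 := annihilate_weyl hm hωm g (β • g) (dom hxx) hxx (dom hβx)
  have e1' : (annihilate g ⟨ψ, hψd⟩ : Fock μ) =
      weyl (γ • g) (annihilate g ⟨x, dom hxx⟩ + (inner ℂ g (γ • g) : ℂ) • x) := by
    rw [← e1]
    congr 1
    exact Subtype.ext hγx.symm
  have e3 : (annihilate g ⟨x, dom hxx⟩ : Fock μ) =
      (weyl (γ • g)).symm (annihilate g ⟨ψ, hψd⟩) - (inner ℂ g (γ • g) : ℂ) • x := by
    rw [e1', LinearIsometryEquiv.symm_apply_apply, add_sub_cancel_right]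
  have hgg : (inner ℂ g g : ℂ) = ((‖g‖ ^ 2 : ℝ) : ℂ) := by
    rw [inner_self_eq_norm_sq_to_K]
    push_cast
    rfl
  rw [e2, e3, ← map_smul, ← map_add, inner_smul_right, inner_smul_right, hgg]
  congr 1
  module

/-- With `a = ‖g‖` and `r = |β - γ|`, the identity bounds `r a²` times the inner product by `4 M a p
q`. Cancelling one `a` and adding the trivial bound `p q` gives a denominator `1 + r a` that is
never zero. -/
theorem norm_le_of_commutator_identity {F : Type*} [NormedAddCommGroup F] [InnerProductSpace ℂ F]
    {U : F ≃ₗᵢ[ℂ] F} {a r M p q : ℝ} {d : ℂ} {φ ψ φc ψa : F} (ha : 0 ≤ a) (hr : 0 ≤ r) (hM : 0 ≤ M)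
    (hd : ‖d‖ = r * a ^ 2) (h : d * inner ℂ φ (U ψ) = inner ℂ φc (U ψ) - inner ℂ φ (U ψa))
    (hp : ‖φ‖ ≤ p) (hq : ‖ψ‖ ≤ q) (hφ : ‖φc‖ ≤ 2 * (a * M) * p) (hψ : ‖ψa‖ ≤ 2 * (a * M) * q) :
    ‖inner ℂ φ (U ψ)‖ ≤ (4 * M + 1) / (1 + r * a) * (p * q) := by
  have hp0 : 0 ≤ p := (norm_nonneg _).trans hp
  have hq0 : 0 ≤ q := (norm_nonneg _).trans hq
  have hI0 : ‖inner ℂ φ (U ψ)‖ ≤ p * q := by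
    refine (norm_inner_le_norm _ _).trans ?_
    rw [LinearIsometryEquiv.norm_map]
    gcongr
  have hmain : r * a ^ 2 * ‖inner ℂ φ (U ψ)‖ ≤ 4 * M * (p * q) * a := by
    rw [← hd, ← norm_mul, h]
    refine (norm_sub_le _ _).trans ((add_le_add (norm_inner_le_norm _ _)
      (norm_inner_le_norm _ _)).trans ?_)
    rw [LinearIsometryEquiv.norm_map, LinearIsometryEquiv.norm_map]
    have c1 : ‖φc‖ * ‖ψ‖ ≤ (2 * (a * M) * p) * q := by gcongr
    have c2 : ‖φ‖ * ‖ψa‖ ≤ p * (2 * (a * M) * q) := by gcongr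
    linarith
  have hmain' : r * a * ‖inner ℂ φ (U ψ)‖ ≤ 4 * M * (p * q) := by
    rcases ha.eq_or_lt with h0 | h0
    · rw [← h0]
      have : 0 ≤ 4 * M * (p * q) := by positivity
      simpa using this
    · refine le_of_mul_le_mul_right ?_ h0
      calc _ = r * a ^ 2 * ‖inner ℂ φ (U ψ)‖ := by ring
        _ ≤ _ := hmain
  have hpos : 0 < 1 + r * a := by positivity
  rw [div_mul_eq_mul_div, le_div_iff₀ hpos]
  linarith

/-- Weyl operators of distant arguments are almost orthogonal on vectors in the domain of
`dΓ(ω)`. -/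
theorem norm_inner_weyl_weyl_symm_le (hω : Measurable ω) (hm : 0 < m) (hωm : ∀ᵐ k ∂μ, m ≤ ω k)
    {f g : Lp ℂ 2 μ} (hfg : f =ᵐ[μ] fun k => (ω k : ℂ) * g k) (β γ : ℂ)
    {φ φ' ψ ψ' : Fock μ} (hφ : (φ, φ') ∈ (dGamma μ ω).graph)
    (hψ : (ψ, ψ') ∈ (dGamma μ ω).graph) :
    ‖inner ℂ φ (weyl (β • g) ((weyl (γ • g)).symm ψ))‖ ≤
      (4 * (1 + m⁻¹) + 1) / (1 + ‖β - γ‖ * ‖g‖) * ((‖φ‖ + ‖φ'‖) * (‖ψ‖ + ‖ψ'‖)) := by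
  have hφd := mem_domSqrtNumber_of_graph hm hωm hφ
  have hψd := mem_domSqrtNumber_of_graph hm hωm hψ
  obtain ⟨hd, e⟩ := annihilate_weyl_weyl_symm hω hm hωm hfg β γ hψ hψd
  have hm' : 0 < m⁻¹ := inv_pos.2 hm
  refine norm_le_of_commutator_identity (U := (weyl (γ • g)).symm.trans (weyl (β • g)))
    (d := (β - γ) * ((‖g‖ ^ 2 : ℝ) : ℂ)) (φc := create g ⟨φ, hφd⟩) (ψa := annihilate g ⟨ψ, hψd⟩)
    (norm_nonneg _) (norm_nonneg _) (by positivity) ?_ ?_ (by simp) (by simp)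
    (norm_create_le hm hωm g ⟨φ, hφd⟩ hφ) (norm_annihilate_le hm hωm g ⟨ψ, hψd⟩ hψ)
  · rw [norm_mul, Complex.norm_real, Real.norm_of_nonneg (by positivity)]
  · have h1 := (inner_create g ⟨φ, hφd⟩ ⟨_, hd⟩).trans (congrArg (inner ℂ φ) e)
    rw [inner_add_right, inner_smul_right] at h1
    exact eq_sub_of_add_eq' h1.symm

end WeylDecay

/-! ### An eigenbasis of `B` adapted to `K` -/

section Eigenbasis

variable {E : Type*} [NormedAddCommGroup E] [InnerProductSpace ℂ E]

theorem inner_eq_zero_of_eigenvalues_ne {B : E →ₗ[ℂ] E}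
    (hB : ∀ x y, inner ℂ (B x) (B y) = inner ℂ x y) {β γ : ℂ} (hβγ : β ≠ γ) {x y : E}
    (hx : B x = β • x) (hy : B y = γ • y) : inner ℂ x y = 0 := by
  by_cases hx0 : x = 0
  · rw [hx0, inner_zero_left]
  have h1 : (starRingEnd ℂ β) * β = 1 := by
    have h := hB x x
    rw [hx, inner_smul_left, inner_smul_right, ← mul_assoc] at h
    exact mul_right_cancel₀ (inner_self_ne_zero.2 hx0) (h.trans (one_mul _).symm)
  have h := hB x y
  rw [hx, hy, inner_smul_left, inner_smul_right] at h
  have h2 : (starRingEnd ℂ β) * (γ - β) * inner ℂ x y = 0 := by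
    linear_combination h - inner ℂ x y * h1
  rcases mul_eq_zero.1 h2 with h3 | h3
  · rcases mul_eq_zero.1 h3 with h4 | h4
    · rw [h4, zero_mul] at h1
      exact absurd h1 zero_ne_one
    · exact absurd (sub_eq_zero.1 h4).symm hβγ
  · exact h3

variable [FiniteDimensional ℂ E]

/-- The orthogonal complement of the eigenspaces is invariant under the isometry `B`; were it
nonzero, it would contain an eigenvector, orthogonal to itself. -/
theorem orthogonal_iSup_eigenspace_eq_bot {B : E →ₗ[ℂ] E}
    (hB : ∀ x y, inner ℂ (B x) (B y) = inner ℂ x y) :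
    (⨆ β : ℂ, Module.End.eigenspace B β)ᗮ = ⊥ := by
  set S := ⨆ β : ℂ, Module.End.eigenspace B β with hS
  have hinv : ∀ y ∈ Sᗮ, B y ∈ Sᗮ := by
    intro y hy
    have h1 : ∀ β : ℂ, Module.End.eigenspace B β ≤ (ℂ ∙ B y)ᗮ := by
      intro β x hx
      rw [Submodule.mem_orthogonal_singleton_iff_inner_left]
      rw [Module.End.mem_eigenspace_iff] at hx
      have hxS : x ∈ S := Submodule.mem_iSup_of_mem β (Module.End.mem_eigenspace_iff.2 hx)
      have h2 : inner ℂ x y = 0 := hy x hxS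
      by_cases hβ : β = 0
      · have h3 := hB x x
        rw [hx, hβ, zero_smul, inner_zero_left] at h3
        rw [inner_self_eq_zero.1 h3.symm, inner_zero_left]
      · have h3 := hB x y
        rw [hx, inner_smul_left, h2] at h3
        exact (mul_eq_zero.1 h3).resolve_left (by simpa using hβ)
    intro x hx
    have := (iSup_le h1 : S ≤ (ℂ ∙ B y)ᗮ) hx
    rwa [Submodule.mem_orthogonal_singleton_iff_inner_left] at this
  by_contra hne
  have : Nontrivial Sᗮ := Submodule.nontrivial_iff_ne_bot.2 hne
  obtain ⟨c, hc⟩ := Module.End.exists_eigenvalue (B.restrict hinv)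
  obtain ⟨v, hv⟩ := hc.exists_hasEigenvector
  have hv1 : B v = c • (v : E) := congrArg Subtype.val hv.apply_eq_smul
  have hvS : (v : E) ∈ S := Submodule.mem_iSup_of_mem c (Module.End.mem_eigenspace_iff.2 hv1)
  have h0 : inner ℂ (v : E) (v : E) = 0 := v.2 _ hvS
  exact hv.2 (Subtype.ext (inner_self_eq_zero.1 h0))

/-- A unitary `B` has an orthonormal eigenbasis such that a given symmetric `K` has no off-diagonal
matrix elements between eigenvectors of `B` with the same eigenvalue. -/
theorem exists_adapted_eigenbasis {B K : E →ₗ[ℂ] E}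
    (hB : ∀ x y, inner ℂ (B x) (B y) = inner ℂ x y) (hK : K.IsSymmetric) {n : ℕ}
    (hn : Module.finrank ℂ E = n) :
    ∃ (u : OrthonormalBasis (Fin n) ℂ E) (β : Fin n → ℂ), (∀ j, B (u j) = β j • u j) ∧
      ∀ j k, j ≠ k → β j = β k → inner ℂ (u j) (K (u k)) = 0 := by
  classical
  have hV : OrthogonalFamily ℂ (fun β : Module.End.Eigenvalues B => Module.End.eigenspace B β)
      fun β => (Module.End.eigenspace B (β : ℂ)).subtypeₗᵢ := by
    intro β γ hβγ x y
    exact inner_eq_zero_of_eigenvalues_ne hB (fun h => hβγ (Subtype.ext h))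
      (Module.End.mem_eigenspace_iff.1 x.2) (Module.End.mem_eigenspace_iff.1 y.2)
  have hint : DirectSum.IsInternal fun β : Module.End.Eigenvalues B =>
      Module.End.eigenspace B (β : ℂ) := by
    rw [hV.isInternal_iff, ← orthogonal_iSup_eigenspace_eq_bot hB]
    congr 1
    refine le_antisymm (iSup_le fun β => le_iSup (Module.End.eigenspace B) (β : ℂ))
      (iSup_le fun β => ?_)
    by_cases hβ : Module.End.eigenspace B β = ⊥
    · rw [hβ]
      exact bot_le
    · exact le_iSup (fun β : Module.End.Eigenvalues B => Module.End.eigenspace B (β : ℂ)) ⟨β, hβ⟩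
  -- The compression of `K` to an eigenspace of `B` is symmetric, and its eigenvectors, collected
  -- over all eigenspaces, form the basis.
  let Kc : ∀ β : Module.End.Eigenvalues B,
      Module.End.eigenspace B (β : ℂ) →ₗ[ℂ] Module.End.eigenspace B (β : ℂ) := fun β =>
    ((Module.End.eigenspace B (β : ℂ)).orthogonalProjectionOnto : E →ₗ[ℂ] _) ∘ₗ K ∘ₗ
      (Module.End.eigenspace B (β : ℂ)).subtype
  have hKc : ∀ (β : Module.End.Eigenvalues B) (x y : Module.End.eigenspace B (β : ℂ)),
      inner ℂ x (Kc β y) = inner ℂ (x : E) (K y) := fun β x y =>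
    (Submodule.inner_orthogonalProjectionOnto_eq_of_mem_left x (K y)).symm ▸ rfl
  have hsym : ∀ β, (Kc β).IsSymmetric := by
    intro β x y
    rw [← inner_conj_symm, hKc, hKc, inner_conj_symm]
    exact hK x y
  let b := hint.collectedOrthonormalBasis hV fun β => (hsym β).eigenvectorBasis rfl
  have hb : ∀ a, b a = ((hsym a.1).eigenvectorBasis rfl a.2 : E) := by
    intro a
    simp [b, DirectSum.IsInternal.collectedOrthonormalBasis]
  let e := Fintype.equivFinOfCardEq ((Module.finrank_eq_card_basis b.toBasis).symm.trans hn)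
  refine ⟨b.reindex e, fun j => ((e.symm j).1 : ℂ), fun j => ?_, fun j k hjk hβ => ?_⟩
  · rw [OrthonormalBasis.reindex_apply, hb]
    exact Module.End.mem_eigenspace_iff.1 (Subtype.mem _)
  · rw [OrthonormalBasis.reindex_apply, OrthonormalBasis.reindex_apply, hb, hb]
    have hne : e.symm j ≠ e.symm k := fun h => hjk (e.symm.injective h)
    have hβ' : (e.symm j).1 = (e.symm k).1 := Subtype.ext hβ
    generalize e.symm j = a at hne hβ' ⊢
    generalize e.symm k = a' at hne hβ' ⊢
    obtain ⟨β, i⟩ := a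
    obtain ⟨γ, i'⟩ := a'
    obtain rfl : β = γ := hβ'
    have hii : i ≠ i' := fun h => hne (by rw [h])
    rw [← hKc, LinearMap.IsSymmetric.apply_eigenvectorBasis, inner_smul_right,
      OrthonormalBasis.inner_eq_ite, if_neg hii, mul_zero]

theorem exists_unitary_diagonalization {D : ℕ} {K B : Matrix (Fin D) (Fin D) ℂ}
    (hK : K.IsHermitian) (hB : B ∈ Matrix.unitaryGroup (Fin D) ℂ) :
    ∃ (U : Matrix (Fin D) (Fin D) ℂ) (β : Fin D → ℂ), U.conjTranspose * U = 1 ∧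
      B * U = U * Matrix.diagonal β ∧
      ∀ j k, j ≠ k → β j = β k → (U.conjTranspose * K * U) j k = 0 := by
  have hB' : ∀ x y, inner ℂ (Matrix.toEuclideanLin B x) (Matrix.toEuclideanLin B y) =
      inner ℂ x y := by
    intro x y
    rw [← LinearMap.adjoint_inner_right, ← Matrix.toEuclideanLin_conjTranspose_eq_adjoint,
      ← LinearMap.comp_apply, ← Matrix.toLpLin_mul_same, ← Matrix.star_eq_conjTranspose,
      Matrix.mem_unitaryGroup_iff'.1 hB]
    simp
  have hK' : (Matrix.toEuclideanLin K).IsSymmetric := Matrix.isSymmetric_toEuclideanLin_iff.2 hK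
  obtain ⟨u, β, h1, h2⟩ := exists_adapted_eigenbasis hB' hK' finrank_euclideanSpace_fin
  refine ⟨Matrix.of fun i j => u j i, β, ?_, ?_, ?_⟩
  · ext i j
    have := u.inner_eq_ite i j
    rw [PiLp.inner_apply] at this
    rw [Matrix.mul_apply, Matrix.one_apply, ← this]
    simp [mul_comm]
  · ext i j
    have := congrFun (congrArg WithLp.ofLp (h1 j)) i
    rw [Matrix.mul_diagonal, Matrix.mul_apply]
    simp only [Matrix.toLpLin_apply, Matrix.mulVec, dotProduct] at this
    simpa [mul_comm] using this
  · intro j k hjk hβ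
    have := h2 j k hjk hβ
    rw [PiLp.inner_apply] at this
    rw [Matrix.mul_assoc, Matrix.mul_apply, ← this]
    refine Finset.sum_congr rfl fun i _ => ?_
    simp [Matrix.toLpLin_apply, Matrix.mulVec, dotProduct, Matrix.mul_apply, mul_comm]

end Eigenbasis

/-! ### Matrices acting on `ℂ^D ⊗ F` -/

section SpinMatrices

variable {F : Type*} [NormedAddCommGroup F] [InnerProductSpace ℂ F] {D : ℕ}

/-- The bounded operator `M ⊗ 1` on `ℂ^D ⊗ F`. -/
def spinAct (M : Matrix (Fin D) (Fin D) ℂ) : Spin D F →L[ℂ] Spin D F :=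
  ((PiLp.continuousLinearEquiv 2 ℂ (fun _ : Fin D => F)).symm : (Fin D → F) →L[ℂ] Spin D F) ∘L
    (ContinuousLinearMap.pi fun i => ∑ j, M i j • ContinuousLinearMap.proj j) ∘L
      (PiLp.continuousLinearEquiv 2 ℂ (fun _ : Fin D => F) : Spin D F →L[ℂ] (Fin D → F))

theorem spinAct_apply (M : Matrix (Fin D) (Fin D) ℂ) (Ψ : Spin D F) (i : Fin D) :
    spinAct M Ψ i = ∑ j, M i j • Ψ j := by
  simp [spinAct]

theorem spinAct_mul (M N : Matrix (Fin D) (Fin D) ℂ) (Ψ : Spin D F) :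
    spinAct (M * N) Ψ = spinAct M (spinAct N Ψ) := by
  ext i
  simp only [spinAct_apply, Matrix.mul_apply, Finset.sum_smul, Finset.smul_sum, smul_smul]
  exact Finset.sum_comm

theorem spinAct_one (Ψ : Spin D F) : spinAct 1 Ψ = Ψ := by
  ext i
  simp [spinAct_apply, Matrix.one_apply]

theorem spinAct_smul (c : ℂ) (M : Matrix (Fin D) (Fin D) ℂ) (Ψ : Spin D F) :
    spinAct (c • M) Ψ = c • spinAct M Ψ := by
  ext i
  simp [spinAct_apply, Finset.smul_sum, smul_smul]

theorem spinAct_diagonal (d : Fin D → ℂ) (Ψ : Spin D F) (i : Fin D) :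
    spinAct (Matrix.diagonal d) Ψ i = d i • Ψ i := by
  rw [spinAct_apply, Finset.sum_eq_single i]
  · rw [Matrix.diagonal_apply_eq]
  · intro j _ hj
    rw [Matrix.diagonal_apply_ne _ hj.symm, zero_smul]
  · simp

theorem inner_spinAct (M : Matrix (Fin D) (Fin D) ℂ) (Ψ Φ : Spin D F) :
    inner ℂ (spinAct M Ψ) Φ = inner ℂ Ψ (spinAct M.conjTranspose Φ) := by
  simp only [PiLp.inner_apply, spinAct_apply, sum_inner, inner_sum, inner_smul_left,
    inner_smul_right, Matrix.conjTranspose_apply]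
  exact Finset.sum_comm

/-- The unitary operator `Uᴴ ⊗ 1` for a unitary matrix `U`. -/
def spinUnitary (U : Matrix (Fin D) (Fin D) ℂ) (hU : U.conjTranspose * U = 1) :
    Spin D F ≃ₗᵢ[ℂ] Spin D F where
  toLinearEquiv := LinearEquiv.ofLinearMap (spinAct U.conjTranspose).toLinearMap
    (spinAct U).toLinearMap
    (LinearMap.ext fun Ψ => by
      change spinAct U.conjTranspose (spinAct U Ψ) = Ψ
      rw [← spinAct_mul, hU, spinAct_one])
    (LinearMap.ext fun Ψ => by
      change spinAct U (spinAct U.conjTranspose Ψ) = Ψ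
      rw [← spinAct_mul, mul_eq_one_comm.1 hU, spinAct_one])
  norm_map' := fun Ψ => by
    change ‖spinAct U.conjTranspose Ψ‖ = ‖Ψ‖
    have h : inner ℂ (spinAct U.conjTranspose Ψ) (spinAct U.conjTranspose Ψ) = inner ℂ Ψ Ψ := by
      rw [inner_spinAct, ← spinAct_mul, Matrix.conjTranspose_conjTranspose,
        mul_eq_one_comm.1 hU, spinAct_one]
    rw [inner_self_eq_norm_sq_to_K, inner_self_eq_norm_sq_to_K] at h
    have h2 : ‖spinAct U.conjTranspose Ψ‖ ^ 2 = ‖Ψ‖ ^ 2 := by exact_mod_cast h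
    exact (sq_eq_sq₀ (norm_nonneg _) (norm_nonneg _)).1 h2

theorem mem_graph_conj (W : F ≃ₗᵢ[ℂ] F) (A : F →ₗ.[ℂ] F) (x y : F) :
    (x, y) ∈ (conj W A).graph ↔ (W.symm x, W.symm y) ∈ A.graph := by
  simp only [LinearPMap.mem_graph_iff]
  constructor
  · rintro ⟨w, hw, h⟩
    refine ⟨⟨W.symm w, w.2⟩, congrArg W.symm hw, ?_⟩
    have h' : W (A ⟨W.symm w, w.2⟩) = y := h
    rw [← h', LinearIsometryEquiv.symm_apply_apply]
  · rintro ⟨w, hw, h⟩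
    have hx : W.symm x ∈ A.domain := by
      have := w.2
      rwa [hw] at this
    refine ⟨⟨x, hx⟩, rfl, ?_⟩
    have e : (⟨W.symm x, hx⟩ : A.domain) = w := Subtype.ext hw.symm
    change W (A ⟨W.symm x, hx⟩) = y
    rw [e, h]
    exact W.apply_symm_apply y

theorem spinTensor_one_apply (A : F →ₗ.[ℂ] F)
    (Ψ : (spinTensor (1 : Matrix (Fin D) (Fin D) ℂ) A).domain) (i : Fin D) :
    (spinTensor (1 : Matrix (Fin D) (Fin D) ℂ) A Ψ) i = A ⟨(Ψ : Spin D F) i, Ψ.2 i⟩ := by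
  change ∑ j, (1 : Matrix (Fin D) (Fin D) ℂ) i j • A ⟨(Ψ : Spin D F) j, Ψ.2 j⟩ = _
  simp [Matrix.one_apply]

theorem mem_graph_spinTensor_one (A : F →ₗ.[ℂ] F) (Ψ Θ : Spin D F) :
    (Ψ, Θ) ∈ (spinTensor (1 : Matrix (Fin D) (Fin D) ℂ) A).graph ↔
      ∀ j, (Ψ j, Θ j) ∈ A.graph := by
  constructor
  · intro h j
    obtain ⟨w, hw, hv⟩ := (LinearPMap.mem_graph_iff _).1 h
    dsimp only at hw hv
    subst hw
    rw [← hv, spinTensor_one_apply]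
    exact LinearPMap.mem_graph A ⟨(w : Spin D F) j, w.2 j⟩
  · intro h
    have hd : ∀ j, Ψ j ∈ A.domain := fun j => LinearPMap.mem_domain_of_mem_graph (h j)
    refine (LinearPMap.mem_graph_iff _).2 ⟨⟨Ψ, hd⟩, rfl, ?_⟩
    ext j
    rw [spinTensor_one_apply]
    exact LinearPMap.mem_graph_snd_inj A (LinearPMap.mem_graph A ⟨Ψ j, hd j⟩) (h j) rfl

theorem spinTensor_idOp_apply (M : Matrix (Fin D) (Fin D) ℂ)
    (Ψ : (spinTensor M (idOp F)).domain) :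
    spinTensor M (idOp F) Ψ = spinAct M (Ψ : Spin D F) := by
  ext i
  rw [spinAct_apply]
  rfl

theorem spinTensor_idOp_add_apply (M : Matrix (Fin D) (Fin D) ℂ) (A : F →ₗ.[ℂ] F)
    (w : (spinTensor M (idOp F) + spinTensor (1 : Matrix (Fin D) (Fin D) ℂ) A).domain) :
    (spinTensor M (idOp F) + spinTensor (1 : Matrix (Fin D) (Fin D) ℂ) A) w =
      spinAct M (w : Spin D F) +
        spinTensor (1 : Matrix (Fin D) (Fin D) ℂ) A ⟨(w : Spin D F), w.2.2⟩ := by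
  rw [← spinTensor_idOp_apply M ⟨(w : Spin D F), w.2.1⟩]
  rfl

theorem mem_graph_spinTensor_idOp_add (M : Matrix (Fin D) (Fin D) ℂ) (A : F →ₗ.[ℂ] F)
    (Ψ Θ : Spin D F) :
    (Ψ, Θ) ∈ (spinTensor M (idOp F) + spinTensor 1 A).graph ↔
      (Ψ, Θ - spinAct M Ψ) ∈ (spinTensor (1 : Matrix (Fin D) (Fin D) ℂ) A).graph := by
  constructor
  · intro h
    obtain ⟨w, hw, hv⟩ := (LinearPMap.mem_graph_iff _).1 h
    dsimp only at hw hv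
    subst hw
    subst hv
    refine (LinearPMap.mem_graph_iff _).2 ⟨⟨(w : Spin D F), w.2.2⟩, rfl, ?_⟩
    rw [spinTensor_idOp_add_apply]
    exact (add_sub_cancel_left _ _).symm
  · intro h
    obtain ⟨w, hw, hv⟩ := (LinearPMap.mem_graph_iff _).1 h
    dsimp only at hw hv
    subst hw
    have hw : (w : Spin D F) ∈ (spinTensor M (idOp F) +
      spinTensor (1 : Matrix (Fin D) (Fin D) ℂ) A).domain := ⟨fun _ => trivial, w.2⟩
    refine (LinearPMap.mem_graph_iff _).2 ⟨⟨(w : Spin D F), hw⟩, rfl, ?_⟩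
    refine (spinTensor_idOp_add_apply M A ⟨(w : Spin D F), hw⟩).trans ?_
    exact (congrArg _ hv).trans (add_sub_cancel _ _)

theorem isSelfAdjoint_spinTensor_one [CompleteSpace F] {A : F →ₗ.[ℂ] F}
    (hsym : ∀ a b x y, (a, b) ∈ A.graph → (x, y) ∈ A.graph → inner ℂ b x = inner ℂ a y)
    (c : ℝ) (hs : ∀ φ : F, ∃ ψ, (ψ, φ - (c : ℂ) • ψ) ∈ A.graph) :
    IsSelfAdjoint (spinTensor (1 : Matrix (Fin D) (Fin D) ℂ) A) := by
  refine isSelfAdjoint_of_surjective (fun a b x y hab hxy => ?_) c fun Φ => ?_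
  · rw [mem_graph_spinTensor_one] at hab hxy
    rw [PiLp.inner_apply, PiLp.inner_apply]
    exact Finset.sum_congr rfl fun j _ => hsym _ _ _ _ (hab j) (hxy j)
  · choose ψ hψ using fun j => hs (Φ j)
    exact ⟨WithLp.toLp 2 ψ, (mem_graph_spinTensor_one _ _ _).2 hψ⟩

end SpinMatrices

/-! ### The graph of the Hamiltonian -/

section Hamiltonian

variable {X : Type*} [MeasurableSpace X] {μ : Measure X} [SigmaFinite μ] {D : ℕ}

/-- `1 ⊗ a*(f)` on `ℂ^D ⊗ Dom(𝒩^{1/2})`. -/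
def spinCreate (f : Lp ℂ 2 μ) (Φ : Spin D (Fock μ)) (hΦ : ∀ j, Φ j ∈ domSqrtNumber μ) :
    Spin D (Fock μ) := WithLp.toLp 2 fun j => create f ⟨Φ j, hΦ j⟩

/-- `1 ⊗ a(f)` on `ℂ^D ⊗ Dom(𝒩^{1/2})`. -/
def spinAnnihilate (f : Lp ℂ 2 μ) (Φ : Spin D (Fock μ)) (hΦ : ∀ j, Φ j ∈ domSqrtNumber μ) :
    Spin D (Fock μ) := WithLp.toLp 2 fun j => annihilate f ⟨Φ j, hΦ j⟩

theorem spinTensor_create_apply (f : Lp ℂ 2 μ) (M : Matrix (Fin D) (Fin D) ℂ)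
    (Φ : (spinTensor M (create f)).domain) :
    spinTensor M (create f) Φ = spinAct M (spinCreate f (Φ : Spin D (Fock μ)) Φ.2) := by
  ext i
  rw [spinAct_apply]
  rfl

theorem spinTensor_annihilate_apply (f : Lp ℂ 2 μ) (M : Matrix (Fin D) (Fin D) ℂ)
    (Φ : (spinTensor M (annihilate f)).domain) :
    spinTensor M (annihilate f) Φ = spinAct M (spinAnnihilate f (Φ : Spin D (Fock μ)) Φ.2) := by
  ext i
  rw [spinAct_apply]
  rfl

theorem linearPMap_apply_sum {F : Type*} [AddCommGroup F] [Module ℂ F]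
    (A : F →ₗ.[ℂ] F) {ι : Type*} (s : Finset ι) (c : ι → ℂ) (x : ι → F) (hx : ∀ j, x j ∈ A.domain)
    (h : ∑ j ∈ s, c j • x j ∈ A.domain) :
    A ⟨∑ j ∈ s, c j • x j, h⟩ = ∑ j ∈ s, c j • A ⟨x j, hx j⟩ := by
  have e : (⟨∑ j ∈ s, c j • x j, h⟩ : A.domain) = ∑ j ∈ s, c j • (⟨x j, hx j⟩ : A.domain) := by
    apply Subtype.ext
    simp
  have : A.toFun (∑ j ∈ s, c j • (⟨x j, hx j⟩ : A.domain)) =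
      ∑ j ∈ s, c j • A.toFun ⟨x j, hx j⟩ := by
    simp only [map_sum, map_smul]
  rw [e]
  exact this

theorem spinAct_mem_domSqrtNumber (M : Matrix (Fin D) (Fin D) ℂ) {Φ : Spin D (Fock μ)}
    (hΦ : ∀ j, Φ j ∈ domSqrtNumber μ) (i : Fin D) : spinAct M Φ i ∈ domSqrtNumber μ := by
  rw [spinAct_apply]
  exact Submodule.sum_mem _ fun j _ => Submodule.smul_mem _ _ (hΦ j)

theorem spinCreate_spinAct (f : Lp ℂ 2 μ) (M : Matrix (Fin D) (Fin D) ℂ) {Φ : Spin D (Fock μ)}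
    (hΦ : ∀ j, Φ j ∈ domSqrtNumber μ) (h : ∀ j, spinAct M Φ j ∈ domSqrtNumber μ) :
    spinCreate f (spinAct M Φ) h = spinAct M (spinCreate f Φ hΦ) := by
  refine PiLp.ext fun i => ?_
  have h' := h i
  rw [spinAct_apply] at h'
  rw [spinAct_apply]
  refine Eq.trans ?_ (linearPMap_apply_sum (create f) Finset.univ (M i) (fun j => Φ j) hΦ h')
  change create f ⟨spinAct M Φ i, h i⟩ = _
  congr 1
  exact Subtype.ext (spinAct_apply M Φ i)

theorem spinAnnihilate_spinAct (f : Lp ℂ 2 μ) (M : Matrix (Fin D) (Fin D) ℂ)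
    {Φ : Spin D (Fock μ)} (hΦ : ∀ j, Φ j ∈ domSqrtNumber μ)
    (h : ∀ j, spinAct M Φ j ∈ domSqrtNumber μ) :
    spinAnnihilate f (spinAct M Φ) h = spinAct M (spinAnnihilate f Φ hΦ) := by
  refine PiLp.ext fun i => ?_
  have h' := h i
  rw [spinAct_apply] at h'
  rw [spinAct_apply]
  refine Eq.trans ?_ (linearPMap_apply_sum (annihilate f) Finset.univ (M i) (fun j => Φ j) hΦ h')
  change annihilate f ⟨spinAct M Φ i, h i⟩ = _
  congr 1
  exact Subtype.ext (spinAct_apply M Φ i)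

theorem spinAct_mem_graph (A : Fock μ →ₗ.[ℂ] Fock μ) (M : Matrix (Fin D) (Fin D) ℂ)
    {Φ Y : Spin D (Fock μ)} (h : ∀ j, (Φ j, Y j) ∈ A.graph) (i : Fin D) :
    (spinAct M Φ i, spinAct M Y i) ∈ A.graph := by
  rw [spinAct_apply, spinAct_apply]
  have := Submodule.sum_mem A.graph (t := Finset.univ)
    (f := fun j => M i j • (Φ j, Y j)) fun j _ => A.graph.smul_mem (M i j) (h j)
  convert this
  · rw [Prod.fst_sum]; rfl
  · rw [Prod.snd_sum]; rfl

theorem hamiltonian_sub_apply (ω : X → ℝ) (K B E : Matrix (Fin D) (Fin D) ℂ) (f : Lp ℂ 2 μ)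
    (w : (hamiltonian ω K B f - spinTensor E (idOp (Fock μ))).domain) :
    (hamiltonian ω K B f - spinTensor E (idOp (Fock μ))) w =
      spinAct K (w : Spin D (Fock μ)) +
        spinTensor (1 : Matrix (Fin D) (Fin D) ℂ) (dGamma μ ω)
          ⟨(w : Spin D (Fock μ)), w.2.1.1.2⟩ +
        (spinAct B (spinCreate f (w : Spin D (Fock μ)) w.2.1.2.1) +
          spinAct B.conjTranspose (spinAnnihilate f (w : Spin D (Fock μ)) w.2.1.2.1)) -
        spinAct E (w : Spin D (Fock μ)) := by
  rw [← spinTensor_idOp_apply K ⟨(w : Spin D (Fock μ)), w.2.1.1.1⟩,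
    ← spinTensor_idOp_apply E ⟨(w : Spin D (Fock μ)), w.2.2⟩,
    ← spinTensor_create_apply f B ⟨(w : Spin D (Fock μ)), w.2.1.2.1⟩,
    ← spinTensor_annihilate_apply f B.conjTranspose ⟨(w : Spin D (Fock μ)), w.2.1.2.2⟩]
  rfl

/-- On vectors with components in `Dom(𝒩^{1/2})` every other summand is defined, so the graph is
parametrized by the value `Y` of `1 ⊗ dΓ(ω)` alone. -/
theorem mem_graph_hamiltonian_sub (ω : X → ℝ) (K B E : Matrix (Fin D) (Fin D) ℂ) (f : Lp ℂ 2 μ)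
    (Φ Θ : Spin D (Fock μ)) (hΦ : ∀ j, Φ j ∈ domSqrtNumber μ) :
    (Φ, Θ) ∈ (hamiltonian ω K B f - spinTensor E (idOp (Fock μ))).graph ↔
      ∃ Y : Spin D (Fock μ), (∀ j, (Φ j, Y j) ∈ (dGamma μ ω).graph) ∧
        Θ = spinAct K Φ + Y + (spinAct B (spinCreate f Φ hΦ) +
          spinAct B.conjTranspose (spinAnnihilate f Φ hΦ)) - spinAct E Φ := by
  simp only [← mem_graph_spinTensor_one]
  constructor
  · intro h
    obtain ⟨w, hw, hv⟩ := (LinearPMap.mem_graph_iff _).1 h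
    dsimp only at hw hv
    subst hw
    exact ⟨_, LinearPMap.mem_graph (spinTensor (1 : Matrix (Fin D) (Fin D) ℂ) (dGamma μ ω))
      ⟨(w : Spin D (Fock μ)), w.2.1.1.2⟩, hv.symm.trans (hamiltonian_sub_apply ω K B E f w)⟩
  · rintro ⟨Y, hY, rfl⟩
    obtain ⟨w, hw, hv⟩ := (LinearPMap.mem_graph_iff _).1 hY
    dsimp only at hw hv
    subst hw
    subst hv
    have hw : (w : Spin D (Fock μ)) ∈ (hamiltonian ω K B f - spinTensor E (idOp (Fock μ))).domain :=
      ⟨⟨⟨fun _ => trivial, w.2⟩, ⟨hΦ, hΦ⟩⟩, fun _ => trivial⟩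
    exact (LinearPMap.mem_graph_iff _).2 ⟨⟨(w : Spin D (Fock μ)), hw⟩, rfl,
      hamiltonian_sub_apply ω K B E f ⟨(w : Spin D (Fock μ)), hw⟩⟩

theorem mem_graph_hamiltonian_sub_domain (ω : X → ℝ) (K B E : Matrix (Fin D) (Fin D) ℂ)
    (f : Lp ℂ 2 μ) {Φ Θ : Spin D (Fock μ)}
    (h : (Φ, Θ) ∈ (hamiltonian ω K B f - spinTensor E (idOp (Fock μ))).graph) (j : Fin D) :
    Φ j ∈ domSqrtNumber μ :=
  (LinearPMap.mem_domain_of_mem_graph h).1.2.1 j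

end Hamiltonian

/-! ### The dressing transformation -/

section Dressing

variable {X : Type*} [MeasurableSpace X] {μ : Measure X} {ω : X → ℝ} {m : ℝ}

theorem half_inner_smul_add {f g : Lp ℂ 2 μ} {b : ℂ} (hb : (starRingEnd ℂ b) * b = 1) :
    ((inner ℂ (b • f) (b • g) + inner ℂ (b • g) (b • f)) / 2 : ℂ) =
      (inner ℂ f g + inner ℂ g f) / 2 := by
  simp only [inner_smul_left, inner_smul_right]
  linear_combination ((inner ℂ f g + inner ℂ g f) / 2 : ℂ) * hb

theorem exists_div_dispersion (hω : Measurable ω) (hm : 0 < m) (hωm : ∀ᵐ k ∂μ, m ≤ ω k)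
    (f : Lp ℂ 2 μ) : ∃ g : Lp ℂ 2 μ, (g =ᵐ[μ] fun k => ((ω k)⁻¹ : ℂ) * f k) ∧
      (f =ᵐ[μ] fun k => (ω k : ℂ) * g k) := by
  have hL : MemLp (fun k => ((ω k)⁻¹ : ℂ) * f k) 2 μ := by
    refine (Lp.memLp f).of_le_mul (c := m⁻¹) ?_ ?_
    · have : Measurable fun k => ((ω k)⁻¹ : ℂ) := by fun_prop
      exact this.aestronglyMeasurable.mul (Lp.aestronglyMeasurable f)
    · filter_upwards [hωm] with k hk
      rw [norm_mul, norm_inv, Complex.norm_real, Real.norm_of_nonneg (hm.le.trans hk)]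
      gcongr
  refine ⟨hL.toLp _, hL.coeFn_toLp, ?_⟩
  filter_upwards [hL.coeFn_toLp, hωm] with k h1 h2
  have h3 : (ω k : ℂ) ≠ 0 := Complex.ofReal_ne_zero.2 (hm.trans_le h2).ne'
  rw [h1, mul_inv_cancel_left₀ h3]

/-- The symmetrized right-hand side is the constant `c / 2` that the commutator expansion produces.
-/
theorem integral_eq_half_inner_add {f g : Lp ℂ 2 μ} (hg : g =ᵐ[μ] fun k => ((ω k)⁻¹ : ℂ) * f k) :
    ∫ k, (starRingEnd ℂ) (f k) * f k / (ω k : ℂ) ∂μ = (inner ℂ f g + inner ℂ g f) / 2 := by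
  have h1 : inner ℂ f g = ∫ k, (starRingEnd ℂ) (f k) * f k / (ω k : ℂ) ∂μ := by
    rw [L2.inner_def]
    refine integral_congr_ae ?_
    filter_upwards [hg] with k hk
    rw [hk, RCLike.inner_apply]
    ring
  have h2 : inner ℂ g f = ∫ k, (starRingEnd ℂ) (f k) * f k / (ω k : ℂ) ∂μ := by
    rw [L2.inner_def]
    refine integral_congr_ae ?_
    filter_upwards [hg] with k hk
    rw [hk, RCLike.inner_apply, map_mul, map_inv₀, Complex.conj_ofReal]
    ring
  rw [h1, h2]
  ring

variable [SigmaFinite μ] {D : ℕ}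

/-- The dressing transformation `(⊕_j e^{a*(β_j g) - a(β_j g)}) (Uᴴ ⊗ 1)`. -/
def spinWeyl (U : Matrix (Fin D) (Fin D) ℂ) (hU : U.conjTranspose * U = 1) (β : Fin D → ℂ)
    (g : Lp ℂ 2 μ) : Spin D (Fock μ) ≃ₗᵢ[ℂ] Spin D (Fock μ) :=
  (spinUnitary U hU).trans (LinearIsometryEquiv.piLpCongrRight 2 fun j => weyl (β j • g))

theorem spinWeyl_apply (U : Matrix (Fin D) (Fin D) ℂ) (hU : U.conjTranspose * U = 1)
    (β : Fin D → ℂ) (g : Lp ℂ 2 μ) (Ψ : Spin D (Fock μ)) (j : Fin D) :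
    spinWeyl U hU β g Ψ j = weyl (β j • g) (spinAct U.conjTranspose Ψ j) := rfl

theorem spinWeyl_symm_apply (U : Matrix (Fin D) (Fin D) ℂ) (hU : U.conjTranspose * U = 1)
    (β : Fin D → ℂ) (g : Lp ℂ 2 μ) (Ψ : Spin D (Fock μ)) :
    (spinWeyl U hU β g).symm Ψ =
      spinAct U (WithLp.toLp 2 fun j => (weyl (β j • g)).symm (Ψ j)) := rfl

theorem spinWeyl_spinAct (U : Matrix (Fin D) (Fin D) ℂ) (hU : U.conjTranspose * U = 1)
    (β : Fin D → ℂ) (g : Lp ℂ 2 μ) (Ξ : Spin D (Fock μ)) (j : Fin D) :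
    spinWeyl U hU β g (spinAct U Ξ) j = weyl (β j • g) (Ξ j) := by
  rw [spinWeyl_apply, ← spinAct_mul, hU, spinAct_one]

theorem conj_mul_self_of_diagonalization {U B : Matrix (Fin D) (Fin D) ℂ} {β : Fin D → ℂ}
    (hU : U.conjTranspose * U = 1) (hB : B.conjTranspose * B = 1)
    (hBU : B * U = U * Matrix.diagonal β) (j : Fin D) : (starRingEnd ℂ (β j)) * β j = 1 := by
  have h : (B * U).conjTranspose * (B * U) = 1 := by
    rw [Matrix.conjTranspose_mul, Matrix.mul_assoc, ← Matrix.mul_assoc B.conjTranspose, hB,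
      Matrix.one_mul, hU]
  rw [hBU, Matrix.conjTranspose_mul, Matrix.mul_assoc, ← Matrix.mul_assoc U.conjTranspose, hU,
    Matrix.one_mul, Matrix.diagonal_conjTranspose, Matrix.diagonal_mul_diagonal] at h
  have := congrFun (congrFun h j) j
  simpa using this

theorem conjTranspose_mul_of_diagonalization {U B : Matrix (Fin D) (Fin D) ℂ} {β : Fin D → ℂ}
    (hU : U.conjTranspose * U = 1) (hB : B.conjTranspose * B = 1)
    (hBU : B * U = U * Matrix.diagonal β) :
    B.conjTranspose * U = U * Matrix.diagonal fun j => starRingEnd ℂ (β j) := by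
  have h1 : Matrix.diagonal β * Matrix.diagonal (fun j => starRingEnd ℂ (β j)) = 1 := by
    rw [Matrix.diagonal_mul_diagonal, ← Matrix.diagonal_one]
    congr 1
    funext j
    rw [mul_comm, conj_mul_self_of_diagonalization hU hB hBU]
  calc B.conjTranspose * U = B.conjTranspose * (U * Matrix.diagonal β) *
        Matrix.diagonal (fun j => starRingEnd ℂ (β j)) := by
        rw [Matrix.mul_assoc, Matrix.mul_assoc U, h1, Matrix.mul_one]
    _ = _ := by rw [← hBU, ← Matrix.mul_assoc, hB, Matrix.one_mul]

/-- The components of the dressed Hamiltonian before the Weyl transformation. -/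
def dressedComponent (β : Fin D → ℂ) (f : Lp ℂ 2 μ) (e : ℂ) (Ξ Y : Spin D (Fock μ))
    (hΞ : ∀ j, Ξ j ∈ domSqrtNumber μ) : Spin D (Fock μ) :=
  WithLp.toLp 2 fun j => Y j + field (β j • f) ⟨Ξ j, hΞ j⟩ + e • Ξ j

/-- `U` diagonalizes `B` and `Bᴴ` simultaneously, with entries `β_j` and `conj β_j`. These are
absorbed by linearity of `a*` and antilinearity of `a` into the form factor `β_j f`, and `Bᴴ B = 1`
makes the self-energy scalar. -/
theorem hamiltonian_value_eq {U B : Matrix (Fin D) (Fin D) ℂ} {β : Fin D → ℂ}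
    (hU : U.conjTranspose * U = 1) (hB : B.conjTranspose * B = 1)
    (hBU : B * U = U * Matrix.diagonal β) (f : Lp ℂ 2 μ) (e : ℂ) {Ξ Y : Spin D (Fock μ)}
    (hΞ : ∀ j, Ξ j ∈ domSqrtNumber μ) (h : ∀ j, spinAct U Ξ j ∈ domSqrtNumber μ) :
    spinAct U Y + (spinAct B (spinCreate f (spinAct U Ξ) h) +
        spinAct B.conjTranspose (spinAnnihilate f (spinAct U Ξ) h)) -
          spinAct (-(e • (B.conjTranspose * B))) (spinAct U Ξ) =
      spinAct U (dressedComponent β f e Ξ Y hΞ) := by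
  have e1 : spinAct (-(e • (B.conjTranspose * B))) (spinAct U Ξ) = -(spinAct U (e • Ξ)) := by
    rw [hB, ← neg_smul, spinAct_smul, spinAct_one, map_smul, neg_smul]
  rw [e1, spinCreate_spinAct f U hΞ h, spinAnnihilate_spinAct f U hΞ h, ← spinAct_mul,
    ← spinAct_mul, hBU, conjTranspose_mul_of_diagonalization hU hB hBU, spinAct_mul, spinAct_mul,
    sub_neg_eq_add, ← map_add, ← map_add, ← map_add]
  congr 1
  refine PiLp.ext fun j => ?_
  change Y j + (spinAct _ _ j + spinAct _ _ j) + e • Ξ j =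
    Y j + (create (β j • f) ⟨Ξ j, hΞ j⟩ + annihilate (β j • f) ⟨Ξ j, hΞ j⟩) + e • Ξ j
  rw [spinAct_diagonal, spinAct_diagonal]
  exact congrArg (fun v => Y j + v + e • Ξ j) (congrArg₂ (· + ·)
    (create_smul (β j) f ⟨Ξ j, hΞ j⟩).symm (annihilate_smul (β j) f ⟨Ξ j, hΞ j⟩).symm)

/-- The dressing transformation turns `H - E` into `1 ⊗ dΓ(ω) + W (K ⊗ 1) W*`. -/
theorem mem_graph_conj_spinWeyl (hω : Measurable ω) (hm : 0 < m) (hωm : ∀ᵐ k ∂μ, m ≤ ω k)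
    {f g : Lp ℂ 2 μ} (hfg : f =ᵐ[μ] fun k => (ω k : ℂ) * g k)
    {U B : Matrix (Fin D) (Fin D) ℂ} (K : Matrix (Fin D) (Fin D) ℂ) {β : Fin D → ℂ}
    (hU : U.conjTranspose * U = 1) (hB : B.conjTranspose * B = 1)
    (hBU : B * U = U * Matrix.diagonal β) {e : ℂ}
    (he : e = (inner ℂ f g + inner ℂ g f) / 2) (Ψ Θ : Spin D (Fock μ)) :
    (Ψ, Θ) ∈ (conj (spinWeyl U hU β g) (hamiltonian ω K B f -
        spinTensor (-(e • (B.conjTranspose * B))) (idOp (Fock μ)))).graph ↔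
      ∀ j, (Ψ j, (Θ - spinWeyl U hU β g (spinAct K ((spinWeyl U hU β g).symm Ψ))) j) ∈
        (dGamma μ ω).graph := by
  set W := spinWeyl U hU β g with hW
  obtain ⟨Ξ, hΞ⟩ : ∃ Ξ : Spin D (Fock μ), Ξ = WithLp.toLp 2 fun j => (weyl (β j • g)).symm (Ψ j) :=
    ⟨_, rfl⟩
  have hΞj : ∀ j, weyl (β j • g) (Ξ j) = Ψ j := fun j => by
    rw [hΞ]
    exact LinearIsometryEquiv.apply_symm_apply _ _
  have hWΨ : W.symm Ψ = spinAct U Ξ := by rw [hΞ]; rfl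
  -- Since `|β_j| = 1`, completing the square costs the same constant `e` in every component.
  have weylZ : ∀ (Y : Spin D (Fock μ)) (hd : ∀ j, Ξ j ∈ domSqrtNumber μ),
      (∀ j, (Ξ j, Y j) ∈ (dGamma μ ω).graph) →
      ∀ j, (Ψ j, weyl (β j • g) (dressedComponent β f e Ξ Y hd j)) ∈ (dGamma μ ω).graph := by
    intro Y hd hY j
    have := weyl_mem_graph hω hm hωm (smul_ae_eq_mul_smul hfg (β j)) (hd j) (hY j)
    rw [hΞj, half_inner_smul_add (conj_mul_self_of_diagonalization hU hB hBU j), ← he] at this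
    exact this
  have dom : ∀ {x y : Fock μ}, (x, y) ∈ (dGamma μ ω).graph → x ∈ domSqrtNumber μ :=
    fun h => mem_domSqrtNumber_of_graph hm hωm h
  rw [mem_graph_conj, hWΨ]
  constructor
  · intro h
    have hd' := mem_graph_hamiltonian_sub_domain ω K B _ f h
    obtain ⟨Y₀, hY₀, hΘ⟩ := (mem_graph_hamiltonian_sub ω K B _ f _ _ hd').1 h
    have hUU : ∀ Z : Spin D (Fock μ), spinAct U (spinAct U.conjTranspose Z) = Z := fun Z => by
      rw [← spinAct_mul, mul_eq_one_comm.1 hU, spinAct_one]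
    have hUU' : ∀ Z : Spin D (Fock μ), spinAct U.conjTranspose (spinAct U Z) = Z := fun Z => by
      rw [← spinAct_mul, hU, spinAct_one]
    have hY : ∀ j, (Ξ j, spinAct U.conjTranspose Y₀ j) ∈ (dGamma μ ω).graph := by
      intro j
      have := spinAct_mem_graph (dGamma μ ω) U.conjTranspose hY₀ j
      rwa [hUU'] at this
    have hd : ∀ j, Ξ j ∈ domSqrtNumber μ := fun j => dom (hY j)
    have hval := hamiltonian_value_eq hU hB hBU f e (Y := spinAct U.conjTranspose Y₀) hd hd'
    rw [hUU] at hval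
    have hΘ' : W.symm Θ = spinAct K (spinAct U Ξ) +
        spinAct U (dressedComponent β f e Ξ (spinAct U.conjTranspose Y₀) hd) := by
      rw [hΘ, ← hval]
      abel
    have hΘ'' : Θ - W (spinAct K (spinAct U Ξ)) =
        W (spinAct U (dressedComponent β f e Ξ (spinAct U.conjTranspose Y₀) hd)) := by
      rw [sub_eq_iff_eq_add', ← map_add, ← hΘ', LinearIsometryEquiv.apply_symm_apply]
    intro j
    rw [hΘ'', hW, spinWeyl_spinAct]
    exact weylZ _ hd hY j
  · intro h
    -- Conversely, the inverse Weyl operators preserve `Dom(dΓ(ω))`, so some value `Y` exists, and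
    -- single-valuedness of `dΓ(ω)` identifies its image.
    choose Y hY using fun j => weyl_symm_mem_graph hω hm hωm (smul_ae_eq_mul_smul hfg (β j)) (h j)
    have hY' : ∀ j, (Ξ j, (WithLp.toLp 2 Y : Spin D (Fock μ)) j) ∈ (dGamma μ ω).graph := by
      rw [hΞ]
      exact hY
    have hd : ∀ j, Ξ j ∈ domSqrtNumber μ := fun j => dom (hY' j)
    have hd' := spinAct_mem_domSqrtNumber U hd
    have hZ : Θ - W (spinAct K (spinAct U Ξ)) =
        W (spinAct U (dressedComponent β f e Ξ (WithLp.toLp 2 Y) hd)) := by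
      refine PiLp.ext fun j => ?_
      rw [hW, spinWeyl_spinAct]
      exact LinearPMap.mem_graph_snd_inj _ (h j) (weylZ _ hd hY' j) rfl
    rw [mem_graph_hamiltonian_sub ω K B _ f _ _ hd']
    refine ⟨spinAct U (WithLp.toLp 2 Y), spinAct_mem_graph _ U hY', ?_⟩
    have hval := hamiltonian_value_eq hU hB hBU f e (Y := WithLp.toLp 2 Y) hd hd'
    have hΘ : W.symm Θ = spinAct K (spinAct U Ξ) +
        spinAct U (dressedComponent β f e Ξ (WithLp.toLp 2 Y) hd) := by
      rw [sub_eq_iff_eq_add', ← map_add] at hZ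
      rw [hZ, LinearIsometryEquiv.symm_apply_apply]
    rw [hΘ, ← hval]
    abel

/-- The difference between the dressed and the limiting matrix term. -/
def dressedMatrix (U : Matrix (Fin D) (Fin D) ℂ) (hU : U.conjTranspose * U = 1) (β : Fin D → ℂ)
    (K η : Matrix (Fin D) (Fin D) ℂ) (g : Lp ℂ 2 μ) : Spin D (Fock μ) →L[ℂ] Spin D (Fock μ) :=
  ((spinWeyl U hU β g : Spin D (Fock μ) →L[ℂ] Spin D (Fock μ)) ∘L spinAct K ∘L
    ((spinWeyl U hU β g).symm : Spin D (Fock μ) →L[ℂ] Spin D (Fock μ))) - spinAct η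

theorem dressedMatrix_apply (U : Matrix (Fin D) (Fin D) ℂ) (hU : U.conjTranspose * U = 1)
    (β : Fin D → ℂ) (K η : Matrix (Fin D) (Fin D) ℂ) (g : Lp ℂ 2 μ) (Ψ : Spin D (Fock μ)) :
    dressedMatrix U hU β K η g Ψ =
      spinWeyl U hU β g (spinAct K ((spinWeyl U hU β g).symm Ψ)) - spinAct η Ψ := rfl

theorem dressedMatrix_symmetric (U : Matrix (Fin D) (Fin D) ℂ) (hU : U.conjTranspose * U = 1)
    (β : Fin D → ℂ) {K η : Matrix (Fin D) (Fin D) ℂ} (hK : K.IsHermitian) (hη : η.IsHermitian)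
    (g : Lp ℂ 2 μ) (Φ Ψ : Spin D (Fock μ)) :
    inner ℂ (dressedMatrix U hU β K η g Φ) Ψ = inner ℂ Φ (dressedMatrix U hU β K η g Ψ) := by
  rw [dressedMatrix_apply, dressedMatrix_apply, inner_sub_left, inner_sub_right, inner_spinAct, hη]
  congr 1
  obtain ⟨W, hW⟩ : ∃ W, W = spinWeyl U hU β g := ⟨_, rfl⟩
  rw [← hW]
  calc inner ℂ (W (spinAct K (W.symm Φ))) Ψ
      = inner ℂ (W (spinAct K (W.symm Φ))) (W (W.symm Ψ)) := by rw [W.apply_symm_apply]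
    _ = inner ℂ (W (W.symm Φ)) (W (spinAct K (W.symm Ψ))) := by
        rw [W.inner_map_map, W.inner_map_map, inner_spinAct, hK]
    _ = _ := by rw [W.apply_symm_apply]

theorem norm_dressedMatrix_apply_le (U : Matrix (Fin D) (Fin D) ℂ) (hU : U.conjTranspose * U = 1)
    (β : Fin D → ℂ) (K η : Matrix (Fin D) (Fin D) ℂ) (g : Lp ℂ 2 μ) (Ψ : Spin D (Fock μ)) :
    ‖dressedMatrix U hU β K η g Ψ‖ ≤
      (‖(spinAct K : Spin D (Fock μ) →L[ℂ] Spin D (Fock μ))‖ +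
        ‖(spinAct η : Spin D (Fock μ) →L[ℂ] Spin D (Fock μ))‖) * ‖Ψ‖ := by
  rw [dressedMatrix_apply, add_mul]
  refine (norm_sub_le _ _).trans (add_le_add ?_ (ContinuousLinearMap.le_opNorm _ _))
  rw [LinearIsometryEquiv.norm_map]
  refine (ContinuousLinearMap.le_opNorm _ _).trans ?_
  rw [LinearIsometryEquiv.norm_map]

/-- On the diagonal the two Weyl operators cancel, leaving exactly the term that `η` subtracts. -/
theorem dressedMatrix_apply_apply (U : Matrix (Fin D) (Fin D) ℂ) (hU : U.conjTranspose * U = 1)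
    (β : Fin D → ℂ) (K : Matrix (Fin D) (Fin D) ℂ) (g : Lp ℂ 2 μ) (Ψ : Spin D (Fock μ))
    (j : Fin D) :
    dressedMatrix U hU β K (Matrix.diagonal fun j => (U.conjTranspose * K * U) j j) g Ψ j =
      ∑ k, if k = j then 0 else
        (U.conjTranspose * K * U) j k • weyl (β j • g) ((weyl (β k • g)).symm (Ψ k)) := by
  have h1 : ∀ k, (if k = j then 0 else
      (U.conjTranspose * K * U) j k • weyl (β j • g) ((weyl (β k • g)).symm (Ψ k))) =
      (U.conjTranspose * K * U) j k • weyl (β j • g) ((weyl (β k • g)).symm (Ψ k)) -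
        if k = j then (U.conjTranspose * K * U) j j • Ψ j else 0 := by
    intro k
    split_ifs with h
    · subst h
      rw [LinearIsometryEquiv.apply_symm_apply, sub_self]
    · rw [sub_zero]
  rw [Finset.sum_congr rfl fun k _ => h1 k, Finset.sum_sub_distrib, Finset.sum_ite_eq',
    if_pos (Finset.mem_univ j), dressedMatrix_apply]
  change spinWeyl U hU β g (spinAct K ((spinWeyl U hU β g).symm Ψ)) j - spinAct _ Ψ j = _
  rw [spinAct_diagonal, spinWeyl_apply, spinWeyl_symm_apply, ← spinAct_mul, ← spinAct_mul,
    spinAct_apply, map_sum]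
  congr 1
  exact Finset.sum_congr rfl fun k _ => map_smul _ _ _

/-- The bound on the form of the off-diagonal part of the dressed matrix term. -/
def decayRate (m : ℝ) (M : Matrix (Fin D) (Fin D) ℂ) (β : Fin D → ℂ) (r : ℝ) : ℝ :=
  ∑ j, ∑ k, if β j = β k then 0 else ‖M j k‖ * ((4 * (1 + m⁻¹) + 1) / (1 + ‖β j - β k‖ * r))

theorem tendsto_decayRate (m : ℝ) (M : Matrix (Fin D) (Fin D) ℂ) (β : Fin D → ℂ) :
    Tendsto (decayRate m M β) atTop (𝓝 0) := by
  have h0 : (0 : ℝ) = ∑ _j : Fin D, ∑ _k : Fin D, (0 : ℝ) := by simp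
  rw [h0]
  refine tendsto_finsetSum _ fun j _ => tendsto_finsetSum _ fun k _ => ?_
  by_cases h : β j = β k
  · simp only [h, if_true]
    exact tendsto_const_nhds
  · simp only [h, if_false]
    have hpos : 0 < ‖β j - β k‖ := norm_pos_iff.2 (sub_ne_zero.2 h)
    have h1 : Tendsto (fun r : ℝ => 1 + ‖β j - β k‖ * r) atTop atTop :=
      tendsto_atTop_add_const_left _ _ (tendsto_id.const_mul_atTop hpos)
    simpa using (h1.const_div_atTop (4 * (1 + m⁻¹) + 1)).const_mul ‖M j k‖

/-- Diagonal entries are subtracted, entries with equal `β` vanish by the choice of basis, and all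
others decay by `norm_inner_weyl_weyl_symm_le`. -/
theorem norm_inner_dressedMatrix_le (hω : Measurable ω) (hm : 0 < m) (hωm : ∀ᵐ k ∂μ, m ≤ ω k)
    {f g : Lp ℂ 2 μ} (hfg : f =ᵐ[μ] fun k => (ω k : ℂ) * g k)
    {U : Matrix (Fin D) (Fin D) ℂ} (hU : U.conjTranspose * U = 1) {β : Fin D → ℂ}
    {K : Matrix (Fin D) (Fin D) ℂ}
    (hKβ : ∀ j k, j ≠ k → β j = β k → (U.conjTranspose * K * U) j k = 0)
    {a a' x x' : Spin D (Fock μ)} {p q : ℝ} (ha : ∀ j, (a j, a' j) ∈ (dGamma μ ω).graph)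
    (hx : ∀ j, (x j, x' j) ∈ (dGamma μ ω).graph) (hp : ∀ j, ‖a j‖ + ‖a' j‖ ≤ p)
    (hq : ∀ j, ‖x j‖ + ‖x' j‖ ≤ q) :
    ‖inner ℂ a (dressedMatrix U hU β K
        (Matrix.diagonal fun j => (U.conjTranspose * K * U) j j) g x)‖ ≤
      decayRate m (U.conjTranspose * K * U) β ‖g‖ * (p * q) := by
  rw [PiLp.inner_apply, decayRate, Finset.sum_mul]
  refine (norm_sum_le _ _).trans (Finset.sum_le_sum fun j _ => ?_)
  rw [dressedMatrix_apply_apply, inner_sum, Finset.sum_mul]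
  refine (norm_sum_le _ _).trans (Finset.sum_le_sum fun k _ => ?_)
  have hm' : 0 < m⁻¹ := inv_pos.2 hm
  by_cases hkj : k = j
  · subst hkj
    simp
  rw [if_neg hkj]
  by_cases hβ : β j = β k
  · rw [hKβ j k (Ne.symm hkj) hβ, zero_smul, inner_zero_right, norm_zero, if_pos hβ, zero_mul]
  rw [if_neg hβ, inner_smul_right, norm_mul, mul_assoc ‖(U.conjTranspose * K * U) j k‖]
  refine mul_le_mul_of_nonneg_left ?_ (norm_nonneg ((U.conjTranspose * K * U) j k))
  refine (norm_inner_weyl_weyl_symm_le hω hm hωm hfg (β j) (β k) (ha j) (hx k)).trans ?_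
  refine mul_le_mul_of_nonneg_left ?_ (by positivity)
  have h1 : 0 ≤ ‖a j‖ + ‖a' j‖ := by positivity
  exact mul_le_mul (hp j) (hq k) (by positivity) (h1.trans (hp j))

end Dressing

/-! ### Assembling the limit -/

section Limit

variable {X : Type*} [MeasurableSpace X] {μ : Measure X}

theorem tendsto_norm_div_dispersion {ω : X → ℝ} {f g : ℕ → Lp ℂ 2 μ}
    (hg : ∀ Λ, g Λ =ᵐ[μ] fun k => ((ω k)⁻¹ : ℂ) * f Λ k)
    (hf : Tendsto (fun Λ => eLpNorm (fun k => ((ω k)⁻¹ : ℂ) * f Λ k) 2 μ) atTop (𝓝 ∞)) :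
    Tendsto (fun Λ => ‖g Λ‖) atTop atTop := by
  rw [← ENNReal.tendsto_ofReal_nhds_top]
  refine hf.congr fun Λ => ?_
  rw [ofReal_norm, Lp.enorm_def]
  exact (eLpNorm_congr_ae (hg Λ)).symm

variable [SigmaFinite μ] {D : ℕ}

theorem isSelfAdjoint_spinTensor_idOp_add_dGamma {ω : X → ℝ} (hω : Measurable ω)
    (hω0 : ∀ᵐ k ∂μ, 0 ≤ ω k) {η : Matrix (Fin D) (Fin D) ℂ} (hη : η.IsHermitian) :
    IsSelfAdjoint (spinTensor η (idOp (Fock μ)) + spinTensor 1 (dGamma μ ω)) := by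
  have h1 : IsSelfAdjoint (spinTensor (1 : Matrix (Fin D) (Fin D) ℂ) (dGamma μ ω)) :=
    isSelfAdjoint_spinTensor_one (fun _ _ _ _ => inner_eq_of_mem_graph_dGamma) 1 fun φ => by
      simpa using exists_resolvent_dGamma hω hω0 φ
  refine isSelfAdjoint_of_bounded_perturbation h1 (V := spinAct η) (fun x y => ?_)
    fun x y => mem_graph_spinTensor_idOp_add _ _ _ _
  rw [inner_spinAct, hη]

theorem mem_graph_conj_iff_sub_dressedMatrix {ω : X → ℝ} {m : ℝ} (hω : Measurable ω) (hm : 0 < m)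
    (hωm : ∀ᵐ k ∂μ, m ≤ ω k) {f g : Lp ℂ 2 μ} (hg : g =ᵐ[μ] fun k => ((ω k)⁻¹ : ℂ) * f k)
    (hfg : f =ᵐ[μ] fun k => (ω k : ℂ) * g k)
    {U B : Matrix (Fin D) (Fin D) ℂ} (K η : Matrix (Fin D) (Fin D) ℂ) {β : Fin D → ℂ}
    (hU : U.conjTranspose * U = 1) (hB : B.conjTranspose * B = 1)
    (hBU : B * U = U * Matrix.diagonal β) (Ψ Θ : Spin D (Fock μ)) :
    (Ψ, Θ) ∈ (conj (spinWeyl U hU β g)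
        (hamiltonian ω K B f - spinTensor (selfEnergy ω B f) (idOp (Fock μ)))).graph ↔
      (Ψ, Θ - dressedMatrix U hU β K η g Ψ) ∈
        (spinTensor η (idOp (Fock μ)) + spinTensor 1 (dGamma μ ω)).graph := by
  have e1 : Θ - dressedMatrix U hU β K η g Ψ - spinAct η Ψ =
      Θ - spinWeyl U hU β g (spinAct K ((spinWeyl U hU β g).symm Ψ)) := by
    rw [dressedMatrix_apply]
    abel
  rw [mem_graph_spinTensor_idOp_add, mem_graph_spinTensor_one, e1]
  exact mem_graph_conj_spinWeyl hω hm hωm hfg K hU hB hBU (integral_eq_half_inner_add hg) Ψ Θ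

/-- Passing from the graph norm of `1 ⊗ dΓ(ω)` to that of the limit operator costs a factor `1 +
‖η‖` in each argument, hence the square. -/
theorem norm_inner_dressedMatrix_le_of_mem_graph {ω : X → ℝ} {m : ℝ} (hω : Measurable ω)
    (hm : 0 < m) (hωm : ∀ᵐ k ∂μ, m ≤ ω k)
    {f g : Lp ℂ 2 μ} (hfg : f =ᵐ[μ] fun k => (ω k : ℂ) * g k)
    {U : Matrix (Fin D) (Fin D) ℂ} (hU : U.conjTranspose * U = 1) {β : Fin D → ℂ}
    {K η : Matrix (Fin D) (Fin D) ℂ}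
    (hη : η = Matrix.diagonal fun j => (U.conjTranspose * K * U) j j)
    (hKβ : ∀ j k, j ≠ k → β j = β k → (U.conjTranspose * K * U) j k = 0)
    {a b x y : Spin D (Fock μ)}
    (hab : (a, b) ∈ (spinTensor η (idOp (Fock μ)) + spinTensor 1 (dGamma μ ω)).graph)
    (hxy : (x, y) ∈ (spinTensor η (idOp (Fock μ)) + spinTensor 1 (dGamma μ ω)).graph) :
    ‖inner ℂ a (dressedMatrix U hU β K η g x)‖ ≤
      decayRate m (U.conjTranspose * K * U) β ‖g‖ *
          (1 + ‖(spinAct η : Spin D (Fock μ) →L[ℂ] Spin D (Fock μ))‖) ^ 2 *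
        ((‖a‖ + ‖b‖) * (‖x‖ + ‖y‖)) := by
  obtain ⟨S, hS⟩ : ∃ S : Spin D (Fock μ) →L[ℂ] Spin D (Fock μ), S = spinAct η := ⟨_, rfl⟩
  rw [mem_graph_spinTensor_idOp_add, mem_graph_spinTensor_one, ← hS] at hab hxy
  rw [← hS]
  have bound : ∀ (u v : Spin D (Fock μ)) (j : Fin D),
      ‖u j‖ + ‖(v - S u) j‖ ≤ (1 + ‖S‖) * (‖u‖ + ‖v‖) := by
    intro u v j
    have h1 : ‖u j‖ ≤ ‖u‖ := PiLp.norm_apply_le _ _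
    have h2 : ‖(v - S u) j‖ ≤ ‖v - S u‖ := PiLp.norm_apply_le _ _
    have h3 := norm_sub_le v (S u)
    have h4 := S.le_opNorm u
    have h5 := mul_nonneg (norm_nonneg S) (norm_nonneg v)
    linarith
  have := norm_inner_dressedMatrix_le hω hm hωm hfg hU hKβ hab hxy (bound a b) (bound x y)
  rw [← hη] at this
  refine this.trans (le_of_eq ?_)
  ring

end Limit

end GSB

end

theorem proposition2p9 {X : Type*} [MeasurableSpace X] (μ : Measure X) [SigmaFinite μ]
    (ω : X → ℝ) (hω : Measurable ω) (m : ℝ) (hm : 0 < m) (hωm : ∀ᵐ k ∂μ, m ≤ ω k)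
    (D : ℕ) (K B : Matrix (Fin D) (Fin D) ℂ) (hK : K.IsHermitian)
    (hKB : GSB.PermutesEigenbasis K B)
    (f : ℕ → Lp ℂ 2 μ)
    (hf : Tendsto (fun Λ => eLpNorm (fun k => ((ω k)⁻¹ : ℂ) * f Λ k) 2 μ) atTop (𝓝 ∞)) :
    ∃ (η₀ : Matrix (Fin D) (Fin D) ℂ)
      (W : ℕ → GSB.Spin D (GSB.Fock μ) ≃ₗᵢ[ℂ] GSB.Spin D (GSB.Fock μ)),
      η₀.IsDiag ∧ η₀.IsHermitian ∧
      GSB.NormResolventTendsto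
        (fun Λ => GSB.conj (W Λ)
          (GSB.hamiltonian ω K B (f Λ)
            - GSB.spinTensor (GSB.selfEnergy ω B (f Λ)) (GSB.idOp (GSB.Fock μ))))
        (GSB.spinTensor η₀ (GSB.idOp (GSB.Fock μ)) + GSB.spinTensor 1 (GSB.dGamma μ ω)) := by
  have hBu := hKB.1
  have hB : B.conjTranspose * B = 1 := Matrix.mem_unitaryGroup_iff'.1 hBu
  obtain ⟨U, β, hU, hBU, hKβ⟩ := GSB.exists_unitary_diagonalization hK hBu
  choose g hg hfg using fun Λ => GSB.exists_div_dispersion hω hm hωm (f Λ)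
  -- The limit matrix is the diagonal part of `K` in the adapted basis; it is independent of `Λ`.
  obtain ⟨η, hη⟩ : ∃ η, η = Matrix.diagonal fun j => (U.conjTranspose * K * U) j j := ⟨_, rfl⟩
  have hηH : η.IsHermitian := by
    rw [hη]
    refine Matrix.isHermitian_diagonal_of_self_adjoint _ (funext fun j => ?_)
    exact (Matrix.isHermitian_conjTranspose_mul_mul U hK).apply j j
  refine ⟨η, fun Λ => GSB.spinWeyl U hU β (g Λ), by rw [hη]; exact Matrix.isDiag_diagonal _, hηH, ?_⟩
  refine GSB.normResolventTendsto_of_form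
    (GSB.isSelfAdjoint_spinTensor_idOp_add_dGamma hω (hωm.mono fun k hk => hm.le.trans hk) hηH)
    (V := fun Λ => GSB.dressedMatrix U hU β K η (g Λ))
    (fun Λ => GSB.dressedMatrix_symmetric U hU β hK hηH (g Λ))
    (fun Λ => GSB.norm_dressedMatrix_apply_le U hU β K η (g Λ))
    (fun Λ => GSB.mem_graph_conj_iff_sub_dressedMatrix hω hm hωm (hg Λ) (hfg Λ) K η hU hB hBU) ?_
    (fun Λ a b x y => GSB.norm_inner_dressedMatrix_le_of_mem_graph hω hm hωm (hfg Λ) hU hη hKβ)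
  -- The remaining goal is that the form bounds tend to zero: the decay rate is evaluated at `‖g Λ‖
  -- → ∞` and multiplied by a constant.
  have h := ((GSB.tendsto_decayRate m (U.conjTranspose * K * U) β).comp
    (GSB.tendsto_norm_div_dispersion hg hf)).mul_const
      ((1 + ‖(GSB.spinAct η : GSB.Spin D (GSB.Fock μ) →L[ℂ] GSB.Spin D (GSB.Fock μ))‖) ^ 2)
  rwa [zero_mul] at h
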